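/- All operads are nonsymmetric dg operads: cochain complexes of $\mathbb Z$-modules in nonnegative degrees $P(n)$ ($n\ge 1$), with a unit and partial compositions $\circ_i:P(n)\otimes P(m)\to P(n+m-1)$ $(1\le i\le n)$ which are morphisms of complexes and satisfy the unit, sequential and parallel associativity axioms with the Koszul sign rule. **The operad $K'$.** For $n\ge 1$ let $K'(n)$ be the complex of cellular cochains of the associahedron of dimension $n-1$: it is the free $\mathbb Z$-module on the planar rooted trees with $n+1$ leaves all of whose vertices have at least two children; the degree (dimension) of a tree is the sum over its vertices of (number of children $-2$). The $n$ sectors of a tree (pairs of consecutive leaves) are numbered from left to right; each is located at one vertex. A tree $T$ is oriented by the exterior product, from left to right, of its sectors which are not the last sector of their vertex. The differential of $T$ is the sum over its inner edges $a$ of $\pm T/a$. Contracting $a$ creates exactly one new factor in the orientation, namely the last sector of the lower vertex of $a$ if $a$ leads to its last child, and the last sector of the upper vertex otherwise; the sign is the one obtained by writing this new factor in front of the orientation of $T$ and sorting from left to right, multiplied by $-1$ in the second case. For trees $x,y$ let $x*y$ be the sum of the trees obtained by shuffling the vertices on the rightmost branch of $x$ with those on the leftmost branch of $y$ (if $x$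 or $y$ is a single leaf, $x*y$ is the other tree). Let $T\in K'(n)$, $S\in K'(m)$ be trees, let $v$ be the vertex of $T$ at which sector $i$ is located, $x_1,\dots,x_k$ the subtrees above $v$, with sector $i$ between $x_a$ and $x_{a+1}$, and $s_1,\dots,s_l$ the subtrees above the root of $S$. Then $T\circ_i S$ is $\pm$ the sum of trees obtained from $T$ by replacing the subtrees above $v$ by $x_1,\dots,x_{a-1},\,x_a*s_1,\,s_2,\dots,s_{l-1},\,s_l*x_{a+1},\,x_{a+2},\dots,x_k$. The common sign is obtained as follows: in the orientation of $T$ replace sector $i$ (if present) by the last sector of the root of $S$, write the orientation of $S$ after it, and sort all factors from left to right. The unit is the tree with two leaves. The complex $K'(2)$ has the basis $(1<2)$, $(1>2)$ of degree $0$ and $(1|2)$ of degree $1$: the binary tree with three leaves whose root carries sector $1$, resp. sector $2$, and the corolla with three leaves; $d(1<2)=(1|2)=-d(1>2)$. **Proposition.** With these definitions $K'$ is a nonsymmetric dg operad. Let $\mathcal F$ be the free nonsymmetric dg operad on the complex $K'(2)$ (placed in arity $2$), and let $I\subset\mathcal F$ be the operadic ideal generated by the relations $$(1>2)\circ_2(1<2)=(1<2)\circ_1(1>2),$$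 $$(1>2)\circ_2(1>2)=(1>2)\circ_1(1>2)+(1>2)\circ_1(1<2),$$ $$(1<2)\circ_1(1<2)=(1<2)\circ_2(1<2)+(1<2)\circ_2(1>2),$$ $$(1>2)\circ_2(1|2)=(1|2)\circ_1(1>2),$$ $$(1<2)\circ_1(1|2)=(1|2)\circ_2(1<2),$$ $$(1|2)\circ_1(1<2)=(1|2)\circ_2(1>2),$$ $$(1|2)\circ_1(1|2)=-(1|2)\circ_2(1|2).$$ Then $I$ is stable under the differential, and there is an isomorphism of nonsymmetric dg operads $\mathcal F/I\cong K'$ which is the identity on the generators $K'(2)$. In particular $K'$ is binary quadratic: it has a presentation by generators of arity $2$ and relations between composites of two generators. -/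

import Mathlib

/-! ### Nonsymmetric differential graded operads

All complexes are cochain complexes in nonnegative degrees, of modules over a commutative ring `R`
(below, `R = ℤ`). -/

/-- The data of a nonsymmetric dg operad: for each arity `n` an `R`-module `obj n` with its homogeneous
parts `gr n p` and a differential, a unit, and partial compositions.  The inputs of an
operation of arity `n` are indexed by `Fin n`, so `comp i` is the composition usually written `∘_{i+1}`;
it sends arities `n` and `m` to the arity `k` with `n + m = k + 1`. -/
structure DGOperadData (R : Type) [CommRing R] where
  obj : ℕ → Type
  [addCommGroup : ∀ n, AddCommGroup (obj n)]
  [module : ∀ n, Module R (obj n)]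
  gr : ∀ n, ℕ → Submodule R (obj n)
  d : ∀ n, obj n →ₗ[R] obj n
  one : obj 1
  comp : ∀ {n m k : ℕ} (_ : Fin n) (_ : n + m = k + 1), obj n →ₗ[R] obj m →ₗ[R] obj k

attribute [instance] DGOperadData.addCommGroup DGOperadData.module

namespace DGOperadData

variable {R : Type} [CommRing R]

/-- The axioms of a nonsymmetric dg operad, with the Koszul sign rule. -/
structure IsDGOperad (P : DGOperadData R) : Prop where
  isInternal : ∀ n, DirectSum.IsInternal (P.gr n)
  one_mem : P.one ∈ P.gr 1 0
  comp_mem : ∀ {n m k p q : ℕ} (i : Fin n) (h : n + m = k + 1) (x : P.obj n) (y : P.obj m),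
    x ∈ P.gr n p → y ∈ P.gr m q → P.comp i h x y ∈ P.gr k (p + q)
  d_mem : ∀ {n p : ℕ} (x : P.obj n), x ∈ P.gr n p → P.d n x ∈ P.gr n (p + 1)
  d_d : ∀ {n : ℕ} (x : P.obj n), P.d n (P.d n x) = 0
  d_one : P.d 1 P.one = 0
  d_comp : ∀ {n m k p : ℕ} (i : Fin n) (h : n + m = k + 1) (x : P.obj n) (y : P.obj m),
    x ∈ P.gr n p →
      P.d k (P.comp i h x y) = P.comp i h (P.d n x) y + (-1 : R) ^ p • P.comp i h x (P.d m y)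
  one_comp : ∀ {n : ℕ} (h : 1 + n = n + 1) (x : P.obj n), P.comp 0 h P.one x = x
  comp_one : ∀ {n : ℕ} (i : Fin n) (h : n + 1 = n + 1) (x : P.obj n), P.comp i h x P.one = x
  /-- Sequential composition: `(x ∘ᵢ y) ∘ᵢ₊ⱼ z = x ∘ᵢ (y ∘ⱼ z)` (inputs counted from `0`). -/
  comp_assoc : ∀ {n m a k r q : ℕ} (h₁ : n + m = k + 1) (h₂ : k + a = q + 1)
    (h₃ : m + a = r + 1) (h₄ : n + r = q + 1) (i : Fin n) (j : Fin m) (l : Fin k)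
    (_ : (l : ℕ) = i + j) (x : P.obj n) (y : P.obj m) (z : P.obj a),
    P.comp l h₂ (P.comp i h₁ x y) z = P.comp i h₄ x (P.comp j h₃ y z)
  /-- Parallel composition: for `i < j`,
  `(x ∘ᵢ y) ∘ⱼ₊ₘ₋₁ z = (-1)^{|y||z|} (x ∘ⱼ z) ∘ᵢ y`, with `m` the arity of `y`. -/
  comp_comm : ∀ {n m a k r q s t : ℕ} (h₁ : n + m = k + 1) (h₂ : k + a = q + 1)
    (h₃ : n + a = r + 1) (h₄ : r + m = q + 1) (i j : Fin n) (_ : i < j)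
    (l : Fin k) (_ : (l : ℕ) + 1 = j + m) (i' : Fin r) (_ : (i' : ℕ) = i)
    (x : P.obj n) (y : P.obj m) (z : P.obj a), y ∈ P.gr m s → z ∈ P.gr a t →
    P.comp l h₂ (P.comp i h₁ x y) z = (-1 : R) ^ (s * t) • P.comp i' h₄ (P.comp j h₃ x z) y

/-- An isomorphism of nonsymmetric dg operads. -/
structure Iso (P Q : DGOperadData R) where
  equiv : ∀ n, P.obj n ≃ₗ[R] Q.obj n
  map_gr : ∀ n p (x : P.obj n), equiv n x ∈ Q.gr n p ↔ x ∈ P.gr n p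
  map_d : ∀ n (x : P.obj n), equiv n (P.d n x) = Q.d n (equiv n x)
  map_one : equiv 1 P.one = Q.one
  map_comp : ∀ {n m k : ℕ} (i : Fin n) (h : n + m = k + 1) (x : P.obj n) (y : P.obj m),
    equiv k (P.comp i h x y) = Q.comp i h (equiv n x) (equiv m y)

/-- An operadic ideal.  Stability under the differential is not part of the definition. -/
structure OpIdeal (P : DGOperadData R) where
  carrier : ∀ n, Submodule R (P.obj n)
  comp_mem_left : ∀ {n m k : ℕ} (i : Fin n) (h : n + m = k + 1) (x : P.obj n) (y : P.obj m),
    x ∈ carrier n → P.comp i h x y ∈ carrier k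
  comp_mem_right : ∀ {n m k : ℕ} (i : Fin n) (h : n + m = k + 1) (x : P.obj n) (y : P.obj m),
    y ∈ carrier m → P.comp i h x y ∈ carrier k

/-- The operadic ideal generated by a set of operations of arity `a`. -/
def idealSpan (P : DGOperadData R) {a : ℕ} (S : Set (P.obj a)) : P.OpIdeal where
  carrier n := ⨅ (J : P.OpIdeal) (_ : S ⊆ J.carrier a), J.carrier n
  comp_mem_left i h x y hx := by
    simp only [Submodule.mem_iInf] at hx ⊢
    exact fun J hJ => J.comp_mem_left i h x y (hx J hJ)
  comp_mem_right i h x y hy := by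
    simp only [Submodule.mem_iInf] at hy ⊢
    exact fun J hJ => J.comp_mem_right i h x y (hy J hJ)

/-- Stability of an ideal under the differential. -/
def OpIdeal.IsDStable {P : DGOperadData R} (I : P.OpIdeal) : Prop :=
  ∀ n (x : P.obj n), x ∈ I.carrier n → P.d n x ∈ I.carrier n

/-- The composition induced on the quotient by an ideal. -/
def quotientComp (P : DGOperadData R) (I : P.OpIdeal) {n m k : ℕ} (i : Fin n)
    (h : n + m = k + 1) :
    (P.obj n ⧸ I.carrier n) →ₗ[R] (P.obj m ⧸ I.carrier m) →ₗ[R] (P.obj k ⧸ I.carrier k) :=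
  (I.carrier n).liftQ
    { toFun := fun x => (I.carrier m).mapQ (I.carrier k) (P.comp i h x)
        (fun y hy => I.comp_mem_right i h x y hy)
      map_add' := fun x x' => LinearMap.ext fun y => by
        obtain ⟨y, rfl⟩ := Submodule.mkQ_surjective _ y; simp
      map_smul' := fun c x => LinearMap.ext fun y => by
        obtain ⟨y, rfl⟩ := Submodule.mkQ_surjective _ y; simp }
    (fun x hx => by
      rw [LinearMap.mem_ker]
      refine LinearMap.ext fun y => ?_
      obtain ⟨y, rfl⟩ := Submodule.mkQ_surjective _ y
      simpa using I.comp_mem_left i h x y hx)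

/-- The quotient of a dg operad by an ideal stable under the differential. -/
def quotient (P : DGOperadData R) (I : P.OpIdeal) (hd : I.IsDStable) : DGOperadData R where
  obj n := P.obj n ⧸ I.carrier n
  gr n p := (P.gr n p).map (I.carrier n).mkQ
  d n := (I.carrier n).mapQ (I.carrier n) (P.d n) (hd n)
  one := (I.carrier 1).mkQ P.one
  comp i h := P.quotientComp I i h

end DGOperadData

/-! ### Linear algebra on free modules -/

/-- The bilinear extension of a map defined on basis elements. -/
noncomputable def bilinExt {α β γ : Type} (f : α → β → γ →₀ ℤ) :
    (α →₀ ℤ) →ₗ[ℤ] (β →₀ ℤ) →ₗ[ℤ] (γ →₀ ℤ) :=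
  Finsupp.linearCombination ℤ fun a => Finsupp.linearCombination ℤ (f a)

theorem linearCombination_mem_supported {α β : Type} {s : Set α} {t : Set β}
    {f : α → β →₀ ℤ} (hf : ∀ a ∈ s, f a ∈ Finsupp.supported ℤ ℤ t) {x : α →₀ ℤ}
    (hx : x ∈ Finsupp.supported ℤ ℤ s) :
    Finsupp.linearCombination ℤ f x ∈ Finsupp.supported ℤ ℤ t := by
  rw [Finsupp.linearCombination_apply, Finsupp.sum]
  exact Submodule.sum_mem _ fun a ha =>
    Submodule.smul_mem _ _ (hf a ((Finsupp.mem_supported ℤ x).1 hx ha))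

theorem bilinExt_mem_supported {α β γ : Type} {s : Set α} {t : Set β} {u : Set γ}
    {f : α → β → γ →₀ ℤ} (hf : ∀ a ∈ s, ∀ b ∈ t, f a b ∈ Finsupp.supported ℤ ℤ u)
    {x : α →₀ ℤ} {y : β →₀ ℤ} (hx : x ∈ Finsupp.supported ℤ ℤ s)
    (hy : y ∈ Finsupp.supported ℤ ℤ t) :
    bilinExt f x y ∈ Finsupp.supported ℤ ℤ u := by
  rw [bilinExt, Finsupp.linearCombination_apply, Finsupp.sum, LinearMap.sum_apply]
  refine Submodule.sum_mem _ fun a ha => ?_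
  rw [LinearMap.smul_apply]
  exact Submodule.smul_mem _ _
    (linearCombination_mem_supported (hf a ((Finsupp.mem_supported ℤ x).1 hx ha)) hy)

theorem mapDomain_mem_supported {α β : Type} {s : Set α} {t : Set β} {f : α → β}
    (hf : ∀ a ∈ s, f a ∈ t) {x : α →₀ ℤ} (hx : x ∈ Finsupp.supported ℤ ℤ s) :
    x.mapDomain f ∈ Finsupp.supported ℤ ℤ t := by
  classical
  rw [Finsupp.mem_supported] at hx ⊢
  intro b hb
  obtain ⟨a, ha, rfl⟩ := Finset.mem_image.1 (Finsupp.mapDomain_support hb)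
  exact hf a (hx ha)

/-- `linearCombination` restricted to the submodules spanned by parts of the bases. -/
noncomputable def restrictLin {α β : Type} {s : Set α} {t : Set β} (f : α → β →₀ ℤ)
    (hf : ∀ a ∈ s, f a ∈ Finsupp.supported ℤ ℤ t) :
    Finsupp.supported ℤ ℤ s →ₗ[ℤ] Finsupp.supported ℤ ℤ t :=
  (Finsupp.linearCombination ℤ f).restrict fun _ hx => linearCombination_mem_supported hf hx

/-- `bilinExt` restricted to the submodules spanned by parts of the bases. -/
noncomputable def restrictBilin {α β γ : Type} {s : Set α} {t : Set β} {u : Set γ}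
    (f : α → β → γ →₀ ℤ) (hf : ∀ a ∈ s, ∀ b ∈ t, f a b ∈ Finsupp.supported ℤ ℤ u) :
    Finsupp.supported ℤ ℤ s →ₗ[ℤ] Finsupp.supported ℤ ℤ t →ₗ[ℤ] Finsupp.supported ℤ ℤ u :=
  LinearMap.mk₂ ℤ (fun x y => ⟨bilinExt f x y, bilinExt_mem_supported hf x.2 y.2⟩)
    (fun _ _ _ => Subtype.ext (by simp)) (fun _ _ _ => Subtype.ext (by simp))
    (fun _ _ _ => Subtype.ext (by simp)) (fun _ _ _ => Subtype.ext (by simp))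

/-! ### Planar trees -/

mutual
/-- Planar rooted trees in which every vertex has at least two children: a leaf, or a root
vertex with a first child `c` and the nonempty sequence `cs` of its other children. -/
inductive PTree : Type
  | leaf : PTree
  | node (c : PTree) (cs : PForest) : PTree
/-- Nonempty sequences of planar trees. -/
inductive PForest : Type
  | one (c : PTree) : PForest
  | cons (c : PTree) (cs : PForest) : PForest
end

mutual
/-- The number of sectors (pairs of consecutive leaves) of a tree: the number of leaves minus one.
Sectors are numbered from left to right, starting at `0`. -/
def PTree.sectors : PTree → ℕ
  | .leaf => 0
  | .node c cs => c.sectors + cs.sectors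
/-- The number of sectors of a sequence of siblings, each tree being counted together with the
sector that separates it from its left neighbour. -/
def PForest.sectors : PForest → ℕ
  | .one c => 1 + c.sectors
  | .cons c cs => 1 + c.sectors + cs.sectors
end

mutual
/-- The dimension of the cell indexed by a tree: the sum over the vertices of the number of
children minus two.  A sector belongs to the vertex at which it is located; the dimension is
the number of sectors that are not the last one of their vertex.  The cell is oriented by the
exterior product of these sectors, taken from left to right. -/
def PTree.dim : PTree → ℕ
  | .leaf => 0
  | .node c cs => c.dim + cs.dim
/-- The contribution to the dimension of the children of a vertex other than the first. -/
def PForest.dim : PForest → ℕ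
  | .one c => c.dim
  | .cons c cs => 1 + c.dim + cs.dim
end

/-- The contribution to `PForest.dim` of everything left of the last sector of the vertex. -/
def PForest.dimBeforeLast : PForest → ℕ
  | .one _ => 0
  | .cons c cs => 1 + c.dim + cs.dimBeforeLast

/-- Concatenation of sequences of trees. -/
def PForest.append : PForest → PForest → PForest
  | .one c, ds => .cons c ds
  | .cons c cs, ds => .cons c (cs.append ds)

namespace PTree

mutual
/-- `shuffle x y` is the sum of the trees obtained by shuffling the vertices on the rightmost branch of `x`
with the vertices on the leftmost branch of `y`. -/
noncomputable def shuffle : PTree → PTree → PTree →₀ ℤ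
  | .leaf, y => Finsupp.single y 1
  | .node c cs, .leaf => Finsupp.single (.node c cs) 1
  | .node c cs, .node d ds =>
      (shuffleLast cs (.node d ds)).mapDomain (fun f => .node c f) +
        (shuffle (.node c cs) d).mapDomain (fun t => .node t ds)
  termination_by x y => sizeOf x + sizeOf y
/-- Replace the last tree `t` of a sequence by `shuffle t y`. -/
noncomputable def shuffleLast : PForest → PTree → PForest →₀ ℤ
  | .one c, y => (shuffle c y).mapDomain .one
  | .cons c cs, y => (shuffleLast cs y).mapDomain (fun f => .cons c f)
  termination_by cs y => sizeOf cs + sizeOf y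
end

/-- The sequence `ss` followed by the sequence `cs`, where the last tree `l` of `ss` and the first tree
`c` of `cs` are merged into `shuffle l c`. -/
noncomputable def glue : PForest → PForest → PForest →₀ ℤ
  | .one l, .one c => (shuffle l c).mapDomain .one
  | .one l, .cons c cs => (-1 : ℤ) ^ l.dim • (shuffle l c).mapDomain (fun t => .cons t cs)
  | .cons s ss, cs => (glue ss cs).mapDomain (fun f => .cons s f)

/-- Insertion of a tree with root children `s, ss` in the sector between `c` and the first tree
of `cs`; gives the new children of the vertex, from `c` on. -/
noncomputable def splice (c : PTree) (S : PTree) (cs : PForest) : PTree × PForest →₀ ℤ :=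
  match S with
  | .leaf => 0
  | .node s ss => bilinExt (fun t f => Finsupp.single (t, f) 1) (shuffle c s) (glue ss cs)

mutual
/-- The composite `T ∘ᵢ S` of two trees: the root of `S` is merged with the vertex of `T` at which
the sector `i` is located, and then the two subtrees of `T` adjacent to the sector
are merged with the outer subtrees of the root of `S` by `shuffle`.  The sign: in the orientation of `T`
the sector `i` is replaced by the last sector of the root of `S`, the orientation of `S` is
put after it, and all the factors are then sorted from left to right. -/
noncomputable def compAt : PTree → ℕ → PTree → PTree →₀ ℤ
  | .leaf, _, _ => 0
  | .node c cs, i, S =>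
      if i < c.sectors then
        (-1 : ℤ) ^ (S.dim * cs.dim) • (compAt c i S).mapDomain (fun t => .node t cs)
      else if i = c.sectors then
        (-1 : ℤ) ^ (S.dim * cs.dim) • (splice c S cs).mapDomain (fun p => .node p.1 p.2)
      else (compAtForest cs (i - c.sectors - 1) S).mapDomain (fun f => .node c f)
/-- The same for a sequence of siblings; the sector on the left of the first one is not counted. -/
noncomputable def compAtForest : PForest → ℕ → PTree → PForest →₀ ℤ
  | .one c, i, S => (compAt c i S).mapDomain .one
  | .cons c cs, i, S =>
      if i < c.sectors then
        (-1 : ℤ) ^ (S.dim * cs.dim) • (compAt c i S).mapDomain (fun t => .cons t cs)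
      else if i = c.sectors then
        (-1 : ℤ) ^ (S.dim * cs.dim) • (splice c S cs).mapDomain (fun p => .cons p.1 p.2)
      else (compAtForest cs (i - c.sectors - 1) S).mapDomain (fun f => .cons c f)
end

/-- Contraction of the edge below a child `c` that is not the last child of its vertex, `cs` being the
siblings on its right.  The last sector of the root of `c` is the new factor of the
orientation. -/
noncomputable def contract (c : PTree) (cs : PForest) : PTree × PForest →₀ ℤ :=
  match c with
  | .leaf => 0
  | .node e es => Finsupp.single (e, es.append cs) (-(-1 : ℤ) ^ (e.dim + es.dimBeforeLast))

/-- Contraction of the edge below the last child of a vertex. -/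
noncomputable def contractLast (c : PTree) : PForest →₀ ℤ :=
  match c with
  | .leaf => 0
  | .node e es => Finsupp.single (.cons e es) 1

mutual
/-- The cellular coboundary of a tree: the signed sum of the trees obtained by contracting one
inner edge.  The contraction creates one new factor of the orientation, put in front; there
is a further sign `-1` if the upper vertex is not the last child of the lower one. -/
noncomputable def cobd : PTree → PTree →₀ ℤ
  | .leaf => 0
  | .node c cs =>
      (cobd c).mapDomain (fun t => .node t cs) +
        (contract c cs).mapDomain (fun p => .node p.1 p.2) +
        (-1 : ℤ) ^ c.dim • (cobdForest cs).mapDomain (fun f => .node c f)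
/-- The part of the coboundary that comes from the edges below and in the children of a vertex other than
the first. -/
noncomputable def cobdForest : PForest → PForest →₀ ℤ
  | .one c => (cobd c).mapDomain .one + contractLast c
  | .cons c cs =>
      -((cobd c).mapDomain (fun t => .cons t cs) +
        (contract c cs).mapDomain (fun p => .cons p.1 p.2) +
        (-1 : ℤ) ^ c.dim • (cobdForest cs).mapDomain (fun f => .cons c f))
end

/-- The cells of the associahedron of dimension `n - 1`: planar trees with `n + 1` leaves, for
`n ≥ 1`. -/
def cells (n : ℕ) : Set PTree := {T | T ≠ .leaf ∧ T.sectors = n}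

/-! The operations above are compatible with the numbers of sectors. -/

theorem sectors_forest_pos (cs : PForest) : 1 ≤ cs.sectors := by
  cases cs <;> simp only [PForest.sectors] <;> omega

theorem mem_cells_iff {n : ℕ} {T : PTree} : T ∈ cells n ↔ 1 ≤ n ∧ T.sectors = n := by
  cases T with
  | leaf => simp only [cells, Set.mem_ofPred_eq, PTree.sectors]; simp; omega
  | node c cs =>
    have := sectors_forest_pos cs
    simp only [cells, Set.mem_ofPred_eq, PTree.sectors]
    simp
    omega

theorem append_sectors : ∀ cs ds : PForest,
    (cs.append ds).sectors = cs.sectors + ds.sectors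
  | .one c, ds => by simp only [PForest.append, PForest.sectors]
  | .cons c cs, ds => by
      simp only [PForest.append, PForest.sectors, append_sectors cs ds]; omega

/-- The set of trees with a given number of sectors, including the leaf. -/
def withSectors (n : ℕ) : Set PTree := {T | T.sectors = n}

/-- The set of sequences of trees with a given number of sectors. -/
def forestWithSectors (n : ℕ) : Set PForest := {F | F.sectors = n}

theorem withSectors_eq {n : ℕ} (hn : 1 ≤ n) : withSectors n = cells n := by
  ext T; simp [mem_cells_iff, withSectors, hn]

mutual
theorem shuffle_mem : ∀ x y : PTree,
    shuffle x y ∈ Finsupp.supported ℤ ℤ (withSectors (x.sectors + y.sectors))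
  | .leaf, y => by
      rw [shuffle]
      exact Finsupp.single_mem_supported ℤ _ (by simp [withSectors, PTree.sectors])
  | .node c cs, .leaf => by
      rw [shuffle]
      exact Finsupp.single_mem_supported ℤ _ (by simp [withSectors, PTree.sectors])
  | .node c cs, .node d ds => by
      rw [shuffle]
      refine Submodule.add_mem _
        (mapDomain_mem_supported (fun a ha => ?_) (shuffleLast_mem cs (.node d ds)))
        (mapDomain_mem_supported (fun a ha => ?_) (shuffle_mem (.node c cs) d))
      · simp only [forestWithSectors, withSectors, Set.mem_ofPred_eq, PTree.sectors] at ha ⊢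
        omega
      · simp only [withSectors, Set.mem_ofPred_eq, PTree.sectors] at ha ⊢
        omega
  termination_by x y => sizeOf x + sizeOf y
theorem shuffleLast_mem : ∀ (cs : PForest) (y : PTree),
    shuffleLast cs y ∈ Finsupp.supported ℤ ℤ (forestWithSectors (cs.sectors + y.sectors))
  | .one c, y => by
      rw [shuffleLast]
      refine mapDomain_mem_supported (fun a ha => ?_) (shuffle_mem c y)
      simp only [forestWithSectors, withSectors, Set.mem_ofPred_eq, PForest.sectors] at ha ⊢
      omega
  | .cons c cs, y => by
      rw [shuffleLast]
      refine mapDomain_mem_supported (fun a ha => ?_) (shuffleLast_mem cs y)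
      simp only [forestWithSectors, Set.mem_ofPred_eq, PForest.sectors] at ha ⊢
      omega
  termination_by cs y => sizeOf cs + sizeOf y
end

theorem glue_mem : ∀ ss cs : PForest,
    glue ss cs ∈ Finsupp.supported ℤ ℤ (forestWithSectors (ss.sectors + cs.sectors - 1))
  | .one l, .one c => by
      rw [glue]
      refine mapDomain_mem_supported (fun a ha => ?_) (shuffle_mem l c)
      simp only [forestWithSectors, withSectors, Set.mem_ofPred_eq, PForest.sectors] at ha ⊢
      omega
  | .one l, .cons c cs => by
      rw [glue]
      refine Submodule.smul_mem _ _
        (mapDomain_mem_supported (fun a ha => ?_) (shuffle_mem l c))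
      simp only [forestWithSectors, withSectors, Set.mem_ofPred_eq, PForest.sectors] at ha ⊢
      omega
  | .cons s ss, cs => by
      rw [glue]
      refine mapDomain_mem_supported (fun a ha => ?_) (glue_mem ss cs)
      have := sectors_forest_pos ss
      simp only [forestWithSectors, Set.mem_ofPred_eq, PForest.sectors] at ha ⊢
      omega

theorem splice_mem (c S : PTree) (cs : PForest) :
    splice c S cs ∈ Finsupp.supported ℤ ℤ
      {p | p.1.sectors + p.2.sectors + 1 = c.sectors + S.sectors + cs.sectors} := by
  cases S with
  | leaf => simp [splice]
  | node s ss =>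
    refine bilinExt_mem_supported (fun t ht f hf => ?_) (shuffle_mem c s) (glue_mem ss cs)
    refine Finsupp.single_mem_supported ℤ _ ?_
    have := sectors_forest_pos ss
    simp only [forestWithSectors, withSectors, Set.mem_ofPred_eq, PTree.sectors] at ht hf ⊢
    omega

mutual
theorem compAt_mem : ∀ (T : PTree) (i : ℕ) (S : PTree),
    compAt T i S ∈ Finsupp.supported ℤ ℤ {U | U.sectors + 1 = T.sectors + S.sectors}
  | .leaf, _, _ => by simp [compAt]
  | .node c cs, i, S => by
      rw [compAt]
      split_ifs
      · refine Submodule.smul_mem _ _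
          (mapDomain_mem_supported (fun a ha => ?_) (compAt_mem c i S))
        simp only [Set.mem_ofPred_eq, PTree.sectors] at ha ⊢
        omega
      · refine Submodule.smul_mem _ _
          (mapDomain_mem_supported (fun a ha => ?_) (splice_mem c S cs))
        simp only [Set.mem_ofPred_eq, PTree.sectors] at ha ⊢
        omega
      · refine mapDomain_mem_supported (fun a ha => ?_)
          (compAtForest_mem cs (i - c.sectors - 1) S)
        simp only [Set.mem_ofPred_eq, PTree.sectors] at ha ⊢
        omega
theorem compAtForest_mem : ∀ (T : PForest) (i : ℕ) (S : PTree),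
    compAtForest T i S ∈ Finsupp.supported ℤ ℤ {U | U.sectors + 1 = T.sectors + S.sectors}
  | .one c, i, S => by
      rw [compAtForest]
      refine mapDomain_mem_supported (fun a ha => ?_) (compAt_mem c i S)
      simp only [Set.mem_ofPred_eq, PForest.sectors] at ha ⊢
      omega
  | .cons c cs, i, S => by
      rw [compAtForest]
      split_ifs
      · refine Submodule.smul_mem _ _
          (mapDomain_mem_supported (fun a ha => ?_) (compAt_mem c i S))
        simp only [Set.mem_ofPred_eq, PForest.sectors] at ha ⊢
        omega
      · refine Submodule.smul_mem _ _
          (mapDomain_mem_supported (fun a ha => ?_) (splice_mem c S cs))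
        simp only [Set.mem_ofPred_eq, PForest.sectors] at ha ⊢
        omega
      · refine mapDomain_mem_supported (fun a ha => ?_)
          (compAtForest_mem cs (i - c.sectors - 1) S)
        simp only [Set.mem_ofPred_eq, PForest.sectors] at ha ⊢
        omega
end

theorem contract_mem (c : PTree) (cs : PForest) :
    contract c cs ∈ Finsupp.supported ℤ ℤ
      {p | p.1.sectors + p.2.sectors = c.sectors + cs.sectors} := by
  cases c with
  | leaf => simp [contract]
  | node e es =>
    refine Finsupp.single_mem_supported ℤ _ ?_
    simp only [Set.mem_ofPred_eq, PTree.sectors, append_sectors]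
    omega

theorem contractLast_mem (c : PTree) :
    contractLast c ∈ Finsupp.supported ℤ ℤ (forestWithSectors (1 + c.sectors)) := by
  cases c with
  | leaf => simp [contractLast]
  | node e es =>
    refine Finsupp.single_mem_supported ℤ _ ?_
    simp only [forestWithSectors, Set.mem_ofPred_eq, PTree.sectors, PForest.sectors]
    omega

mutual
theorem cobd_mem : ∀ T : PTree, cobd T ∈ Finsupp.supported ℤ ℤ (withSectors T.sectors)
  | .leaf => by simp [cobd]
  | .node c cs => by
      rw [cobd]
      refine Submodule.add_mem _ (Submodule.add_mem _
        (mapDomain_mem_supported (fun a ha => ?_) (cobd_mem c))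
        (mapDomain_mem_supported (fun a ha => ?_) (contract_mem c cs)))
        (Submodule.smul_mem _ _
          (mapDomain_mem_supported (fun a ha => ?_) (cobdForest_mem cs))) <;>
      · simp only [forestWithSectors, withSectors, Set.mem_ofPred_eq, PTree.sectors] at ha ⊢
        omega
theorem cobdForest_mem : ∀ T : PForest,
    cobdForest T ∈ Finsupp.supported ℤ ℤ (forestWithSectors T.sectors)
  | .one c => by
      rw [cobdForest]
      refine Submodule.add_mem _
        (mapDomain_mem_supported (fun a ha => ?_) (cobd_mem c)) (contractLast_mem c)
      simp only [forestWithSectors, withSectors, Set.mem_ofPred_eq, PForest.sectors] at ha ⊢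
      omega
  | .cons c cs => by
      rw [cobdForest]
      refine Submodule.neg_mem _ (Submodule.add_mem _ (Submodule.add_mem _
        (mapDomain_mem_supported (fun a ha => ?_) (cobd_mem c))
        (mapDomain_mem_supported (fun a ha => ?_) (contract_mem c cs)))
        (Submodule.smul_mem _ _
          (mapDomain_mem_supported (fun a ha => ?_) (cobdForest_mem cs)))) <;>
      · simp only [forestWithSectors, withSectors, Set.mem_ofPred_eq, PForest.sectors] at ha ⊢
        omega
end

theorem compAt_mem_cells {n m k : ℕ} (h : n + m = k + 1) (i : ℕ) (T : PTree)
    (hT : T ∈ cells n) (S : PTree) (hS : S ∈ cells m) :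
    compAt T i S ∈ Finsupp.supported ℤ ℤ (cells k) := by
  refine Finsupp.supported_mono (fun U hU => ?_) (compAt_mem T i S)
  rw [mem_cells_iff] at hT hS ⊢
  simp only [Set.mem_ofPred_eq] at hU
  omega

theorem cobd_mem_cells {n : ℕ} (T : PTree) (hT : T ∈ cells n) :
    cobd T ∈ Finsupp.supported ℤ ℤ (cells n) := by
  rw [mem_cells_iff] at hT
  have := cobd_mem T
  rwa [hT.2, withSectors_eq hT.1] at this

/-- The tree with two leaves. -/
def unit : PTree := .node .leaf (.one .leaf)

/-- The tree `1 < 2`: three leaves, binary, its root vertex carrying the first sector. -/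
def lt : PTree := .node .leaf (.one (.node .leaf (.one .leaf)))

/-- The tree `1 > 2`: three leaves, binary, its root vertex carrying the second sector. -/
def gt : PTree := .node (.node .leaf (.one .leaf)) (.one .leaf)

/-- The tree `1 | 2`: the corolla with three leaves. -/
def bar : PTree := .node .leaf (.cons .leaf (.one .leaf))

theorem unit_mem : unit ∈ cells 1 := by
  simp [mem_cells_iff, unit, PTree.sectors, PForest.sectors]

theorem lt_mem : lt ∈ cells 2 := by
  simp [mem_cells_iff, lt, PTree.sectors, PForest.sectors]

theorem gt_mem : gt ∈ cells 2 := by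
  simp [mem_cells_iff, gt, PTree.sectors, PForest.sectors]

theorem bar_mem : bar ∈ cells 2 := by
  simp [mem_cells_iff, bar, PTree.sectors, PForest.sectors]

end PTree

/-- The operad `K'`: in arity `n`, the cellular cochain complex of the associahedron of dimension
`n - 1`, a tree being identified with the corresponding basis cochain. -/
noncomputable def KPrime : DGOperadData ℤ where
  obj n := Finsupp.supported ℤ ℤ (PTree.cells n)
  gr n p := (Finsupp.supported ℤ ℤ {T : PTree | T.dim = p}).comap
    (Finsupp.supported ℤ ℤ (PTree.cells n)).subtype
  d _ := restrictLin PTree.cobd PTree.cobd_mem_cells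
  one := ⟨Finsupp.single PTree.unit 1, Finsupp.single_mem_supported ℤ _ PTree.unit_mem⟩
  comp i h := restrictBilin (fun T S => PTree.compAt T i S) (PTree.compAt_mem_cells h i)

/-- The basis cochain of `K'(n)` given by a tree. -/
noncomputable def KPrime.cell {n : ℕ} (T : PTree.cells n) : KPrime.obj n :=
  ⟨Finsupp.single T.1 1, Finsupp.single_mem_supported ℤ _ T.2⟩

/-! ### Free operads on binary generators -/

/-- Planar binary trees whose vertices are labelled by `G`. -/
inductive FTree (G : Type) : Type
  | leaf : FTree G
  | node (g : G) (l r : FTree G) : FTree G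

namespace FTree

variable {G : Type}

/-- The number of leaves, which are numbered from left to right, starting at `0`. -/
def arity : FTree G → ℕ
  | leaf => 1
  | node _ l r => l.arity + r.arity

/-- The total degree of the labels.  A tree stands for the tensor product of its labels in the
order: root, left subtree, right subtree. -/
def degree (deg : G → ℕ) : FTree G → ℕ
  | leaf => 0
  | node g l r => deg g + l.degree deg + r.degree deg

/-- Grafting of the tree `T` on the leaf `i`. -/
def graft : FTree G → ℕ → FTree G → FTree G
  | leaf, _, T => T
  | node g l r, i, T =>
      if i < l.arity then node g (l.graft i T) r else node g l (r.graft (i - l.arity) T)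

/-- The total degree of the labels that come after the leaf `i`, in the order above. -/
def degreeAfter (deg : G → ℕ) : FTree G → ℕ → ℕ
  | leaf, _ => 0
  | node _ l r, i =>
      if i < l.arity then l.degreeAfter deg i + r.degree deg
      else r.degreeAfter deg (i - l.arity)

/-- Grafting with the Koszul sign. -/
noncomputable def compAt (deg : G → ℕ) (S : FTree G) (i : ℕ) (T : FTree G) : FTree G →₀ ℤ :=
  Finsupp.single (S.graft i T) ((-1) ^ (T.degree deg * S.degreeAfter deg i))

/-- The differential of the generators, extended as a derivation. -/
noncomputable def diff (deg : G → ℕ) (dG : G → G →₀ ℤ) : FTree G → FTree G →₀ ℤ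
  | leaf => 0
  | node g l r =>
      (dG g).mapDomain (fun g' => node g' l r) +
        (-1 : ℤ) ^ deg g • (diff deg dG l).mapDomain (fun l' => node g l' r) +
        (-1 : ℤ) ^ (deg g + l.degree deg) • (diff deg dG r).mapDomain (fun r' => node g l r')

/-- The trees with `n` leaves. -/
def withArity (G : Type) (n : ℕ) : Set (FTree G) := {T | T.arity = n}

theorem arity_pos : ∀ T : FTree G, 1 ≤ T.arity
  | leaf => le_refl 1
  | node _ l r => by have := arity_pos l; simp only [arity]; omega

theorem graft_arity : ∀ (S : FTree G) (i : ℕ) (T : FTree G),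
    (S.graft i T).arity + 1 = S.arity + T.arity
  | leaf, i, T => by simp only [graft, arity]; omega
  | node g l r, i, T => by
      have hl := graft_arity l i T
      have hr := graft_arity r (i - l.arity) T
      simp only [graft]
      split_ifs <;> simp only [arity] <;> omega

theorem compAt_mem (deg : G → ℕ) {n m k : ℕ} (h : n + m = k + 1) (i : ℕ) (S : FTree G)
    (hS : S ∈ withArity G n) (T : FTree G) (hT : T ∈ withArity G m) :
    S.compAt deg i T ∈ Finsupp.supported ℤ ℤ (withArity G k) := by
  refine Finsupp.single_mem_supported ℤ _ ?_
  have := graft_arity S i T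
  simp only [withArity, Set.mem_ofPred_eq] at hS hT ⊢
  omega

theorem diff_mem (deg : G → ℕ) (dG : G → G →₀ ℤ) : ∀ T : FTree G,
    T.diff deg dG ∈ Finsupp.supported ℤ ℤ (withArity G T.arity)
  | leaf => by simp [diff]
  | node g l r => by
      rw [diff]
      refine Submodule.add_mem _ (Submodule.add_mem _
        (mapDomain_mem_supported (s := Set.univ) (fun a _ => ?_) (by simp))
        (Submodule.smul_mem _ _
          (mapDomain_mem_supported (fun a ha => ?_) (diff_mem deg dG l))))
        (Submodule.smul_mem _ _
          (mapDomain_mem_supported (fun a ha => ?_) (diff_mem deg dG r)))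
      · simp only [withArity, Set.mem_ofPred_eq, arity]
      · simp only [withArity, Set.mem_ofPred_eq, arity] at ha ⊢
        omega
      · simp only [withArity, Set.mem_ofPred_eq, arity] at ha ⊢
        omega

end FTree

/-- The free nonsymmetric dg operad on a complex `E` placed in arity two, where `E` is the free module on `G`,
with generators in the degrees `deg` and with the differential `dG`: its component of arity `n`
is the sum, over the planar binary trees with `n` leaves, of tensor powers of `E`. -/
noncomputable def freeBinaryOperad (G : Type) (deg : G → ℕ) (dG : G → G →₀ ℤ) :
    DGOperadData ℤ where
  obj n := Finsupp.supported ℤ ℤ (FTree.withArity G n)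
  gr n p := (Finsupp.supported ℤ ℤ {T : FTree G | T.degree deg = p}).comap
    (Finsupp.supported ℤ ℤ (FTree.withArity G n)).subtype
  d n := restrictLin (FTree.diff deg dG) (fun T hT => by
    have := FTree.diff_mem deg dG T
    rwa [show T.arity = n from hT] at this)
  one := ⟨Finsupp.single .leaf 1, Finsupp.single_mem_supported ℤ _ rfl⟩
  comp i h := restrictBilin (fun S T => S.compAt deg i T) (FTree.compAt_mem deg h i)

/-- A generator, as an operation of arity two. -/
noncomputable def freeBinaryOperad.gen {G : Type} (deg : G → ℕ) (dG : G → G →₀ ℤ) (g : G) :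
    (freeBinaryOperad G deg dG).obj 2 :=
  ⟨Finsupp.single (.node g .leaf .leaf) 1, Finsupp.single_mem_supported ℤ _ rfl⟩

/-- A dg operad is binary quadratic if it has a presentation by generators in arity two (here, a free
`ℤ`-module) and quadratic relations: relations between composites of two
generators, that is, relations in arity three. -/
def DGOperadData.IsBinaryQuadratic (P : DGOperadData ℤ) : Prop :=
  ∃ (G : Type) (deg : G → ℕ) (dG : G → G →₀ ℤ)
    (S : Set ((freeBinaryOperad G deg dG).obj 3))
    (hd : ((freeBinaryOperad G deg dG).idealSpan S).IsDStable),
    (freeBinaryOperad G deg dG).IsDGOperad ∧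
      Nonempty (((freeBinaryOperad G deg dG).quotient _ hd).Iso P)

/-! ### The presentation of `K'` -/

/-- The free nonsymmetric dg operad on the complex `K'(2)`, whose basis is the set of cells. -/
noncomputable def freeK : DGOperadData ℤ :=
  freeBinaryOperad (PTree.cells 2) (fun T => T.1.dim)
    (fun T => Finsupp.supportedEquivFinsupp (R := ℤ) (PTree.cells 2)
      (KPrime.d 2 (KPrime.cell T)))

/-- The generator of `freeK` given by a cell of `K'(2)`. -/
noncomputable def freeK.gen (T : PTree.cells 2) : freeK.obj 2 := freeBinaryOperad.gen _ _ T

namespace freeK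

/-- `1 < 2` -/
noncomputable def lt : freeK.obj 2 := gen ⟨PTree.lt, PTree.lt_mem⟩

/-- `1 > 2` -/
noncomputable def gt : freeK.obj 2 := gen ⟨PTree.gt, PTree.gt_mem⟩

/-- `1 | 2` -/
noncomputable def bar : freeK.obj 2 := gen ⟨PTree.bar, PTree.bar_mem⟩

/-- `x ∘₁ y` -/
noncomputable def o₁ (x y : freeK.obj 2) : freeK.obj 3 :=
  freeK.comp (m := 2) (k := 3) (0 : Fin 2) rfl x y

/-- `x ∘₂ y` -/
noncomputable def o₂ (x y : freeK.obj 2) : freeK.obj 3 :=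
  freeK.comp (m := 2) (k := 3) (1 : Fin 2) rfl x y

/-- The seven relations, each written as the difference of its two sides. -/
noncomputable def relations : Set (freeK.obj 3) :=
  {o₂ gt lt - o₁ lt gt,
    o₂ gt gt - (o₁ gt gt + o₁ gt lt),
    o₁ lt lt - (o₂ lt lt + o₂ lt gt),
    o₂ gt bar - o₁ bar gt,
    o₁ lt bar - o₂ bar lt,
    o₁ bar lt - o₂ bar gt,
    o₁ bar bar - (-o₂ bar bar)}

end freeK

/-! ### Linear structure of the spaces spanned by trees -/

-- The span of all trees carries three products. For trees x, y with a root, x < y is the part of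
-- the shuffle x * y whose root is the root of x, x > y is the part whose root is that of y, and x |
-- y is the signed sum obtained by identifying the two roots. Thus x * y = x < y + x > y, and
-- associativity of the shuffle, together with the sign rules for |, gives seven identities between
-- these products. Evaluated at the unit tree they are the seven relations.
--
-- Two facts make these products operadic. First, the coboundary is a derivation for them up to d(<)
-- = | and d(>) = -|: contracting an edge that joins a vertex of x to a vertex of y is the only
-- deviation (`dT_opT`). Second, inserting a tree in a sector of x or of y acts on that factor
-- alone, up to the Koszul sign (`cB_opT_left`, `cB_opT_right`). The same recursions define the
-- differential and the grafting of labelled binary trees. Hence `psi`, which reads a labelled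
-- binary tree as an iterated product of unit trees, is a morphism `toKPrime` from the free operad
-- to K'.
--
-- It has a degree-preserving section: a tree is rebuilt from the unit by grafting the first child
-- with >, adding each intermediate sibling with |, and adding the last one with < (`TriOps.ev`,
-- `psiL_ev`). So the operad axioms of K' follow from those of the free operad, which are checked
-- directly on labelled trees.
--
-- The relations hold in K', so the ideal I lies in the kernel. Conversely, the recipe `ev` makes
-- sense for any three operations. In the quotient of the free operad by I they satisfy the seven
-- laws, and these laws make evaluation compatible with the three products (`EW_ltW`, `EW_gtW`,
-- `EW_bmW`). Evaluation after `psi` is therefore the projection to the quotient (`ET_psiL`), and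
-- the kernel lies in I. Stability of I under d holds because the differential of each relation is a
-- combination of relations.
--
-- Signs are carried by the operators `wt q`, which multiply a tree by q to the power of its
-- dimension: q = -1 gives Koszul signs as linear maps, and q = 2 detects degrees.

theorem Finsupp.eq_of_additive {α V : Type} [AddCommGroup V] {f g : (α →₀ ℤ) → V}
    (x : α →₀ ℤ)
    (hf : ∀ x y, f (x + y) = f x + f y)
    (hg : ∀ x y, g (x + y) = g x + g y)
    (h : ∀ a, f (Finsupp.single a 1) = g (Finsupp.single a 1)) : f x = g x := by
  have : AddMonoidHom.mk' f hf = AddMonoidHom.mk' g hg := by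
    ext a; exact h a
  exact DFunLike.congr_fun this x

theorem bilinExt_single {α β γ : Type} (f : α → β → γ →₀ ℤ) (a : α) (b : β) :
    bilinExt f (Finsupp.single a 1) (Finsupp.single b 1) = f a b := by
  simp [bilinExt]

namespace PTree

/-- Integral combinations of trees. -/
abbrev TreeMod := PTree →₀ ℤ
/-- Integral combinations of sequences of trees. -/
abbrev ForestMod := PForest →₀ ℤ
/-- Integral combinations of pairs of a tree and a sequence of trees: the children of a vertex,
the first one being set apart. -/
abbrev PairMod := PTree × PForest →₀ ℤ

/-- The basis vector of a tree. -/
noncomputable def tr (x : PTree) : TreeMod := Finsupp.single x 1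
/-- The basis vector of a sequence of trees. -/
noncomputable def fo (f : PForest) : ForestMod := Finsupp.single f 1
/-- The basis vector of the leaf. -/
noncomputable def lf : TreeMod := tr leaf

/-- Pairing of a tree with a sequence. -/
noncomputable def pr : TreeMod →ₗ[ℤ] ForestMod →ₗ[ℤ] PairMod :=
  bilinExt fun t f => Finsupp.single (t, f) 1
/-- Joining children to a new root. -/
noncomputable def nd : PairMod →ₗ[ℤ] TreeMod := Finsupp.lmapDomain ℤ ℤ fun p => node p.1 p.2
/-- Linear extension of `PForest.cons`. -/
noncomputable def cn : PairMod →ₗ[ℤ] ForestMod :=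
  Finsupp.lmapDomain ℤ ℤ fun p => PForest.cons p.1 p.2
/-- Linear extension of `PForest.one`. -/
noncomputable def on : TreeMod →ₗ[ℤ] ForestMod := Finsupp.lmapDomain ℤ ℤ PForest.one

theorem pr_tr_fo (x : PTree) (f : PForest) : pr (tr x) (fo f) = Finsupp.single (x, f) 1 :=
  bilinExt_single _ _ _

theorem tr_leaf : tr leaf = lf := rfl

theorem tr_node (c : PTree) (cs : PForest) : tr (node c cs) = nd (pr (tr c) (fo cs)) := by
  rw [pr_tr_fo]; simp [nd, tr]

theorem fo_cons (c : PTree) (cs : PForest) : fo (.cons c cs) = cn (pr (tr c) (fo cs)) := by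
  rw [pr_tr_fo]; simp [cn, fo]

theorem fo_one (c : PTree) : fo (.one c) = on (tr c) := by
  simp [on, tr, fo]

section ext
variable {V : Type} [AddCommGroup V]

/-- Bare functions, with additivity discharged automatically, allow `apply` to unify with an
identity of any shape in which one argument occurs additively. Multilinear identities are reduced to
basis trees in this way. -/
theorem eq_of_tr {f g : TreeMod → V} (x : TreeMod)
    (h : ∀ a, f (tr a) = g (tr a))
    (hf : ∀ x y, f (x + y) = f x + f y := by
      intros; simp only [map_add, LinearMap.add_apply, smul_add, neg_add, add_zero,
        Finsupp.mapDomain_add] <;> abel)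
    (hg : ∀ x y, g (x + y) = g x + g y := by
      intros; simp only [map_add, LinearMap.add_apply, smul_add, neg_add, add_zero,
        Finsupp.mapDomain_add] <;> abel) :
    f x = g x :=
  Finsupp.eq_of_additive x hf hg h

theorem eq_of_fo {f g : ForestMod → V} (x : ForestMod)
    (h : ∀ a, f (fo a) = g (fo a))
    (hf : ∀ x y, f (x + y) = f x + f y := by
      intros; simp only [map_add, LinearMap.add_apply, smul_add, neg_add, add_zero,
        Finsupp.mapDomain_add] <;> abel)
    (hg : ∀ x y, g (x + y) = g x + g y := by
      intros; simp only [map_add, LinearMap.add_apply, smul_add, neg_add, add_zero,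
        Finsupp.mapDomain_add] <;> abel) :
    f x = g x :=
  Finsupp.eq_of_additive x hf hg h

theorem eq_of_pr {f g : PairMod → V} (x : PairMod)
    (h : ∀ a b, f (pr (tr a) (fo b)) = g (pr (tr a) (fo b)))
    (hf : ∀ x y, f (x + y) = f x + f y := by
      intros; simp only [map_add, LinearMap.add_apply, smul_add, neg_add, add_zero,
        Finsupp.mapDomain_add] <;> abel)
    (hg : ∀ x y, g (x + y) = g x + g y := by
      intros; simp only [map_add, LinearMap.add_apply, smul_add, neg_add, add_zero,
        Finsupp.mapDomain_add] <;> abel) :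
    f x = g x :=
  Finsupp.eq_of_additive x hf hg fun a => by simpa only [pr_tr_fo] using h a.1 a.2

/-- Additive functions on `TreeMod` agree if they agree on the leaf and on the trees with a
root vertex. -/
theorem eq_of_lf_nd {f g : TreeMod → V} (x : TreeMod)
    (h : f lf = g lf) (h' : ∀ w, f (nd w) = g (nd w))
    (hf : ∀ x y, f (x + y) = f x + f y := by
      intros; simp only [map_add, LinearMap.add_apply, smul_add, neg_add, add_zero,
        Finsupp.mapDomain_add] <;> abel)
    (hg : ∀ x y, g (x + y) = g x + g y := by
      intros; simp only [map_add, LinearMap.add_apply, smul_add, neg_add, add_zero,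
        Finsupp.mapDomain_add] <;> abel) :
    f x = g x :=
  eq_of_tr x (fun a => match a with
    | .leaf => h
    | .node c cs => by rw [tr_node, h']) hf hg

theorem eq_of_on_cn {f g : ForestMod → V} (x : ForestMod)
    (h : ∀ x, f (on x) = g (on x)) (h' : ∀ w, f (cn w) = g (cn w))
    (hf : ∀ x y, f (x + y) = f x + f y := by
      intros; simp only [map_add, LinearMap.add_apply, smul_add, neg_add, add_zero,
        Finsupp.mapDomain_add] <;> abel)
    (hg : ∀ x y, g (x + y) = g x + g y := by
      intros; simp only [map_add, LinearMap.add_apply, smul_add, neg_add, add_zero,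
        Finsupp.mapDomain_add] <;> abel) :
    f x = g x :=
  eq_of_fo x (fun a => match a with
    | .one c => by rw [fo_one, h]
    | .cons c cs => by rw [fo_cons, h']) hf hg

theorem eq_of_pr' {f g : PairMod → V} (x : PairMod)
    (h : ∀ a b, f (pr a b) = g (pr a b))
    (hf : ∀ x y, f (x + y) = f x + f y := by
      intros; simp only [map_add, LinearMap.add_apply, smul_add, neg_add, add_zero,
        Finsupp.mapDomain_add] <;> abel)
    (hg : ∀ x y, g (x + y) = g x + g y := by
      intros; simp only [map_add, LinearMap.add_apply, smul_add, neg_add, add_zero,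
        Finsupp.mapDomain_add] <;> abel) :
    f x = g x :=
  eq_of_pr x (fun _ _ => h _ _) hf hg

end ext

/-! ### Weights -/

/-- Multiplication of each tree by `q` to the power of its dimension. -/
noncomputable def wt (q : ℤ) : TreeMod →ₗ[ℤ] TreeMod :=
  Finsupp.linearCombination ℤ fun t => Finsupp.single t (q ^ t.dim)
/-- Multiplication of each sequence by `q` to the power of its dimension. -/
noncomputable def wtF (q : ℤ) : ForestMod →ₗ[ℤ] ForestMod :=
  Finsupp.linearCombination ℤ fun t => Finsupp.single t (q ^ t.dim)
/-- Multiplication of each pair by `q` to the power of its dimension. -/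
noncomputable def wtW (q : ℤ) : PairMod →ₗ[ℤ] PairMod :=
  Finsupp.linearCombination ℤ fun p => Finsupp.single p (q ^ (p.1.dim + p.2.dim))

variable (q r : ℤ)

theorem wt_tr (x : PTree) : wt q (tr x) = q ^ x.dim • tr x := by simp [wt, tr]
theorem wtF_fo (x : PForest) : wtF q (fo x) = q ^ x.dim • fo x := by simp [wtF, fo]
theorem wtW_single (x : PTree) (f : PForest) :
    wtW q (pr (tr x) (fo f)) = q ^ (x.dim + f.dim) • pr (tr x) (fo f) := by
  simp [wtW, pr_tr_fo]

theorem wtW_pr (x : TreeMod) (f : ForestMod) : wtW q (pr x f) = pr (wt q x) (wtF q f) := by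
  apply eq_of_tr x; intro x
  apply eq_of_fo f; intro f
  rw [wtW_single, wt_tr, wtF_fo]
  simp only [map_smul, LinearMap.smul_apply, smul_smul]
  rw [pow_add, mul_comm]

theorem wt_nd (w : PairMod) : wt q (nd w) = nd (wtW q w) := by
  apply eq_of_pr w; intro a b
  rw [wtW_single, map_smul, ← tr_node, wt_tr, PTree.dim]

/-- The sector on the left of a tree that has a further sibling on its right is not the last of its
vertex; it accounts for the factor `q`. -/
theorem wtF_cn (w : PairMod) : wtF q (cn w) = q • cn (wtW q w) := by
  apply eq_of_pr w; intro a b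
  rw [wtW_single, map_smul, ← fo_cons, wtF_fo, PForest.dim, smul_smul]
  congr 1; ring

theorem wtF_on (x : TreeMod) : wtF q (on x) = on (wt q x) := by
  apply eq_of_tr x; intro a
  rw [wt_tr, map_smul, ← fo_one, wtF_fo, PForest.dim]

theorem wt_lf : wt q lf = lf := by
  rw [← tr_leaf, wt_tr]; simp [PTree.dim]

theorem wt_wt (x : TreeMod) : wt q (wt r x) = wt (q * r) x := by
  apply eq_of_tr x; intro a
  simp only [wt_tr, map_smul, smul_smul, mul_pow]; rw [mul_comm]

theorem wtF_wtF (x : ForestMod) : wtF q (wtF r x) = wtF (q * r) x := by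
  apply eq_of_fo x; intro a
  simp only [wtF_fo, map_smul, smul_smul, mul_pow]; rw [mul_comm]

theorem wtW_wtW (x : PairMod) : wtW q (wtW r x) = wtW (q * r) x := by
  apply eq_of_pr x; intro a b
  simp only [wtW_single, map_smul, smul_smul, mul_pow]; rw [mul_comm]

theorem wt_one (x : TreeMod) : wt 1 x = x := by
  apply eq_of_tr x; intro a
  simp [wt_tr]

theorem wtW_one (x : PairMod) : wtW 1 x = x := by
  apply eq_of_pr x; intro a b
  simp [wtW_single]

/-! ### The shuffle product and the three operations -/

/-- Bilinear extension of `shuffle`. -/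
noncomputable def sh : TreeMod →ₗ[ℤ] TreeMod →ₗ[ℤ] TreeMod := bilinExt shuffle
/-- Bilinear extension of `shuffleLast`. -/
noncomputable def shl : ForestMod →ₗ[ℤ] TreeMod →ₗ[ℤ] ForestMod := bilinExt shuffleLast

/-- The operation `<` on trees, in terms of the children of the root on the left. -/
noncomputable def ltW : PairMod →ₗ[ℤ] TreeMod →ₗ[ℤ] PairMod :=
  bilinExt fun p S => pr (tr p.1) (shl (fo p.2) (tr S))
/-- The operation `>` on trees, in terms of the children of the root on the right. -/
noncomputable def gtW : TreeMod →ₗ[ℤ] PairMod →ₗ[ℤ] PairMod :=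
  bilinExt fun T p => pr (sh (tr T) (tr p.1)) (fo p.2)

/-- Signed concatenation of sequences. -/
noncomputable def app : ForestMod →ₗ[ℤ] ForestMod →ₗ[ℤ] ForestMod :=
  bilinExt fun E F => Finsupp.single (E.append F) ((-1) ^ E.dimBeforeLast)
/-- Signed concatenation, for pairs. -/
noncomputable def appW : PairMod →ₗ[ℤ] ForestMod →ₗ[ℤ] PairMod :=
  bilinExt fun p F => pr (wt (-1) (tr p.1)) (app (fo p.2) (fo F))

/-- The last tree of the sequence is merged with the first child of the root of the tree, the
roots being identified. -/
noncomputable def bm : ForestMod →ₗ[ℤ] TreeMod →ₗ[ℤ] ForestMod :=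
  bilinExt fun F S => match S with
    | .leaf => 0
    | .node d ds => app (shl (fo F) (tr d)) (fo ds)
/-- The operation `|` on trees, in terms of the children of the root on the left. -/
noncomputable def bmW : PairMod →ₗ[ℤ] TreeMod →ₗ[ℤ] PairMod :=
  bilinExt fun p S => pr (wt (-1) (tr p.1)) (bm (fo p.2) (tr S))

theorem ltW_pr (c : TreeMod) (F : ForestMod) (S : TreeMod) :
    ltW (pr c F) S = pr c (shl F S) := by
  apply eq_of_tr c; intro c
  apply eq_of_fo F; intro F
  apply eq_of_tr S; intro S
  rw [pr_tr_fo]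
  exact bilinExt_single _ _ _

theorem gtW_pr (T d : TreeMod) (F : ForestMod) : gtW T (pr d F) = pr (sh T d) F := by
  apply eq_of_tr d; intro c
  apply eq_of_fo F; intro F
  apply eq_of_tr T; intro S
  rw [pr_tr_fo]
  exact bilinExt_single _ _ _

theorem appW_pr (c : TreeMod) (E F : ForestMod) :
    appW (pr c E) F = pr (wt (-1) c) (app E F) := by
  apply eq_of_tr c; intro c
  apply eq_of_fo F; intro F
  apply eq_of_fo E; intro S
  rw [pr_tr_fo]
  exact bilinExt_single _ _ _

theorem bmW_pr (c : TreeMod) (F : ForestMod) (S : TreeMod) :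
    bmW (pr c F) S = pr (wt (-1) c) (bm F S) := by
  apply eq_of_tr c; intro c
  apply eq_of_fo F; intro F
  apply eq_of_tr S; intro S
  rw [pr_tr_fo]
  exact bilinExt_single _ _ _

theorem app_on (x : TreeMod) (F : ForestMod) : app (on x) F = cn (pr x F) := by
  apply eq_of_tr x; intro c
  apply eq_of_fo F; intro F
  rw [← fo_one, ← fo_cons]
  refine (bilinExt_single _ _ _).trans ?_
  simp [PForest.append, PForest.dimBeforeLast, fo]

theorem app_fo (E F : PForest) :
    app (fo E) (fo F) = (-1 : ℤ) ^ E.dimBeforeLast • fo (E.append F) := by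
  refine (bilinExt_single _ _ _).trans ?_
  simp [fo]

/-- The factor created by a concatenation has to move past the sector on the left of the first tree,
hence the sign, and past that tree itself, hence the parity inside `appW`. -/
theorem app_cn (w : PairMod) (F : ForestMod) : app (cn w) F = -cn (appW w F) := by
  apply eq_of_pr w; intro c E
  apply eq_of_fo F; intro F
  rw [appW_pr, ← fo_cons, app_fo, app_fo, wt_tr]
  simp only [map_smul, LinearMap.smul_apply, PForest.append, PForest.dimBeforeLast, fo_cons,
    smul_smul]
  rw [← neg_smul]; congr 1; ring

theorem bm_lf (F : ForestMod) : bm F lf = 0 := by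
  apply eq_of_fo F; intro F
  exact bilinExt_single _ _ _

theorem bm_nd_pr (F : ForestMod) (d : TreeMod) (G : ForestMod) :
    bm F (nd (pr d G)) = app (shl F d) G := by
  apply eq_of_fo F; intro F
  apply eq_of_tr d; intro d
  apply eq_of_fo G; intro G
  rw [← tr_node]
  exact bilinExt_single _ _ _

theorem shl_fo (F : PForest) (x : PTree) : shl (fo F) (tr x) = shuffleLast F x :=
  bilinExt_single _ _ _

theorem sh_tr (y x : PTree) : sh (tr y) (tr x) = shuffle y x :=
  bilinExt_single _ _ _

theorem shl_on (x y : TreeMod) : shl (on x) y = on (sh x y) := by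
  apply eq_of_tr x; intro x
  apply eq_of_tr y; intro y
  rw [← fo_one, shl_fo, sh_tr, shuffleLast]; rfl

theorem mapDomain_node_right (c : PTree) (f : ForestMod) :
    f.mapDomain (fun f => PTree.node c f) = nd (pr (tr c) f) := by
  apply eq_of_fo f; intro f
  rw [← tr_node]; simp [fo, tr]

theorem mapDomain_node_left (f : PForest) (c : TreeMod) :
    c.mapDomain (fun c => PTree.node c f) = nd (pr c (fo f)) := by
  apply eq_of_tr c; intro c
  rw [← tr_node]; simp [tr]

theorem mapDomain_cons_right (c : PTree) (f : ForestMod) :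
    f.mapDomain (fun f => PForest.cons c f) = cn (pr (tr c) f) := by
  apply eq_of_fo f; intro f
  rw [← fo_cons]; simp [fo]

theorem mapDomain_cons_left (f : PForest) (c : TreeMod) :
    c.mapDomain (fun c => PForest.cons c f) = cn (pr c (fo f)) := by
  apply eq_of_tr c; intro c
  rw [← fo_cons]; simp [tr, fo]

theorem shl_cn (w : PairMod) (y : TreeMod) : shl (cn w) y = cn (ltW w y) := by
  apply eq_of_pr w; intro c F
  apply eq_of_tr y; intro y
  rw [← fo_cons, ltW_pr, shl_fo, shl_fo, shuffleLast, mapDomain_cons_right]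

theorem sh_lf_left (x : TreeMod) : sh lf x = x := by
  apply eq_of_tr x; intro a
  exact (sh_tr _ _).trans (by rw [shuffle]; rfl)

theorem sh_lf_right (x : TreeMod) : sh x lf = x := by
  apply eq_of_tr x; intro a
  refine (sh_tr _ _).trans ?_
  cases a <;> rw [shuffle] <;> rfl

/-- The lowest vertex of a shuffle comes from the left tree or from the right one; the two summands
are the products < and >. This splitting drives all the inductions over shuffles. -/
theorem sh_nd_nd (v w : PairMod) : sh (nd v) (nd w) = nd (ltW v (nd w)) + nd (gtW (nd v) w) := by
  apply eq_of_pr v; intro c C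
  apply eq_of_pr w; intro d D
  rw [← tr_node, ← tr_node, gtW_pr, ltW_pr, sh_tr, shuffle, sh_tr, shl_fo, mapDomain_node_right,
    mapDomain_node_left]

theorem shl_lf (F : ForestMod) : shl F lf = F := by
  apply eq_of_fo F; intro F
  induction F using PForest.rec (motive_1 := fun _ => True) with
  | leaf => trivial
  | node => trivial
  | one c => rw [fo_one, shl_on, sh_lf_right]
  | cons c cs _ ih => rw [fo_cons, shl_cn, ltW_pr, ih]

theorem ltW_lf (w : PairMod) : ltW w lf = w := by
  apply eq_of_pr' w; intro _ _
  rw [ltW_pr, shl_lf]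

theorem gtW_lf (w : PairMod) : gtW lf w = w := by
  apply eq_of_pr' w; intro _ _
  rw [gtW_pr, sh_lf_left]

theorem bmW_lf (w : PairMod) : bmW w lf = 0 := by
  apply eq_of_pr' w; intro _ _
  rw [bmW_pr, bm_lf, map_zero]

theorem bm_cn (w : PairMod) (S : TreeMod) : bm (cn w) S = -cn (bmW w S) := by
  apply eq_of_lf_nd S
  · rw [bm_lf, bmW_lf, map_zero, neg_zero]
  intro S
  apply eq_of_pr' w; intro c F
  apply eq_of_pr' S; intro d G
  rw [bm_nd_pr, shl_cn, app_cn, bmW_pr, bm_nd_pr, ltW_pr, appW_pr]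

/-- Nothing stands before the sector of a one-tree sequence, so no sign arises, and identifying the
vertices only shuffles `x` into the first child of `w`. This base case turns statements on `bm` into
statements on `gtW`. -/
theorem bm_on (x : TreeMod) (w : PairMod) : bm (on x) (nd w) = cn (gtW x w) := by
  apply eq_of_pr' w; intro c F
  rw [bm_nd_pr, shl_on, app_on, gtW_pr]

mutual
-- Both sides are split according to the tree that provides the lowest vertex. The three parts
-- match: by induction inside the last child of `x`, by definition for `y`, and by induction inside
-- the first child of `z`.
theorem sh_assoc_tr : ∀ x y z : PTree, sh (sh (tr x) (tr y)) (tr z) = sh (tr x) (sh (tr y) (tr z))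
  | .leaf, y, z => by simp only [tr_leaf, sh_lf_left]
  | .node c C, .leaf, z => by simp only [tr_leaf, sh_lf_left, sh_lf_right]
  | .node c C, .node d D, .leaf => by simp only [tr_leaf, sh_lf_right]
  | .node c C, .node d D, .node e E => by
      have h₁ := shl_assoc_fo C (.node d D) (.node e E)
      have h₂ := sh_assoc_tr (.node c C) d (.node e E)
      have h₃ := sh_assoc_tr (.node c C) (.node d D) e
      simp only [tr_node, sh_nd_nd, map_add, LinearMap.add_apply, ltW_pr, gtW_pr] at *
      rw [h₁, ← h₃]
      simp only [map_add, LinearMap.add_apply]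
      abel
  termination_by x y z => sizeOf x + sizeOf y + sizeOf z
theorem shl_assoc_fo : ∀ (F : PForest) (y z : PTree),
    shl (shl (fo F) (tr y)) (tr z) = shl (fo F) (sh (tr y) (tr z))
  | .one c, y, z => by simp only [fo_one, shl_on, sh_assoc_tr c y z]
  | .cons c C, y, z => by simp only [fo_cons, shl_cn, ltW_pr, shl_assoc_fo C y z]
  termination_by F y z => sizeOf F + sizeOf y + sizeOf z
end

theorem sh_assoc (x y z : TreeMod) : sh (sh x y) z = sh x (sh y z) := by
  apply eq_of_tr x; intro x
  apply eq_of_tr y; intro y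
  apply eq_of_tr z; intro z
  exact sh_assoc_tr x y z

theorem shl_assoc (F : ForestMod) (y z : TreeMod) : shl (shl F y) z = shl F (sh y z) := by
  apply eq_of_fo F; intro F
  apply eq_of_tr y; intro y
  apply eq_of_tr z; intro z
  exact shl_assoc_fo F y z

theorem ltW_ltW (w : PairMod) (y z : TreeMod) : ltW (ltW w y) z = ltW w (sh y z) := by
  apply eq_of_pr' w; intro _ _
  simp only [ltW_pr, shl_assoc]

theorem gtW_gtW (x y : TreeMod) (w : PairMod) : gtW x (gtW y w) = gtW (sh x y) w := by
  apply eq_of_pr' w; intro _ _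
  simp only [gtW_pr, sh_assoc]

theorem ltW_gtW (x : TreeMod) (w : PairMod) (y : TreeMod) :
    ltW (gtW x w) y = gtW x (ltW w y) := by
  apply eq_of_pr' w; intro _ _
  simp only [gtW_pr, ltW_pr]

end PTree

@[elab_as_elim]
theorem PForest.list_induction {p : PForest → Prop} (one : ∀ c, p (.one c))
    (cons : ∀ c cs, p cs → p (.cons c cs)) : ∀ F, p F
  | .one c => one c
  | .cons c cs => cons c cs (PForest.list_induction one cons cs)

namespace PTree

/-! ### Weights of products -/

section weights
variable (q : ℤ)

mutual
theorem wt_sh_tr : ∀ x y : PTree, wt q (sh (tr x) (tr y)) = sh (wt q (tr x)) (wt q (tr y))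
  | .leaf, y => by simp only [tr_leaf, sh_lf_left, wt_lf]
  | .node c C, .leaf => by simp only [tr_leaf, sh_lf_right, wt_lf]
  | .node c C, .node d D => by
      have h₁ := wtF_shl_fo C (.node d D)
      have h₂ := wt_sh_tr (.node c C) d
      simp only [tr_node, sh_nd_nd, map_add, ltW_pr, gtW_pr, wt_nd, wtW_pr] at *
      rw [h₁, h₂]
  termination_by x y => sizeOf x + sizeOf y
theorem wtF_shl_fo : ∀ (F : PForest) (y : PTree),
    wtF q (shl (fo F) (tr y)) = shl (wtF q (fo F)) (wt q (tr y))
  | .one c, y => by simp only [fo_one, shl_on, wtF_on, wt_sh_tr c y]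
  | .cons c C, y => by
      simp only [fo_cons, shl_cn, ltW_pr, wtF_cn, wtW_pr, wtF_shl_fo C y, map_smul,
        LinearMap.smul_apply]
  termination_by F y => sizeOf F + sizeOf y
end

theorem wt_sh (x y : TreeMod) : wt q (sh x y) = sh (wt q x) (wt q y) := by
  apply eq_of_tr x; intro x
  apply eq_of_tr y; intro y
  exact wt_sh_tr q x y

theorem wtF_shl (F : ForestMod) (y : TreeMod) : wtF q (shl F y) = shl (wtF q F) (wt q y) := by
  apply eq_of_fo F; intro F
  apply eq_of_tr y; intro y
  exact wtF_shl_fo q F y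

theorem wtW_ltW (w : PairMod) (y : TreeMod) : wtW q (ltW w y) = ltW (wtW q w) (wt q y) := by
  apply eq_of_pr' w; intro c F
  simp only [ltW_pr, wtW_pr, wtF_shl]

theorem wtW_gtW (x : TreeMod) (w : PairMod) : wtW q (gtW x w) = gtW (wt q x) (wtW q w) := by
  apply eq_of_pr' w; intro c F
  simp only [gtW_pr, wtW_pr, wt_sh]

theorem wt_comm (r : ℤ) (x : TreeMod) : wt q (wt r x) = wt r (wt q x) := by
  rw [wt_wt, wt_wt, mul_comm]

theorem wtF_comm (r : ℤ) (x : ForestMod) : wtF q (wtF r x) = wtF r (wtF q x) := by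
  rw [wtF_wtF, wtF_wtF, mul_comm]

theorem wtW_comm (r : ℤ) (x : PairMod) : wtW q (wtW r x) = wtW r (wtW q x) := by
  rw [wtW_wtW, wtW_wtW, mul_comm]

theorem wt_neg_one_neg_one (x : TreeMod) : wt (-1) (wt (-1) x) = x := by
  rw [wt_wt, neg_one_mul, neg_neg, wt_one]

theorem wtW_neg_one_neg_one (x : PairMod) : wtW (-1) (wtW (-1) x) = x := by
  rw [wtW_wtW, neg_one_mul, neg_neg, wtW_one]

/-- One more sector ceases to be the last of its vertex, so concatenation has degree one. -/
theorem wtF_app (E F : ForestMod) : wtF q (app E F) = q • app (wtF q E) (wtF q F) := by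
  apply eq_of_fo E; intro E
  induction E using PForest.list_induction generalizing F with
  | one c => simp only [fo_one, app_on, wtF_cn, wtF_on, wtW_pr]
  | cons c E ih =>
    simp only [fo_cons, app_cn, appW_pr, map_neg, wtF_cn, wtW_pr, ih, map_smul,
      LinearMap.smul_apply, smul_neg, wt_comm q (-1)]

theorem wtW_appW (w : PairMod) (F : ForestMod) :
    wtW q (appW w F) = q • appW (wtW q w) (wtF q F) := by
  apply eq_of_pr' w; intro c E
  simp only [appW_pr, wtW_pr, wtF_app, map_smul, wt_comm q (-1)]

theorem wtF_bm (F : ForestMod) (S : TreeMod) : wtF q (bm F S) = q • bm (wtF q F) (wt q S) := by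
  apply eq_of_lf_nd S
  · simp only [bm_lf, wt_lf, map_zero, smul_zero]
  intro S
  apply eq_of_pr' S; intro d G
  simp only [bm_nd_pr, wt_nd, wtW_pr, wtF_app, wtF_shl]

theorem wtW_bmW (w : PairMod) (S : TreeMod) :
    wtW q (bmW w S) = q • bmW (wtW q w) (wt q S) := by
  apply eq_of_pr' w; intro c F
  simp only [bmW_pr, wtW_pr, wtF_bm, map_smul, wt_comm q (-1)]

end weights

/-! ### Relations between the operations -/

theorem app_shl (E F : ForestMod) (x : TreeMod) : app E (shl F x) = shl (app E F) x := by
  apply eq_of_fo E; intro E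
  induction E using PForest.list_induction generalizing F with
  | one c => simp only [fo_one, app_on, shl_cn, ltW_pr]
  | cons c E ih => simp only [fo_cons, app_cn, appW_pr, map_neg, LinearMap.neg_apply, ih, shl_cn,
      ltW_pr]

theorem appW_shl (w : PairMod) (F : ForestMod) (x : TreeMod) :
    appW w (shl F x) = ltW (appW w F) x := by
  apply eq_of_pr' w; intro c E
  simp only [appW_pr, ltW_pr, app_shl]

theorem bm_nd_ltW (F : ForestMod) (w : PairMod) (x : TreeMod) :
    bm F (nd (ltW w x)) = shl (bm F (nd w)) x := by
  apply eq_of_pr' w; intro c E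
  simp only [ltW_pr, bm_nd_pr, app_shl]

theorem bmW_nd_ltW (v w : PairMod) (x : TreeMod) :
    bmW v (nd (ltW w x)) = ltW (bmW v (nd w)) x := by
  apply eq_of_pr' v; intro c E
  simp only [ltW_pr, bmW_pr, bm_nd_ltW]

theorem bm_nd_gtW (F : ForestMod) (x : TreeMod) (w : PairMod) :
    bm F (nd (gtW x w)) = bm (shl F x) (nd w) := by
  apply eq_of_pr' w; intro c E
  simp only [gtW_pr, bm_nd_pr, shl_assoc]

theorem bmW_nd_gtW (v : PairMod) (x : TreeMod) (w : PairMod) :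
    bmW v (nd (gtW x w)) = bmW (ltW v x) (nd w) := by
  apply eq_of_pr' v; intro c E
  simp only [ltW_pr, bmW_pr, bm_nd_gtW]

theorem bmW_gtW (x : TreeMod) (w : PairMod) (y : TreeMod) :
    bmW (gtW x w) y = gtW (wt (-1) x) (bmW w y) := by
  apply eq_of_pr' w; intro c E
  simp only [gtW_pr, bmW_pr, wt_sh]

/-- The two sides create the same two factors of degree one in opposite orders, hence the minus
sign; the parity on `E` moves the second factor past `E`. This is the origin of the sign in the
seventh relation. -/
theorem app_bm (E F : ForestMod) (S : TreeMod) :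
    app (wtF (-1) E) (bm F S) = -bm (app E F) S := by
  apply eq_of_fo E; intro E
  induction E using PForest.list_induction generalizing F with
  | one c => simp only [fo_one, wtF_on, app_on, bm_cn, bmW_pr, neg_neg]
  | cons c E ih =>
    simp only [fo_cons, wtF_cn, app_cn, appW_pr, map_neg, wtW_pr, LinearMap.neg_apply, ih,
      bm_cn, bmW_pr, wt_neg_one_neg_one, neg_smul, one_smul, neg_neg]

theorem appW_bm (w : PairMod) (F : ForestMod) (S : TreeMod) :
    appW (wtW (-1) w) (bm F S) = -bmW (appW w F) S := by
  apply eq_of_pr' w; intro c E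
  simp only [wtW_pr, appW_pr, bmW_pr, app_bm, map_neg]

theorem bm_nd_bmW (F : ForestMod) (w : PairMod) (S : TreeMod) :
    bm (wtF (-1) F) (nd (bmW w S)) = -bm (bm F (nd w)) S := by
  apply eq_of_pr' w; intro c E
  simp only [bmW_pr, bm_nd_pr, ← wtF_shl, app_bm]

theorem bmW_nd_bmW (v w : PairMod) (S : TreeMod) :
    bmW (wtW (-1) v) (nd (bmW w S)) = -bmW (bmW v (nd w)) S := by
  apply eq_of_pr' v; intro c E
  simp only [bmW_pr, bm_nd_bmW, wtW_pr, map_neg]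

/-! ### Attaching a sequence of siblings -/

/-- The children `w` of a vertex, followed by further siblings, the last tree of `w` being merged
with the first sibling. -/
noncomputable def attW : PairMod →ₗ[ℤ] ForestMod →ₗ[ℤ] PairMod :=
  bilinExt fun p F => match F with
    | .one x => ltW (pr (tr p.1) (fo p.2)) (tr x)
    | .cons d D => bmW (wtW (-1) (pr (tr p.1) (fo p.2))) (tr (.node d D))

theorem attW_on (w : PairMod) (x : TreeMod) : attW w (on x) = ltW w x := by
  apply eq_of_pr w; intro c F
  apply eq_of_tr x; intro x
  rw [← fo_one]; nth_rw 1 [pr_tr_fo]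
  exact bilinExt_single _ _ _

theorem attW_cn (w v : PairMod) : attW w (cn v) = bmW (wtW (-1) w) (nd v) := by
  apply eq_of_pr w; intro c F
  apply eq_of_pr v; intro d D
  rw [← fo_cons, ← tr_node]; nth_rw 1 [pr_tr_fo]
  exact bilinExt_single _ _ _

theorem attW_shl (w : PairMod) (F : ForestMod) (x : TreeMod) :
    attW w (shl F x) = ltW (attW w F) x := by
  apply eq_of_on_cn F
  · intro y; simp only [shl_on, attW_on, ltW_ltW]
  · intro v; simp only [shl_cn, attW_cn, bmW_nd_ltW]

/-- The product > changes only the first child of `w`, and attaching siblings changes only the other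
end of the row. The sign in `bmW_gtW` is compensated by the parity built into `attW`. -/
theorem attW_gtW (x : TreeMod) (w : PairMod) (F : ForestMod) :
    attW (gtW x w) F = gtW x (attW w F) := by
  apply eq_of_on_cn F
  · intro y; simp only [attW_on, ltW_gtW]
  · intro v; simp only [attW_cn, wtW_gtW, bmW_gtW, wt_neg_one_neg_one]

theorem wtW_attW (q : ℤ) (w : PairMod) (F : ForestMod) :
    wtW q (attW w F) = attW (wtW q w) (wtF q F) := by
  apply eq_of_on_cn F
  · intro y; simp only [attW_on, wtF_on, wtW_ltW]
  · intro v; simp only [attW_cn, wtF_cn, wtW_bmW, map_smul, wt_nd, wtW_comm q (-1)]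

/-- Both sides extend the same row of children on the right. The parity of `w` is the Koszul sign of
the factor created by `bm`, which stands behind `w` on the left-hand side and in front of it on the
other. -/
theorem attW_bm (w : PairMod) (F : ForestMod) (S : TreeMod) :
    attW w (bm F S) = bmW (attW (wtW (-1) w) F) S := by
  apply eq_of_lf_nd S
  · rw [bm_lf, bmW_lf, map_zero]
  intro S
  apply eq_of_on_cn F
  · intro y; simp only [attW_on, attW_cn, bm_on, bmW_nd_gtW]
  · intro v
    simp only [attW_cn, bm_cn, map_neg, bmW_nd_bmW, wtW_neg_one_neg_one, neg_neg]

end PTree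

namespace PTree

/-! ### The differential is a derivation -/

/-- Linear extension of `cobd`. -/
noncomputable def dT : TreeMod →ₗ[ℤ] TreeMod := Finsupp.linearCombination ℤ cobd
/-- Linear extension of `cobdForest`. -/
noncomputable def dF : ForestMod →ₗ[ℤ] ForestMod := Finsupp.linearCombination ℤ cobdForest
/-- Bilinear extension of `contract`. -/
noncomputable def kW : TreeMod →ₗ[ℤ] ForestMod →ₗ[ℤ] PairMod := bilinExt contract
/-- Linear extension of `contractLast`. -/
noncomputable def kL : TreeMod →ₗ[ℤ] ForestMod := Finsupp.linearCombination ℤ contractLast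
/-- The part of the coboundary coming from the children of a vertex and the edges below them. -/
noncomputable def dW : PairMod →ₗ[ℤ] PairMod :=
  Finsupp.linearCombination ℤ fun p => pr (dT (tr p.1)) (fo p.2) + kW (tr p.1) (fo p.2) +
    pr (wt (-1) (tr p.1)) (dF (fo p.2))

theorem dT_tr (x : PTree) : dT (tr x) = cobd x := by simp [dT, tr]
theorem dF_fo (x : PForest) : dF (fo x) = cobdForest x := by simp [dF, fo]
theorem kL_tr (x : PTree) : kL (tr x) = contractLast x := by simp [kL, tr]
theorem kW_tr_fo (x : PTree) (F : PForest) : kW (tr x) (fo F) = contract x F :=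
  bilinExt_single _ _ _

theorem dW_pr (c : TreeMod) (F : ForestMod) :
    dW (pr c F) = pr (dT c) F + kW c F + pr (wt (-1) c) (dF F) := by
  apply eq_of_tr c; intro c
  apply eq_of_fo F; intro F
  rw [pr_tr_fo]; simp [dW]

theorem kW_lf (F : ForestMod) : kW lf F = 0 := by
  apply eq_of_fo F; intro F
  exact bilinExt_single _ _ _

theorem kL_lf : kL lf = 0 := kL_tr _

theorem kL_nd (w : PairMod) : kL (nd w) = cn w := by
  apply eq_of_pr w; intro c F
  rw [← tr_node, ← fo_cons, kL_tr]; rfl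

theorem kW_nd (w : PairMod) (F : ForestMod) : kW (nd w) F = -appW w F := by
  apply eq_of_pr w; intro c E
  apply eq_of_fo F; intro F
  rw [← tr_node, kW_tr_fo, appW_pr, app_fo, wt_tr]
  simp only [map_smul, LinearMap.smul_apply, smul_smul, pr_tr_fo, contract, ← neg_smul]
  rw [Finsupp.smul_single, pow_add, mul_comm]; simp

theorem dT_lf : dT lf = 0 := by
  rw [← tr_leaf, dT_tr, cobd]

theorem mapDomain_node (w : PairMod) : w.mapDomain (fun p => PTree.node p.1 p.2) = nd w := rfl
theorem mapDomain_cons (w : PairMod) : w.mapDomain (fun p => PForest.cons p.1 p.2) = cn w := rfl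
theorem mapDomain_one (x : TreeMod) : x.mapDomain PForest.one = on x := rfl

theorem dT_nd (w : PairMod) : dT (nd w) = nd (dW w) := by
  apply eq_of_pr w; intro c F
  rw [← tr_node, dT_tr, cobd, dW_pr, mapDomain_node_left, mapDomain_node_right, mapDomain_node,
    kW_tr_fo, dT_tr, dF_fo, wt_tr]
  simp only [map_add, map_smul, LinearMap.smul_apply]

theorem dF_cn (w : PairMod) : dF (cn w) = -cn (dW w) := by
  apply eq_of_pr w; intro c F
  rw [← fo_cons, dF_fo, cobdForest, dW_pr, mapDomain_cons_left, mapDomain_cons_right,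
    mapDomain_cons, kW_tr_fo, dT_tr, dF_fo, wt_tr]
  simp only [map_add, map_smul, LinearMap.smul_apply]

theorem dF_on (x : TreeMod) : dF (on x) = on (dT x) + kL x := by
  apply eq_of_tr x; intro x
  rw [← fo_one, dF_fo, cobdForest, dT_tr, kL_tr, mapDomain_one]

theorem appW_gtW (x : TreeMod) (w : PairMod) (F : ForestMod) :
    appW (gtW x w) F = gtW (wt (-1) x) (appW w F) := by
  apply eq_of_pr' w; intro c E
  simp only [gtW_pr, appW_pr, wt_sh]

theorem kW_shl (x : TreeMod) (F : ForestMod) (y : TreeMod) :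
    kW x (shl F y) = ltW (kW x F) y := by
  apply eq_of_lf_nd x
  · simp only [kW_lf, map_zero, LinearMap.zero_apply]
  · intro w; simp only [kW_nd, appW_shl, map_neg, LinearMap.neg_apply]

theorem kW_bm (x : TreeMod) (F : ForestMod) (y : TreeMod) :
    kW (wt (-1) x) (bm F y) = -bmW (kW x F) y := by
  apply eq_of_lf_nd x
  · simp only [wt_lf, kW_lf, map_zero, LinearMap.zero_apply, neg_zero]
  · intro w; simp only [wt_nd, kW_nd, appW_bm, map_neg, LinearMap.neg_apply]

/-- If the lowest vertex of the shuffle comes from `d`, the contraction is that of `d`. If it is the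
root of `nd v`, this root is identified with the vertex below, which is the product |; the minus
sign is the one attached to edges that do not lead to a last child. -/
theorem kW_sh_nd (v : PairMod) (d : TreeMod) (F : ForestMod) :
    kW (sh (nd v) d) F = gtW (wt (-1) (nd v)) (kW d F) - bmW v (nd (pr d F)) := by
  have h : ∀ d, bmW v (nd (pr d F)) = appW (ltW v d) F := fun d => by
    apply eq_of_pr' v; intro c E
    rw [bmW_pr, bm_nd_pr, ltW_pr, appW_pr]
  rw [h, sub_eq_add_neg]
  apply eq_of_lf_nd d
  · simp only [sh_lf_right, ltW_lf, kW_lf, kW_nd, map_zero, zero_add]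
  · intro u
    simp only [sh_nd_nd, map_add, LinearMap.add_apply, kW_nd, appW_gtW, map_neg]
    abel

/-- The lowest vertex of the shuffle is contracted: the first term collects the shuffles in which it
comes from `x`, the second those in which it comes from `y`. -/
theorem kL_sh (x y : TreeMod) : kL (sh x y) = shl (kL x) y + bm (on x) y := by
  apply eq_of_lf_nd y
  · simp only [sh_lf_right, shl_lf, bm_lf, add_zero]
  intro w
  apply eq_of_lf_nd x
  · simp only [sh_lf_left, kL_lf, kL_nd, bm_on, gtW_lf, map_zero, LinearMap.zero_apply, zero_add]
  · intro v
    simp only [sh_nd_nd, map_add, kL_nd, shl_cn, bm_on]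

/-- The Leibniz rule for `F` is a hypothesis because this is the inductive step of the mutual
recursion that proves it. -/
theorem dW_ltW_of (c : TreeMod) (F : ForestMod) (y : TreeMod)
    (h : dF (shl F y) = shl (dF F) y + shl (wtF (-1) F) (dT y) + bm F y) :
    dW (ltW (pr c F) y) =
      ltW (dW (pr c F)) y + ltW (wtW (-1) (pr c F)) (dT y) + bmW (pr c F) y := by
  simp only [ltW_pr, dW_pr, kW_shl, h, map_add, LinearMap.add_apply, wtW_pr, bmW_pr]
  abel

theorem dW_gtW_of (v : PairMod) (d : TreeMod) (F : ForestMod)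
    (h : dT (sh (nd v) d) = sh (dT (nd v)) d + sh (wt (-1) (nd v)) (dT d)) :
    dW (gtW (nd v) (pr d F)) = gtW (dT (nd v)) (pr d F) + gtW (wt (-1) (nd v)) (dW (pr d F)) -
      bmW v (nd (pr d F)) := by
  simp only [gtW_pr, dW_pr, h, kW_sh_nd, map_add, LinearMap.add_apply, wt_sh]
  abel

mutual
-- An edge of a shuffle that joins a vertex of `x` to a vertex of `y` can be contracted in two
-- shuffles, which differ by the order of these two vertices. The two contributions are x | y in d(x
-- < y) and -(x | y) in d(x > y), and they cancel.
theorem dT_sh_tr : ∀ x y : PTree,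
    dT (sh (tr x) (tr y)) = sh (dT (tr x)) (tr y) + sh (wt (-1) (tr x)) (dT (tr y))
  | .leaf, y => by
      simp only [tr_leaf, sh_lf_left, wt_lf, dT_lf, map_zero, LinearMap.zero_apply, zero_add]
  | .node c C, .leaf => by simp only [tr_leaf, sh_lf_right, dT_lf, map_zero, add_zero]
  | .node c C, .node d D => by
      have h₁ := dW_ltW_of (tr c) _ _ (dF_shl_fo C (.node d D))
      have h₂ := dT_sh_tr (.node c C) d
      rw [tr_node c C] at h₂
      replace h₂ := dW_gtW_of (pr (tr c) (fo C)) (tr d) (fo D) h₂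
      rw [tr_node d D] at h₁
      simp only [tr_node, sh_nd_nd, map_add, dT_nd, wt_nd] at *
      rw [h₁, h₂]
      simp only [map_add, map_sub]
      abel
  termination_by x y => sizeOf x + sizeOf y
-- The vertex that carries `F` always stays below `y`, so the contraction of the edge between them
-- has no partner; this is the term `bm`.
theorem dF_shl_fo : ∀ (F : PForest) (y : PTree),
    dF (shl (fo F) (tr y)) =
      shl (dF (fo F)) (tr y) + shl (wtF (-1) (fo F)) (dT (tr y)) + bm (fo F) (tr y)
  | .one c, y => by
      simp only [fo_one, shl_on, wtF_on, dF_on, dT_sh_tr c y, kL_sh, map_add, LinearMap.add_apply]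
      abel
  | .cons c C, y => by
      have h := dW_ltW_of (tr c) _ _ (dF_shl_fo C y)
      simp only [fo_cons, shl_cn, wtF_cn, dF_cn, bm_cn, map_neg, LinearMap.neg_apply, h, map_add,
        neg_smul, one_smul]
      abel
  termination_by F y => sizeOf F + sizeOf y
end

theorem dT_sh (x y : TreeMod) : dT (sh x y) = sh (dT x) y + sh (wt (-1) x) (dT y) := by
  apply eq_of_tr x; intro x
  apply eq_of_tr y; intro y
  exact dT_sh_tr x y

theorem dF_shl (F : ForestMod) (y : TreeMod) :
    dF (shl F y) = shl (dF F) y + shl (wtF (-1) F) (dT y) + bm F y := by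
  apply eq_of_fo F; intro F
  apply eq_of_tr y; intro y
  exact dF_shl_fo F y

theorem dW_ltW (w : PairMod) (y : TreeMod) :
    dW (ltW w y) = ltW (dW w) y + ltW (wtW (-1) w) (dT y) + bmW w y := by
  apply eq_of_pr' w; intro c F
  exact dW_ltW_of c F y (dF_shl F y)

theorem dW_gtW_nd (v w : PairMod) :
    dW (gtW (nd v) w) = gtW (dT (nd v)) w + gtW (wt (-1) (nd v)) (dW w) + -bmW v (nd w) := by
  apply eq_of_pr' w; intro c F
  exact (dW_gtW_of v c F (dT_sh _ c)).trans (sub_eq_add_neg _ _)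

theorem wtW_kW (q : ℤ) (x : TreeMod) (F : ForestMod) :
    wtW q (kW x F) = q • kW (wt q x) (wtF q F) := by
  apply eq_of_lf_nd x
  · simp only [wt_lf, kW_lf, map_zero, smul_zero]
  · intro w; simp only [wt_nd, kW_nd, wtW_appW, map_neg, smul_neg]

theorem wtF_kL (q : ℤ) (x : TreeMod) : wtF q (kL x) = q • kL (wt q x) := by
  apply eq_of_lf_nd x
  · simp only [wt_lf, kL_lf, map_zero, smul_zero]
  · intro w; simp only [wt_nd, kL_nd, wtF_cn]

mutual
theorem wt_dT_tr (q : ℤ) : ∀ x : PTree, wt q (dT (tr x)) = q • dT (wt q (tr x))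
  | .leaf => by simp only [tr_leaf, wt_lf, dT_lf, map_zero, smul_zero]
  | .node c C => by
      simp only [tr_node, wt_nd, dT_nd, dW_pr, map_add, wtW_pr, wtW_kW, wt_dT_tr q c,
        wtF_dF_fo q C, map_smul, LinearMap.smul_apply, smul_add, wt_comm q (-1)]
theorem wtF_dF_fo (q : ℤ) : ∀ F : PForest, wtF q (dF (fo F)) = q • dF (wtF q (fo F))
  | .one c => by
      simp only [fo_one, wtF_on, dF_on, map_add, wt_dT_tr q c, wtF_kL, map_smul, smul_add]
  | .cons c C => by
      simp only [fo_cons, wtF_cn, dF_cn, dW_pr, map_add, wtW_pr, wtW_kW, wt_dT_tr q c,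
        wtF_dF_fo q C, map_smul, LinearMap.smul_apply, smul_add, wt_comm q (-1), map_neg, smul_neg]
end

theorem wt_dT (q : ℤ) (x : TreeMod) : wt q (dT x) = q • dT (wt q x) := by
  apply eq_of_tr x; intro x
  exact wt_dT_tr q x

/-- For a one-tree sequence `bm` is `gtW`, and the deviation `-bmW` from the Leibniz rule of `gtW`
is accounted for by the contraction `kL` of the edge below that tree. In general the trees on its
left are peeled off one by one. -/
theorem dF_bm (F : ForestMod) (S : TreeMod) :
    dF (bm F S) = -bm (dF F) S + -bm (wtF (-1) F) (dT S) := by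
  apply eq_of_lf_nd S
  · simp only [bm_lf, dT_lf, map_zero, neg_zero, add_zero]
  intro w
  apply eq_of_fo F; intro F
  induction F using PForest.list_induction with
  | one c =>
    rw [fo_one]
    generalize tr c = x
    apply eq_of_lf_nd x
    · simp only [bm_on, dF_cn, dF_on, dT_lf, wtF_on, wt_lf, kL_lf, map_zero, LinearMap.zero_apply,
        dT_nd, gtW_lf, zero_add, neg_zero]
    · intro v
      simp only [bm_on, dF_cn, dF_on, kL_nd, wtF_on, dT_nd, dW_gtW_nd, map_add, map_neg,
        LinearMap.add_apply, bm_cn]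
      abel
  | cons c F ih =>
    simp only [fo_cons, bm_cn, dF_cn, map_neg, wtF_cn, wtW_pr, bmW_pr, dW_pr, map_add, ih, kW_bm,
      LinearMap.neg_apply, LinearMap.add_apply, wt_neg_one_neg_one, neg_smul, one_smul, wt_dT]
    abel

end PTree

theorem Finsupp.eq_of_additive_of_mem_supported {α V : Type} [AddCommGroup V]
    {f g : (α →₀ ℤ) → V} {s : Set α} (x : α →₀ ℤ) (hx : x ∈ Finsupp.supported ℤ ℤ s)
    (hf : ∀ x y, f (x + y) = f x + f y)
    (hg : ∀ x y, g (x + y) = g x + g y)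
    (h : ∀ a ∈ s, f (Finsupp.single a 1) = g (Finsupp.single a 1)) : f x = g x := by
  let F := AddMonoidHom.mk' f hf
  let G := AddMonoidHom.mk' g hg
  change F x = G x
  rw [Finsupp.supported_eq_span_single] at hx
  induction hx using Submodule.span_induction with
  | mem x hx => obtain ⟨a, ha, rfl⟩ := hx; exact h a ha
  | zero => rw [map_zero, map_zero]
  | add x y _ _ hx hy => rw [map_add, map_add, hx, hy]
  | smul r x _ hx => rw [map_zsmul, map_zsmul, hx]

namespace PTree

/-! ### Compositions -/

theorem eq_of_tr_of_mem {V : Type} [AddCommGroup V] {f g : TreeMod → V} {s : Set PTree}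
    (x : TreeMod) (hx : x ∈ Finsupp.supported ℤ ℤ s)
    (h : ∀ a ∈ s, f (tr a) = g (tr a))
    (hf : ∀ x y, f (x + y) = f x + f y := by
      intros; simp only [map_add, LinearMap.add_apply, smul_add, neg_add, add_zero] <;> abel)
    (hg : ∀ x y, g (x + y) = g x + g y := by
      intros; simp only [map_add, LinearMap.add_apply, smul_add, neg_add, add_zero] <;> abel) :
    f x = g x :=
  Finsupp.eq_of_additive_of_mem_supported x hx hf hg h

/-- The children of the root of a tree. -/
noncomputable def body : PTree → PairMod
  | .leaf => 0
  | .node c cs => pr (tr c) (fo cs)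

theorem nd_body {U : PTree} (hU : U ≠ leaf) : nd (body U) = tr U := by
  cases U with
  | leaf => exact absurd rfl hU
  | node c cs => rw [tr_node, body]

theorem wtW_body (p : ℤ) (U : PTree) : wtW p (body U) = p ^ U.dim • body U := by
  cases U with
  | leaf => simp [body]
  | node c cs => rw [body, wtW_single, PTree.dim]

theorem glue_one (F : PForest) (x : PTree) : glue F (.one x) = shl (fo F) (tr x) := by
  induction F using PForest.list_induction with
  | one c => rw [glue, fo_one, shl_on, sh_tr, mapDomain_one]
  | cons c F ih => rw [glue, ih, fo_cons, shl_cn, ltW_pr, mapDomain_cons_right]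

/-- `glue` counts the factors in the last tree of `F`, while `bm` counts those up to its last
sector; the two signs differ by the total parity of `F`. -/
theorem glue_cons (F : PForest) (c : PTree) (cs : PForest) :
    glue F (.cons c cs) = bm (wtF (-1) (fo F)) (tr (.node c cs)) := by
  induction F using PForest.list_induction with
  | one x =>
    rw [glue, tr_node, bm_nd_pr, fo_one, wtF_on, wt_tr, mapDomain_cons_left]
    simp only [map_smul, LinearMap.smul_apply, shl_on, app_on, sh_tr]
  | cons x F ih =>
    rw [glue, ih, fo_cons, wtF_cn, mapDomain_cons_right, neg_one_smul, map_neg,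
      LinearMap.neg_apply, bm_cn, wtW_pr, bmW_pr, wt_neg_one_neg_one, neg_neg]

/-- In this form an insertion at a vertex is made of `gtW` and `attW`, whose commutation rules with
the products are known. -/
theorem splice_eq (c U : PTree) (F : PForest) :
    splice c U F = attW (gtW (tr c) (body U)) (fo F) := by
  cases U with
  | leaf => simp [splice, body]
  | node s ss =>
    change pr (shuffle c s) (glue ss F) = _
    rw [body, gtW_pr, sh_tr]
    cases F with
    | one x => rw [fo_one, attW_on, glue_one, ltW_pr]
    | cons d D =>
      rw [fo_cons, attW_cn, wtW_pr, bmW_pr, wt_neg_one_neg_one, glue_cons, tr_node]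

/-- The sign by which `U` acts on a factor of degree one. -/
def sg (U : PTree) : ℤ := (-1) ^ U.dim

theorem sg_mul_sg (U : PTree) : sg U * sg U = 1 := by
  rw [sg, ← pow_add, ← two_mul, pow_mul, neg_one_sq, one_pow]

variable (U : PTree)

/-- Linear extension of `compAt`. -/
noncomputable def cT (i : ℕ) : TreeMod →ₗ[ℤ] TreeMod :=
  Finsupp.linearCombination ℤ fun T => compAt T i U
/-- Linear extension of `compAtForest`. -/
noncomputable def cF (i : ℕ) : ForestMod →ₗ[ℤ] ForestMod :=
  Finsupp.linearCombination ℤ fun T => compAtForest T i U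
/-- The composition in terms of the children of the root. -/
noncomputable def cW (i : ℕ) : PairMod →ₗ[ℤ] PairMod :=
  Finsupp.linearCombination ℤ fun p =>
    if i < p.1.sectors then pr (cT U i (tr p.1)) (wtF (sg U) (fo p.2))
    else if i = p.1.sectors then attW (gtW (tr p.1) (body U)) (wtF (sg U) (fo p.2))
    else pr (tr p.1) (cF U (i - p.1.sectors - 1) (fo p.2))

theorem cT_tr (i : ℕ) (T : PTree) : cT U i (tr T) = compAt T i U := by simp [cT, tr]
theorem cF_fo (i : ℕ) (T : PForest) : cF U i (fo T) = compAtForest T i U := by simp [cF, fo]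

theorem cT_lf (i : ℕ) : cT U i lf = 0 := by rw [← tr_leaf, cT_tr, compAt]

theorem cF_on (i : ℕ) (x : TreeMod) : cF U i (on x) = on (cT U i x) := by
  apply eq_of_tr x; intro x
  rw [← fo_one, cF_fo, cT_tr, compAtForest, mapDomain_one]

theorem wtF_sg_fo (F : PForest) : wtF (sg U) (fo F) = (-1 : ℤ) ^ (U.dim * F.dim) • fo F := by
  rw [wtF_fo, sg, ← pow_mul]

theorem cT_nd (i : ℕ) (w : PairMod) : cT U i (nd w) = nd (cW U i w) := by
  apply eq_of_pr w; intro c F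
  rw [← tr_node, cT_tr, compAt, pr_tr_fo, cW, Finsupp.linearCombination_single, one_smul]
  split_ifs
  · rw [mapDomain_node_left, wtF_sg_fo, cT_tr, map_smul, map_smul]
  · rw [mapDomain_node, splice_eq, wtF_sg_fo, map_smul, map_smul]
  · rw [mapDomain_node_right, cF_fo]

theorem cF_cn (i : ℕ) (w : PairMod) : cF U i (cn w) = cn (cW U i w) := by
  apply eq_of_pr w; intro c F
  rw [← fo_cons, cF_fo, compAtForest, pr_tr_fo, cW, Finsupp.linearCombination_single, one_smul]
  split_ifs
  · rw [mapDomain_cons_left, wtF_sg_fo, cT_tr, map_smul, map_smul]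
  · rw [mapDomain_cons, splice_eq, wtF_sg_fo, map_smul, map_smul]
  · rw [mapDomain_cons_right, cF_fo]

variable {U}

/-- The first child is allowed to be a combination of trees with `a` sectors, because a shuffle in
that place produces such a combination. -/
theorem cW_pr_lt {i a : ℕ} {c : TreeMod} (hc : c ∈ Finsupp.supported ℤ ℤ (withSectors a))
    (F : ForestMod) (h : i < a) : cW U i (pr c F) = pr (cT U i c) (wtF (sg U) F) := by
  apply eq_of_tr_of_mem c hc; intro c hc
  apply eq_of_fo F; intro F
  rw [pr_tr_fo, cW, Finsupp.linearCombination_single, one_smul, if_pos]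
  exact h.trans_eq (Eq.symm hc)

theorem cW_pr_eq {i a : ℕ} {c : TreeMod} (hc : c ∈ Finsupp.supported ℤ ℤ (withSectors a))
    (F : ForestMod) (h : i = a) :
    cW U i (pr c F) = attW (gtW c (body U)) (wtF (sg U) F) := by
  apply eq_of_tr_of_mem c hc; intro c hc
  apply eq_of_fo F; intro F
  have hc : c.sectors = a := hc
  rw [pr_tr_fo, cW, Finsupp.linearCombination_single, one_smul, if_neg (by dsimp only; omega),
    if_pos (by dsimp only; omega)]

theorem cW_pr_gt {i a : ℕ} {c : TreeMod} (hc : c ∈ Finsupp.supported ℤ ℤ (withSectors a))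
    (F : ForestMod) (h : a < i) : cW U i (pr c F) = pr c (cF U (i - a - 1) F) := by
  apply eq_of_tr_of_mem c hc; intro c hc
  apply eq_of_fo F; intro F
  have hc : c.sectors = a := hc
  rw [pr_tr_fo, cW, Finsupp.linearCombination_single, one_smul, if_neg (by dsimp only; omega),
    if_neg (by dsimp only; omega)]
  simp only [hc]

-- Insertion and the shuffle product

theorem tr_mem_withSectors (x : PTree) :
    tr x ∈ Finsupp.supported ℤ ℤ (withSectors x.sectors) :=
  Finsupp.single_mem_supported ℤ _ rfl

theorem wt_tr_mem_withSectors (p : ℤ) (x : PTree) :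
    wt p (tr x) ∈ Finsupp.supported ℤ ℤ (withSectors x.sectors) := by
  rw [wt_tr]
  exact Submodule.smul_mem _ _ (tr_mem_withSectors x)

theorem sh_tr_mem_withSectors (x y : PTree) :
    sh (tr x) (tr y) ∈ Finsupp.supported ℤ ℤ (withSectors (x.sectors + y.sectors)) := by
  rw [sh_tr]; exact shuffle_mem x y

/-- The sector lies in `c`, at the vertex, or in `F`; only the last case needs the induction
hypothesis `h`. The bound `j + 1 < F.sectors` comes from `cF` not counting the leftmost sector of
`F`. The weight `sg U` on `y` is the sign for moving `U` past `y`. -/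
theorem cW_ltW_left_of {c : PTree} {F : PForest} {y : TreeMod} {i : ℕ}
    (hi : i < c.sectors + F.sectors)
    (h : ∀ j, j + 1 < F.sectors →
      cF U j (shl (fo F) y) = shl (cF U j (fo F)) (wt (sg U) y)) :
    cW U i (ltW (pr (tr c) (fo F)) y) = ltW (cW U i (pr (tr c) (fo F))) (wt (sg U) y) := by
  have hc := tr_mem_withSectors c
  rw [ltW_pr]
  rcases lt_trichotomy i c.sectors with hi' | hi' | hi'
  · rw [cW_pr_lt hc _ hi', cW_pr_lt hc _ hi', ltW_pr, wtF_shl]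
  · rw [cW_pr_eq hc _ hi', cW_pr_eq hc _ hi', wtF_shl, attW_shl]
  · rw [cW_pr_gt hc _ hi', cW_pr_gt hc _ hi', ltW_pr, h _ (by omega)]

theorem cW_ltW_right_of {c : PTree} {F : PForest} {y : PTree} {i : ℕ}
    (hi : c.sectors + F.sectors ≤ i) (hi' : i < c.sectors + F.sectors + y.sectors)
    (h : ∀ j, F.sectors ≤ j + 1 → j + 1 < F.sectors + y.sectors →
      cF U j (shl (fo F) (tr y)) = shl (fo F) (cT U (j + 1 - F.sectors) (tr y))) :
    cW U i (ltW (pr (tr c) (fo F)) (tr y)) =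
      ltW (pr (tr c) (fo F)) (cT U (i - (c.sectors + F.sectors)) (tr y)) := by
  have := sectors_forest_pos F
  rw [ltW_pr, cW_pr_gt (tr_mem_withSectors c) _ (by omega), ltW_pr, h _ (by omega) (by omega)]
  congr 4; omega

theorem cW_gtW_left_of {x d : PTree} {F : ForestMod} {i : ℕ} (hi : i < x.sectors)
    (h : cT U i (sh (tr x) (tr d)) = sh (cT U i (tr x)) (wt (sg U) (tr d))) :
    cW U i (gtW (tr x) (pr (tr d) F)) = gtW (cT U i (tr x)) (wtW (sg U) (pr (tr d) F)) := by
  rw [gtW_pr, cW_pr_lt (sh_tr_mem_withSectors x d) _ (by omega), wtW_pr, gtW_pr, h]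

/-- When the sector is at the vertex, the claim is associativity of the shuffle of `x`, `d` and the
first child of `U`; when it is in `F`, nothing happens to the first child. So the induction
hypothesis is only required for sectors inside `d`. -/
theorem cW_gtW_right_of {x d : PTree} {F : ForestMod} {i : ℕ} (hi : x.sectors ≤ i)
    (h : i < x.sectors + d.sectors →
      cT U i (sh (tr x) (tr d)) = sh (tr x) (cT U (i - x.sectors) (tr d))) :
    cW U i (gtW (tr x) (pr (tr d) F)) = gtW (tr x) (cW U (i - x.sectors) (pr (tr d) F)) := by
  have hd := tr_mem_withSectors d
  have hx := sh_tr_mem_withSectors x d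
  rw [gtW_pr]
  rcases lt_trichotomy i (x.sectors + d.sectors) with hi' | hi' | hi'
  · rw [cW_pr_lt hx _ hi', cW_pr_lt hd _ (by omega), gtW_pr, h hi']
  · rw [cW_pr_eq hx _ hi', cW_pr_eq hd _ (by omega), ← gtW_gtW, attW_gtW]
  · rw [cW_pr_gt hx _ hi', cW_pr_gt hd _ (by omega), gtW_pr, Nat.sub_add_eq]

mutual
-- The induction follows the recursion of the shuffle. The delicate sectors are those located on the
-- rightmost branch of `x`, where `y` may become shuffled with vertices of `U` as well; there the
-- claim rests on `attW_shl`.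
theorem cT_sh_left : ∀ (x y : PTree) {i : ℕ}, i < x.sectors →
    cT U i (sh (tr x) (tr y)) = sh (cT U i (tr x)) (wt (sg U) (tr y))
  | .leaf, y, i, h => absurd h (Nat.not_lt_zero i)
  | .node c C, .leaf, i, h => by simp only [tr_leaf, sh_lf_right, wt_lf]
  | .node c C, .node d D, i, h => by
      have h₁ := cW_ltW_left_of (U := U) h fun j hj => cF_shl_left C (.node d D) hj
      have h₂ := cW_gtW_left_of (F := fo D) h (cT_sh_left (.node c C) d h)
      simp only [tr_node, sh_nd_nd, map_add, wt_nd, cT_nd] at *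
      rw [h₁, h₂]
  termination_by x y => sizeOf x + sizeOf y
theorem cF_shl_left : ∀ (F : PForest) (y : PTree) {i : ℕ}, i + 1 < F.sectors →
    cF U i (shl (fo F) (tr y)) = shl (cF U i (fo F)) (wt (sg U) (tr y))
  | .one c, y, i, h => by
      have h₁ := cT_sh_left c y (i := i) (by simp only [PForest.sectors] at h; omega)
      simp only [fo_one, shl_on, cF_on, h₁]
  | .cons c C, y, i, h => by
      have h₁ := cW_ltW_left_of (U := U) (c := c) (F := C) (i := i)
        (by simp only [PForest.sectors] at h; omega) fun j hj => cF_shl_left C y hj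
      simp only [fo_cons, shl_cn, cF_cn, h₁]
  termination_by F y => sizeOf F + sizeOf y
end

mutual
theorem cT_sh_right : ∀ (x y : PTree) {i : ℕ}, x.sectors ≤ i → i < x.sectors + y.sectors →
    cT U i (sh (tr x) (tr y)) = sh (tr x) (cT U (i - x.sectors) (tr y))
  | .leaf, y, i, _, _ => by simp only [tr_leaf, sh_lf_left, PTree.sectors, Nat.sub_zero]
  | .node c C, .leaf, i, h, h' => absurd h' (by simpa only [PTree.sectors, Nat.add_zero, not_lt])
  | .node c C, .node d D, i, h, h' => by
      have h₁ := cW_ltW_right_of (U := U) h h' fun j hj hj' => cF_shl_right C (.node d D) hj hj'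
      have h₂ := cW_gtW_right_of (F := fo D) h (cT_sh_right (.node c C) d h)
      simp only [tr_node, sh_nd_nd, map_add, cT_nd] at *
      rw [h₁, h₂]
      simp only [PTree.sectors]
  termination_by x y => sizeOf x + sizeOf y
theorem cF_shl_right : ∀ (F : PForest) (y : PTree) {i : ℕ}, F.sectors ≤ i + 1 →
    i + 1 < F.sectors + y.sectors →
    cF U i (shl (fo F) (tr y)) = shl (fo F) (cT U (i + 1 - F.sectors) (tr y))
  | .one c, y, i, h, h' => by
      simp only [PForest.sectors] at h h' ⊢
      have h₁ := cT_sh_right c y (i := i) (by omega) (by omega)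
      simp only [fo_one, shl_on, cF_on, h₁]
      congr 4; omega
  | .cons c C, y, i, h, h' => by
      simp only [PForest.sectors] at h h' ⊢
      have h₁ := cW_ltW_right_of (U := U) (c := c) (F := C) (i := i) (by omega) (by omega)
        fun j hj hj' => cF_shl_right C y hj hj'
      simp only [fo_cons, shl_cn, cF_cn, h₁]
      congr 4; omega
  termination_by F y => sizeOf F + sizeOf y
end

theorem cW_ltW_left {c : PTree} {F : PForest} (y : PTree) {i : ℕ}
    (hi : i < c.sectors + F.sectors) :
    cW U i (ltW (pr (tr c) (fo F)) (tr y)) =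
      ltW (cW U i (pr (tr c) (fo F))) (wt (sg U) (tr y)) :=
  cW_ltW_left_of hi fun _ hj => cF_shl_left F y hj

theorem cW_ltW_right {c : PTree} {F : PForest} (y : PTree) {i : ℕ}
    (hi : c.sectors + F.sectors ≤ i) (hi' : i < c.sectors + F.sectors + y.sectors) :
    cW U i (ltW (pr (tr c) (fo F)) (tr y)) =
      ltW (pr (tr c) (fo F)) (cT U (i - (c.sectors + F.sectors)) (tr y)) :=
  cW_ltW_right_of hi hi' fun _ hj => cF_shl_right F y hj

theorem cW_gtW_left {x d : PTree} {F : ForestMod} {i : ℕ} (hi : i < x.sectors) :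
    cW U i (gtW (tr x) (pr (tr d) F)) = gtW (cT U i (tr x)) (wtW (sg U) (pr (tr d) F)) :=
  cW_gtW_left_of hi (cT_sh_left x d hi)

theorem cW_gtW_right {x d : PTree} {F : ForestMod} {i : ℕ} (hi : x.sectors ≤ i) :
    cW U i (gtW (tr x) (pr (tr d) F)) = gtW (tr x) (cW U (i - x.sectors) (pr (tr d) F)) :=
  cW_gtW_right_of hi (cT_sh_right x d hi)

mutual
theorem wt_cT_tr (p : ℤ) : ∀ (x : PTree) (i : ℕ),
    wt p (cT U i (tr x)) = p ^ U.dim • cT U i (wt p (tr x))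
  | .leaf, i => by simp only [tr_leaf, wt_lf, cT_lf, map_zero, smul_zero]
  | .node c C, i => by
      have h := wtW_cW_of p c C i (wt_cT_tr p c i) (wtF_cF_fo p C _)
      simp only [tr_node, wt_nd, cT_nd, h, map_smul]
theorem wtF_cF_fo (p : ℤ) : ∀ (F : PForest) (i : ℕ),
    wtF p (cF U i (fo F)) = p ^ U.dim • cF U i (wtF p (fo F))
  | .one c, i => by
      simp only [fo_one, cF_on, wtF_on, wt_cT_tr p c i, map_smul]
  | .cons c C, i => by
      have h := wtW_cW_of p c C i (wt_cT_tr p c i) (wtF_cF_fo p C _)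
      simp only [fo_cons, wtF_cn, cF_cn, h, map_smul, smul_comm p]
theorem wtW_cW_of (p : ℤ) (c : PTree) (F : PForest) (i : ℕ)
    (h : wt p (cT U i (tr c)) = p ^ U.dim • cT U i (wt p (tr c)))
    (h' : wtF p (cF U (i - c.sectors - 1) (fo F)) =
      p ^ U.dim • cF U (i - c.sectors - 1) (wtF p (fo F))) :
    wtW p (cW U i (pr (tr c) (fo F))) = p ^ U.dim • cW U i (wtW p (pr (tr c) (fo F))) := by
  have hc := tr_mem_withSectors c
  have hc' := wt_tr_mem_withSectors p c
  rw [wtW_pr p (tr c)]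
  rcases lt_trichotomy i c.sectors with hi | hi | hi
  · rw [cW_pr_lt hc _ hi, cW_pr_lt hc' _ hi, wtW_pr, h, map_smul, LinearMap.smul_apply,
      wtF_comm p]
  · rw [cW_pr_eq hc _ hi, cW_pr_eq hc' _ hi, wtW_attW, wtW_gtW, wtW_body, wtF_comm p]
    simp only [map_smul, LinearMap.smul_apply]
  · rw [cW_pr_gt hc _ hi, cW_pr_gt hc' _ hi, wtW_pr, h', map_smul]
end

-- Insertion and the product |

theorem cW_bmW_left_of {c : PTree} {F : PForest} {y : TreeMod} {i : ℕ}
    (hi : i < c.sectors + F.sectors)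
    (h : ∀ j, j + 1 < F.sectors →
      cF U j (bm (fo F) y) = bm (cF U j (fo F)) (wt (sg U) y)) :
    cW U i (bmW (pr (tr c) (fo F)) y) = bmW (cW U i (pr (tr c) (fo F))) (wt (sg U) y) := by
  have hc := tr_mem_withSectors c
  have hc' := wt_tr_mem_withSectors (-1) c
  rw [bmW_pr]
  rcases lt_trichotomy i c.sectors with hi' | hi' | hi'
  -- The sign `sg U` occurs twice and cancels: once in the parity of the first child, which now
  -- contains `U`, and once for the extra factor of degree one in `bm F y` that `U` has to pass.
  · have := wt_cT_tr (U := U) (-1) c i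
    rw [cW_pr_lt hc _ hi', cW_pr_lt hc' _ hi', bmW_pr, wtF_bm, this, ← sg, map_smul, map_smul,
      LinearMap.smul_apply]
  · rw [cW_pr_eq hc _ hi', cW_pr_eq hc' _ hi', wtF_bm, map_smul, attW_bm, wtW_gtW,
      wt_neg_one_neg_one, wtW_body, ← sg]
    simp only [map_smul, LinearMap.smul_apply, smul_smul, sg_mul_sg, one_smul]
  · rw [cW_pr_gt hc _ hi', cW_pr_gt hc' _ hi', bmW_pr, h _ (by omega)]

theorem cF_bm_left (F : PForest) (y : PTree) {i : ℕ} (h : i + 1 < F.sectors) :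
    cF U i (bm (fo F) (tr y)) = bm (cF U i (fo F)) (wt (sg U) (tr y)) := by
  induction F using PForest.list_induction generalizing i with
  | one c =>
    cases y with
    | leaf => simp only [tr_leaf, wt_lf, bm_lf, map_zero]
    | node d D =>
      have h₁ := cW_gtW_left (U := U) (x := c) (d := d) (F := fo D) (i := i)
        (by simp only [PForest.sectors] at h; omega)
      simp only [fo_one, tr_node, bm_on, cF_on, cF_cn, wt_nd, h₁]
  | cons c C ih =>
    have h₁ := cW_bmW_left_of (U := U) (c := c) (F := C) (i := i)
      (by simp only [PForest.sectors] at h; omega) fun j hj => ih hj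
    simp only [fo_cons, bm_cn, cF_cn, h₁, map_neg]

theorem cW_bmW_left {c : PTree} {F : PForest} (y : PTree) {i : ℕ}
    (hi : i < c.sectors + F.sectors) :
    cW U i (bmW (pr (tr c) (fo F)) (tr y)) =
      bmW (cW U i (pr (tr c) (fo F))) (wt (sg U) (tr y)) :=
  cW_bmW_left_of hi fun _ hj => cF_bm_left F y hj

theorem cW_bmW_right_of {c : PTree} {F : PForest} {y : PTree} {i : ℕ}
    (hi : c.sectors + F.sectors ≤ i) (hi' : i < c.sectors + F.sectors + y.sectors)
    (h : ∀ j, F.sectors ≤ j + 1 → j + 1 < F.sectors + y.sectors →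
      cF U j (bm (fo F) (tr y)) = bm (fo F) (cT U (j + 1 - F.sectors) (tr y))) :
    cW U i (bmW (pr (tr c) (fo F)) (tr y)) =
      bmW (pr (tr c) (fo F)) (cT U (i - (c.sectors + F.sectors)) (tr y)) := by
  have := sectors_forest_pos F
  rw [bmW_pr, cW_pr_gt (wt_tr_mem_withSectors _ c) _ (by omega), bmW_pr,
    h _ (by omega) (by omega)]
  congr 4; omega

theorem cF_bm_right (F : PForest) (y : PTree) {i : ℕ} (h : F.sectors ≤ i + 1)
    (h' : i + 1 < F.sectors + y.sectors) :
    cF U i (bm (fo F) (tr y)) = bm (fo F) (cT U (i + 1 - F.sectors) (tr y)) := by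
  induction F using PForest.list_induction generalizing i with
  | one c =>
    cases y with
    | leaf => simp only [tr_leaf, bm_lf, cT_lf, map_zero]
    | node d D =>
      simp only [PForest.sectors] at h h' ⊢
      have h₁ := cW_gtW_right (U := U) (x := c) (d := d) (F := fo D) (i := i) (by omega)
      simp only [fo_one, tr_node, bm_on, cF_cn, cT_nd, h₁]
      congr 4; omega
  | cons c C ih =>
    simp only [PForest.sectors] at h h' ⊢
    have h₁ := cW_bmW_right_of (U := U) (c := c) (F := C) (i := i) (by omega) (by omega)
      fun j hj hj' => ih hj hj'
    simp only [fo_cons, bm_cn, cF_cn, h₁, map_neg]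
    congr 5; omega

theorem cW_bmW_right {c : PTree} {F : PForest} (y : PTree) {i : ℕ}
    (hi : c.sectors + F.sectors ≤ i) (hi' : i < c.sectors + F.sectors + y.sectors) :
    cW U i (bmW (pr (tr c) (fo F)) (tr y)) =
      bmW (pr (tr c) (fo F)) (cT U (i - (c.sectors + F.sectors)) (tr y)) :=
  cW_bmW_right_of hi hi' fun _ hj => cF_bm_right F y hj

end PTree

namespace PTree

/-! ### The binary operations on trees -/

/-- The children of the root, extended linearly; the leaf is sent to zero. -/
noncomputable def bodyL : TreeMod →ₗ[ℤ] PairMod := Finsupp.linearCombination ℤ body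

theorem bodyL_tr (x : PTree) : bodyL (tr x) = body x := by simp [bodyL, tr]

theorem bodyL_nd (w : PairMod) : bodyL (nd w) = w := by
  apply eq_of_pr w; intro c F
  rw [← tr_node, bodyL_tr, body]

theorem bodyL_lf : bodyL lf = 0 := bodyL_tr _

theorem wtW_bodyL (p : ℤ) (x : TreeMod) : wtW p (bodyL x) = bodyL (wt p x) := by
  apply eq_of_lf_nd x
  · rw [wt_lf, bodyL_lf, map_zero]
  · intro w; rw [wt_nd, bodyL_nd, bodyL_nd]

/-- The operation `<`. -/
noncomputable def ltT : TreeMod →ₗ[ℤ] TreeMod →ₗ[ℤ] TreeMod := (ltW.compr₂ nd).comp bodyL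
/-- The operation `>`. -/
noncomputable def gtT : TreeMod →ₗ[ℤ] TreeMod →ₗ[ℤ] TreeMod := (gtW.compl₂ bodyL).compr₂ nd
/-- The operation `|`. -/
noncomputable def barT : TreeMod →ₗ[ℤ] TreeMod →ₗ[ℤ] TreeMod := (bmW.compr₂ nd).comp bodyL

theorem ltT_apply (x y : TreeMod) : ltT x y = nd (ltW (bodyL x) y) := rfl
theorem gtT_apply (x y : TreeMod) : gtT x y = nd (gtW x (bodyL y)) := rfl
theorem barT_apply (x y : TreeMod) : barT x y = nd (bmW (bodyL x) y) := rfl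

/-- The operation given by a tree with three leaves. -/
noncomputable def opT : PTree → TreeMod →ₗ[ℤ] TreeMod →ₗ[ℤ] TreeMod
  | .leaf => 0
  | .node .leaf (.one _) => ltT
  | .node .leaf (.cons _ _) => barT
  | .node (.node _ _) _ => gtT

/-- The operations, extended linearly. -/
noncomputable def opL : TreeMod →ₗ[ℤ] TreeMod →ₗ[ℤ] TreeMod →ₗ[ℤ] TreeMod :=
  Finsupp.linearCombination ℤ opT

theorem opL_tr (g : PTree) : opL (tr g) = opT g := by simp [opL, tr]

theorem opT_lt : opT lt = ltT := by simp only [lt, opT]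
theorem opT_gt : opT gt = gtT := by simp only [gt, opT]
theorem opT_bar : opT bar = barT := by simp only [bar, opT]

theorem dim_unit : unit.dim = 0 := by simp [unit, PTree.dim, PForest.dim]
theorem dim_lt : lt.dim = 0 := by simp [lt, PTree.dim, PForest.dim]
theorem dim_gt : gt.dim = 0 := by simp [gt, PTree.dim, PForest.dim]
theorem dim_bar : bar.dim = 1 := by simp [bar, PTree.dim, PForest.dim]

theorem eq_of_mem_cells_two {T : PTree} (h : T ∈ cells 2) : T = lt ∨ T = gt ∨ T = bar := by
  have hs := (mem_cells_iff.1 h).2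
  have h0 : ∀ x : PTree, x.sectors = 0 → x = .leaf := fun x hx => by
    cases x with
    | leaf => rfl
    | node c F => have := sectors_forest_pos F; simp only [PTree.sectors] at hx; omega
  have h1 : ∀ F : PForest, F.sectors = 1 → F = .one .leaf := fun F hF => by
    cases F with
    | one c => simp only [PForest.sectors] at hF; rw [h0 c (by omega)]
    | cons c F =>
      have := sectors_forest_pos F; simp only [PForest.sectors] at hF; omega
  have h1' : ∀ x : PTree, x.sectors = 1 → x = .node .leaf (.one .leaf) := fun x hx => by
    cases x with
    | leaf => simp [PTree.sectors] at hx
    | node c F =>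
      have := sectors_forest_pos F
      simp only [PTree.sectors] at hx
      rw [h0 c (by omega), h1 F (by omega)]
  cases T with
  | leaf => simp [PTree.sectors] at hs
  | node c F =>
    have hF := sectors_forest_pos F
    simp only [PTree.sectors] at hs
    by_cases hc : c.sectors = 0
    · rw [h0 c hc]
      cases F with
      | one x =>
        simp only [PForest.sectors] at hs
        rw [h1' x (by omega)]; exact Or.inl rfl
      | cons d D =>
        have := sectors_forest_pos D
        simp only [PForest.sectors] at hs
        rw [h0 d (by omega), h1 D (by omega)]; exact Or.inr (Or.inr rfl)
    · rw [h1' c (by omega), h1 F (by omega)]; exact Or.inr (Or.inl rfl)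

theorem wt_opT (p : ℤ) {g : PTree} (hg : g ∈ cells 2) (x y : TreeMod) :
    wt p (opT g x y) = p ^ g.dim • opT g (wt p x) (wt p y) := by
  rcases eq_of_mem_cells_two hg with rfl | rfl | rfl
  · rw [opT_lt, dim_lt, pow_zero, one_smul, ltT_apply, ltT_apply, wt_nd, wtW_ltW, wtW_bodyL]
  · rw [opT_gt, dim_gt, pow_zero, one_smul, gtT_apply, gtT_apply, wt_nd, wtW_gtW, wtW_bodyL]
  · rw [opT_bar, dim_bar, pow_one, barT_apply, barT_apply, wt_nd, wtW_bmW, wtW_bodyL, map_smul]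

theorem cobd_lt : cobd lt = tr bar := by
  simp [lt, bar, cobd, cobdForest, contract, contractLast, PTree.dim, tr]
theorem cobd_gt : cobd gt = -tr bar := by
  simp [gt, bar, cobd, cobdForest, contract, contractLast, PTree.dim, tr, PForest.dimBeforeLast,
    PForest.append, Finsupp.single_neg]
  exact (map_neg nd _).trans (by simp [nd])
theorem cobd_bar : cobd bar = 0 := by
  simp [bar, cobd, cobdForest, contract, contractLast, PTree.dim]

theorem dT_opT {g : PTree} (hg : g ∈ cells 2) (v w : PairMod) :
    dT (opT g (nd v) (nd w)) = opL (cobd g) (nd v) (nd w) +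
      (-1 : ℤ) ^ g.dim • opT g (dT (nd v)) (nd w) +
      (-1 : ℤ) ^ g.dim • opT g (wt (-1) (nd v)) (dT (nd w)) := by
  rcases eq_of_mem_cells_two hg with rfl | rfl | rfl
  · simp only [opT_lt, dim_lt, pow_zero, one_smul, cobd_lt, opL_tr, opT_bar, ltT_apply,
      barT_apply, dT_nd, wt_nd, bodyL_nd, dW_ltW, map_add]
    abel
  · simp only [opT_gt, dim_gt, pow_zero, one_smul, cobd_gt, map_neg, LinearMap.neg_apply, opL_tr,
      opT_bar, gtT_apply, barT_apply, dT_nd, wt_nd, bodyL_nd, dW_gtW_nd, map_add]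
    abel
  · have h : dW (bmW v (nd w)) = -bmW (dW v) (nd w) + -bmW (wtW (-1) v) (nd (dW w)) := by
      apply eq_of_pr' v; intro c F
      simp only [bmW_pr, dW_pr, kW_bm, dF_bm, wt_dT, map_add, LinearMap.add_apply, map_neg, wtW_pr,
        neg_smul, one_smul, dT_nd, wt_neg_one_neg_one]
      simp only [LinearMap.neg_apply]
      abel
    simp only [opT_bar, dim_bar, pow_one, neg_smul, one_smul, cobd_bar, map_zero,
      LinearMap.zero_apply, zero_add, barT_apply, dT_nd, wt_nd, bodyL_nd, h, map_add, map_neg]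

/-- The composition, bilinear in both factors. -/
noncomputable def cB (i : ℕ) : TreeMod →ₗ[ℤ] TreeMod →ₗ[ℤ] TreeMod :=
  bilinExt fun T S => compAt T i S

theorem cB_tr_right (i : ℕ) (x : TreeMod) (U : PTree) : cB i x (tr U) = cT U i x := by
  apply eq_of_tr x; intro x
  rw [cT_tr]; exact bilinExt_single _ _ _

/-- The trees of dimension `t` that have a root vertex. -/
def nodesOfDim (t : ℕ) : Set PTree := {T | T ≠ leaf ∧ T.dim = t}

theorem cB_unit {t : ℕ} {z : TreeMod} (hz : z ∈ Finsupp.supported ℤ ℤ (nodesOfDim t)) :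
    cB 0 (tr unit) z = z := by
  apply eq_of_tr_of_mem z hz; intro U hU
  have h0 : lf ∈ Finsupp.supported ℤ ℤ (withSectors 0) := tr_mem_withSectors leaf
  rw [cB_tr_right, unit, tr_node, cT_nd, tr_leaf, fo_one, tr_leaf, cW_pr_eq h0 _ rfl,
    wtF_on, wt_lf, attW_on, gtW_lf, ltW_lf, nd_body hU.1]

/-- This and `cB_opT_right` say that insertion in K' obeys the recursion of grafting in the free
operad, with the same sign for `z` passing `y`; compare `fB_nodeL_left` and `fB_nodeL_right`. -/
theorem cB_opT_left {g : PTree} (hg : g ∈ cells 2) {a b t i : ℕ} {x y z : TreeMod}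
    (hx : x ∈ Finsupp.supported ℤ ℤ (cells a)) (hy : y ∈ Finsupp.supported ℤ ℤ (cells b))
    (hz : z ∈ Finsupp.supported ℤ ℤ (nodesOfDim t)) (hi : i < a) :
    cB i (opT g x y) z = opT g (cB i x z) (wt ((-1) ^ t) y) := by
  apply eq_of_tr_of_mem z hz; rintro U ⟨-, rfl⟩
  apply eq_of_tr_of_mem x hx; clear hx; intro x hx
  apply eq_of_tr_of_mem y hy; clear hy; intro y hy
  rw [cB_tr_right, cB_tr_right, ← sg]
  obtain ⟨hx, rfl⟩ := hx
  obtain ⟨hy, rfl⟩ := hy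
  cases x with
  | leaf => exact absurd rfl hx
  | node c C => cases y with
  | leaf => exact absurd rfl hy
  | node d D =>
    rcases eq_of_mem_cells_two hg with rfl | rfl | rfl
    · rw [opT_lt, ltT_apply, ltT_apply, cT_nd, tr_node c, cT_nd, bodyL_nd, bodyL_nd,
        cW_ltW_left _ hi]
    · rw [opT_gt, gtT_apply, gtT_apply, cT_nd, tr_node d, wt_nd, bodyL_nd, bodyL_nd,
        cW_gtW_left hi]
    · rw [opT_bar, barT_apply, barT_apply, cT_nd, tr_node c, cT_nd, bodyL_nd, bodyL_nd,
        cW_bmW_left _ hi]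

theorem cB_opT_right {g : PTree} (hg : g ∈ cells 2) {a b t i : ℕ} {x y z : TreeMod}
    (hx : x ∈ Finsupp.supported ℤ ℤ (cells a)) (hy : y ∈ Finsupp.supported ℤ ℤ (cells b))
    (hz : z ∈ Finsupp.supported ℤ ℤ (nodesOfDim t)) (hi : a ≤ i) (hi' : i < a + b) :
    cB i (opT g x y) z = opT g x (cB (i - a) y z) := by
  apply eq_of_tr_of_mem z hz; rintro U ⟨-, rfl⟩
  apply eq_of_tr_of_mem x hx; clear hx; intro x hx
  apply eq_of_tr_of_mem y hy; clear hy; intro y hy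
  rw [cB_tr_right, cB_tr_right]
  obtain ⟨hx, rfl⟩ := hx
  obtain ⟨hy, rfl⟩ := hy
  cases x with
  | leaf => exact absurd rfl hx
  | node c C => cases y with
  | leaf => exact absurd rfl hy
  | node d D =>
    rcases eq_of_mem_cells_two hg with rfl | rfl | rfl
    · rw [opT_lt, ltT_apply, ltT_apply, cT_nd, tr_node c, bodyL_nd, cW_ltW_right _ hi hi']
      rfl
    · rw [opT_gt, gtT_apply, gtT_apply, cT_nd, tr_node d, cT_nd, bodyL_nd, bodyL_nd,
        cW_gtW_right hi]
    · rw [opT_bar, barT_apply, barT_apply, cT_nd, tr_node c, bodyL_nd, cW_bmW_right _ hi hi']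
      rfl

/-- The powers of 2 are distinct, so the eigenvalue of `wt 2` determines the dimension of every tree
that occurs in `x`. -/
theorem mem_nodesOfDim {n t : ℕ} {x : TreeMod} (hx : x ∈ Finsupp.supported ℤ ℤ (cells n))
    (h : wt 2 x = (2 : ℤ) ^ t • x) : x ∈ Finsupp.supported ℤ ℤ (nodesOfDim t) := by
  have hw : ∀ (x : TreeMod) T, wt 2 x T = 2 ^ T.dim * x T := fun x T => by
    refine Finsupp.eq_of_additive (f := fun x : TreeMod => wt 2 x T)
      (g := fun x : TreeMod => 2 ^ T.dim * x T) x (fun x y => by simp)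
      (fun x y => by simp [mul_add]) fun a => ?_
    change wt 2 (tr a) T = _ * tr a T
    rw [wt_tr, Finsupp.smul_apply, smul_eq_mul]
    by_cases ha : a = T
    · rw [ha]
    · rw [tr, Finsupp.single_eq_of_ne' ha, mul_zero, mul_zero]
  rw [Finsupp.mem_supported] at hx ⊢
  intro T hT
  refine ⟨(hx hT).1, ?_⟩
  have h' := hw x T
  rw [h, Finsupp.smul_apply, smul_eq_mul] at h'
  have := mul_right_cancel₀ (Finsupp.mem_support_iff.1 hT) h'
  exact Nat.pow_right_injective (le_refl 2) (by exact_mod_cast this.symm)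

theorem opT_mem_cells {g : PTree} (hg : g ∈ cells 2) {a b : ℕ} {x y : TreeMod}
    (hx : x ∈ Finsupp.supported ℤ ℤ (cells a)) (hy : y ∈ Finsupp.supported ℤ ℤ (cells b)) :
    opT g x y ∈ Finsupp.supported ℤ ℤ (cells (a + b)) := by
  have hF : ∀ (c : PTree) (n : ℕ) (F : ForestMod),
      F ∈ Finsupp.supported ℤ ℤ (forestWithSectors n) →
      nd (pr (tr c) F) ∈ Finsupp.supported ℤ ℤ (cells (c.sectors + n)) := by
    intro c n F h
    rw [← mapDomain_node_right]
    refine mapDomain_mem_supported ?_ h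
    intro E hE
    refine ⟨by simp, ?_⟩
    have hE : E.sectors = n := hE
    rw [PTree.sectors, hE]
  suffices ∀ x ∈ cells a, ∀ y ∈ cells b,
      opT g (tr x) (tr y) ∈ Finsupp.supported ℤ ℤ (cells (a + b)) by
    have h := bilinExt_mem_supported (f := fun x y => opT g (tr x) (tr y)) this hx hy
    have h' : bilinExt (fun x y => opT g (tr x) (tr y)) x y = opT g x y := by
      apply eq_of_tr x; intro x
      apply eq_of_tr y; intro y
      exact bilinExt_single _ _ _
    rwa [h'] at h
  clear hx hy
  intro x hx y hy
  obtain ⟨hx, rfl⟩ := hx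
  obtain ⟨hy, rfl⟩ := hy
  cases x with
  | leaf => exact absurd rfl hx
  | node c C => cases y with
  | leaf => exact absurd rfl hy
  | node d D =>
    rcases eq_of_mem_cells_two hg with rfl | rfl | rfl
    · rw [opT_lt, ltT_apply, tr_node c, bodyL_nd, ltW_pr, shl_fo, PTree.sectors, add_assoc]
      exact hF _ _ _ (shuffleLast_mem _ _)
    · rw [opT_gt, gtT_apply, tr_node d, bodyL_nd, gtW_pr, sh_tr, ← mapDomain_node_left]
      refine mapDomain_mem_supported ?_ (shuffle_mem _ _)
      intro E hE
      refine ⟨by simp, ?_⟩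
      have hE : E.sectors = _ := hE
      rw [PTree.sectors, hE, PTree.sectors, PTree.sectors]; omega
    · rw [opT_bar, barT_apply, tr_node c, bodyL_nd, bmW_pr, wt_tr, map_smul, LinearMap.smul_apply,
        map_smul, PTree.sectors, add_assoc]
      refine Submodule.smul_mem _ _ (hF _ _ _ ?_)
      -- By `glue_cons` the sequence at hand is `glue` up to a sign, which is removed by multiplying
      -- with it once more.
      have h := glue_mem C (.cons d D)
      rw [glue_cons, wtF_fo, map_smul, LinearMap.smul_apply] at h
      have h2 := Submodule.smul_mem _ ((-1 : ℤ) ^ C.dim) h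
      rw [smul_smul, ← pow_add, ← two_mul, pow_mul, neg_one_sq, one_pow, one_smul] at h2
      convert h2 using 3
      simp only [PTree.sectors, PForest.sectors]; omega

end PTree

/-! ### Free operads on binary generators are dg operads -/

theorem Finsupp.eq_of_mem_supported {α V : Type} [AddCommGroup V] {f g : (α →₀ ℤ) → V}
    {s : Set α} (x : α →₀ ℤ) (hx : x ∈ Finsupp.supported ℤ ℤ s)
    (h : ∀ a ∈ s, f (Finsupp.single a 1) = g (Finsupp.single a 1))
    (hf : ∀ x y, f (x + y) = f x + f y := by
      intros; simp only [map_add, LinearMap.add_apply, smul_add, neg_add, add_zero,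
        Finsupp.mapDomain_add] <;> abel)
    (hg : ∀ x y, g (x + y) = g x + g y := by
      intros; simp only [map_add, LinearMap.add_apply, smul_add, neg_add, add_zero,
        Finsupp.mapDomain_add] <;> abel) :
    f x = g x :=
  Finsupp.eq_of_additive_of_mem_supported x hx hf hg h

theorem Finsupp.eq_of_single {α V : Type} [AddCommGroup V] {f g : (α →₀ ℤ) → V}
    (x : α →₀ ℤ) (h : ∀ a, f (Finsupp.single a 1) = g (Finsupp.single a 1))
    (hf : ∀ x y, f (x + y) = f x + f y := by
      intros; simp only [map_add, LinearMap.add_apply, smul_add, neg_add, add_zero,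
        Finsupp.mapDomain_add] <;> abel)
    (hg : ∀ x y, g (x + y) = g x + g y := by
      intros; simp only [map_add, LinearMap.add_apply, smul_add, neg_add, add_zero,
        Finsupp.mapDomain_add] <;> abel) :
    f x = g x :=
  Finsupp.eq_of_additive x hf hg h

/-- The grading of the span of a set by a function on this set is a direct sum decomposition. -/
theorem isInternal_comap_supported {α : Type} (s : Set α) (deg : α → ℕ) :
    DirectSum.IsInternal fun p =>
      (Finsupp.supported ℤ ℤ {a | deg a = p}).comap (Finsupp.supported ℤ ℤ s).subtype := by
  rw [DirectSum.isInternal_submodule_iff_iSupIndep_and_iSup_eq_top]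
  constructor
  · intro p
    have h : (⨆ j, ⨆ (_ : j ≠ p), (Finsupp.supported ℤ ℤ {a | deg a = j}).comap
        (Finsupp.supported ℤ ℤ s).subtype) ≤
        (Finsupp.supported ℤ ℤ {a | deg a ≠ p}).comap (Finsupp.supported ℤ ℤ s).subtype := by
      refine iSup₂_le fun j hj => Submodule.comap_mono (Finsupp.supported_mono ?_)
      rintro a rfl
      exact hj
    refine Disjoint.mono_right h ?_
    rw [Submodule.disjoint_def]
    intro x hx hx'
    have := Finsupp.disjoint_supported_supported (M := ℤ) (R := ℤ) (s := {a | deg a = p})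
      (t := {a | deg a ≠ p}) (Set.disjoint_left.2 fun a ha ha' => ha' ha)
    exact Subtype.ext (Submodule.disjoint_def.1 this _ hx hx')
  · rw [eq_top_iff]
    rintro ⟨x, hx⟩ -
    have key : ∀ x ∈ Finsupp.supported ℤ ℤ s, x ∈ (⨆ p,
        (Finsupp.supported ℤ ℤ {a | deg a = p}).comap (Finsupp.supported ℤ ℤ s).subtype).map
          (Finsupp.supported ℤ ℤ s).subtype := by
      intro x hx
      rw [Finsupp.supported_eq_span_single] at hx
      refine (Submodule.span_le.2 ?_) hx
      rintro _ ⟨a, ha, rfl⟩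
      refine ⟨⟨Finsupp.single a 1, Finsupp.single_mem_supported ℤ _ ha⟩, ?_, rfl⟩
      exact Submodule.mem_iSup_of_mem (deg a) (Finsupp.single_mem_supported ℤ _ rfl)
    obtain ⟨y, hy, rfl⟩ := key x hx
    exact hy

/-- Multiplication of basis elements by `q` to the power of their degree. -/
noncomputable def weight {α : Type} (deg : α → ℕ) (q : ℤ) : (α →₀ ℤ) →ₗ[ℤ] (α →₀ ℤ) :=
  Finsupp.linearCombination ℤ fun t => Finsupp.single t (q ^ deg t)

section weight
variable {α : Type} (deg : α → ℕ) (q r : ℤ)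

theorem weight_single (a : α) :
    weight deg q (Finsupp.single a 1) = q ^ deg a • Finsupp.single a 1 := by simp [weight]

theorem weight_weight (x : α →₀ ℤ) : weight deg q (weight deg r x) = weight deg (q * r) x := by
  apply Finsupp.eq_of_single x; intro a
  simp only [weight_single, map_smul, smul_smul, mul_pow]; rw [mul_comm]

theorem weight_one (x : α →₀ ℤ) : weight deg 1 x = x := by
  apply Finsupp.eq_of_single x; intro a
  rw [weight_single, one_pow, one_smul]

theorem weight_of_mem {p : ℕ} {x : α →₀ ℤ} (hx : x ∈ Finsupp.supported ℤ ℤ {a | deg a = p}) :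
    weight deg q x = q ^ p • x := by
  apply Finsupp.eq_of_mem_supported x hx
  rintro a rfl
  exact weight_single _ _ _

/-- Homogeneity becomes an eigenvalue equation, so statements about degrees follow from identities
between linear maps taken at q = 2. -/
theorem mem_supported_of_weight {p : ℕ} {x : α →₀ ℤ} (h : weight deg 2 x = (2 : ℤ) ^ p • x) :
    x ∈ Finsupp.supported ℤ ℤ {a | deg a = p} := by
  have hw : ∀ (x : α →₀ ℤ) a, weight deg 2 x a = 2 ^ deg a * x a := fun x b => by
    refine Finsupp.eq_of_additive (f := fun x : α →₀ ℤ => weight deg 2 x b)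
      (g := fun x : α →₀ ℤ => 2 ^ deg b * x b) x (fun x y => by simp)
      (fun x y => by simp [mul_add]) fun a => ?_
    rw [weight_single, Finsupp.smul_apply, smul_eq_mul]
    by_cases ha : a = b
    · rw [ha]
    · rw [Finsupp.single_eq_of_ne' ha, mul_zero, mul_zero]
  rw [Finsupp.mem_supported]
  intro a ha
  have h' := hw x a
  rw [h, Finsupp.smul_apply, smul_eq_mul] at h'
  have := mul_right_cancel₀ (Finsupp.mem_support_iff.1 ha) h'
  exact Nat.pow_right_injective (le_refl 2) (by exact_mod_cast this.symm)

end weight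

namespace FTree

variable {G : Type} (deg : G → ℕ) (dG : G → G →₀ ℤ)

/-- Joining two combinations of trees by a vertex. -/
noncomputable def nodeL (g : G) : (FTree G →₀ ℤ) →ₗ[ℤ] (FTree G →₀ ℤ) →ₗ[ℤ] (FTree G →₀ ℤ) :=
  bilinExt fun l r => Finsupp.single (node g l r) 1

/-- Joining two combinations of trees by a vertex labelled by a combination of generators. -/
noncomputable def nodeG :
    (G →₀ ℤ) →ₗ[ℤ] (FTree G →₀ ℤ) →ₗ[ℤ] (FTree G →₀ ℤ) →ₗ[ℤ] (FTree G →₀ ℤ) :=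
  Finsupp.linearCombination ℤ nodeL

/-- The weight operators given by the degree of trees. -/
noncomputable abbrev wtD (q : ℤ) : (FTree G →₀ ℤ) →ₗ[ℤ] (FTree G →₀ ℤ) := weight (degree deg) q

/-- Linear extension of the differential. -/
noncomputable def dL : (FTree G →₀ ℤ) →ₗ[ℤ] (FTree G →₀ ℤ) :=
  Finsupp.linearCombination ℤ (diff deg dG)

/-- Bilinear extension of the composition. -/
noncomputable def fB (i : ℕ) :
    (FTree G →₀ ℤ) →ₗ[ℤ] (FTree G →₀ ℤ) →ₗ[ℤ] (FTree G →₀ ℤ) :=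
  bilinExt fun S T => S.compAt deg i T

theorem nodeL_single (g : G) (l r : FTree G) :
    nodeL g (Finsupp.single l 1) (Finsupp.single r 1) = Finsupp.single (node g l r) 1 :=
  bilinExt_single _ _ _

theorem nodeG_single (g : G) : nodeG (Finsupp.single g 1) = nodeL g := by simp [nodeG]

theorem wtD_nodeL (q : ℤ) (g : G) (x y : FTree G →₀ ℤ) :
    wtD deg q (nodeL g x y) = q ^ deg g • nodeL g (wtD deg q x) (wtD deg q y) := by
  apply Finsupp.eq_of_single x; intro x
  apply Finsupp.eq_of_single y; intro y
  simp only [nodeL_single, weight_single, map_smul, LinearMap.smul_apply, degree, pow_add,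
    smul_smul]
  congr 1; ring

theorem wtD_nodeG (q : ℤ) {p : ℕ} {γ : G →₀ ℤ} (hγ : γ ∈ Finsupp.supported ℤ ℤ {g | deg g = p})
    (x y : FTree G →₀ ℤ) :
    wtD deg q (nodeG γ x y) = q ^ p • nodeG γ (wtD deg q x) (wtD deg q y) := by
  apply Finsupp.eq_of_mem_supported γ hγ
  rintro g rfl
  simp only [nodeG_single, wtD_nodeL]

theorem dL_single (T : FTree G) : dL deg dG (Finsupp.single T 1) = diff deg dG T := by simp [dL]

theorem dL_leaf : dL deg dG (Finsupp.single leaf 1) = 0 := by rw [dL_single, diff]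

theorem dL_nodeL (g : G) (x y : FTree G →₀ ℤ) :
    dL deg dG (nodeL g x y) = nodeG (dG g) x y + (-1 : ℤ) ^ deg g • nodeL g (dL deg dG x) y +
      (-1 : ℤ) ^ deg g • nodeL g (wtD deg (-1) x) (dL deg dG y) := by
  have h₁ : ∀ l r : FTree G, ∀ γ : G →₀ ℤ, γ.mapDomain (fun g => node g l r) =
      nodeG γ (Finsupp.single l 1) (Finsupp.single r 1) := fun l r γ => by
    apply Finsupp.eq_of_single γ
    intro g; rw [nodeG_single, nodeL_single, Finsupp.mapDomain_single]
  have h₂ : ∀ (r : FTree G) (x : FTree G →₀ ℤ), x.mapDomain (fun l => node g l r) =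
      nodeL g x (Finsupp.single r 1) := fun r x => by
    apply Finsupp.eq_of_single x
    intro l; rw [nodeL_single, Finsupp.mapDomain_single]
  have h₃ : ∀ (l : FTree G) (x : FTree G →₀ ℤ), x.mapDomain (fun r => node g l r) =
      nodeL g (Finsupp.single l 1) x := fun l x => by
    apply Finsupp.eq_of_single x
    intro l; rw [nodeL_single, Finsupp.mapDomain_single]
  apply Finsupp.eq_of_single x; intro x
  apply Finsupp.eq_of_single y; intro y
  rw [nodeL_single, dL_single, diff, h₁, h₂, h₃, dL_single, dL_single, weight_single]
  simp only [map_smul, LinearMap.smul_apply, smul_smul, pow_add]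

theorem fB_single (i : ℕ) (S T : FTree G) :
    fB deg i (Finsupp.single S 1) (Finsupp.single T 1) =
      (-1 : ℤ) ^ (T.degree deg * S.degreeAfter deg i) • Finsupp.single (S.graft i T) 1 := by
  refine (bilinExt_single _ _ _).trans ?_
  rw [compAt, Finsupp.smul_single, smul_eq_mul, mul_one]

theorem fB_leaf (i : ℕ) (z : FTree G →₀ ℤ) : fB deg i (Finsupp.single leaf 1) z = z := by
  apply Finsupp.eq_of_single z; intro T
  rw [fB_single, degreeAfter, graft, mul_zero, pow_zero, one_smul]

/-- Labels are ordered root, left, right, so labels grafted on the left subtree end up in front of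
the right one. Grafting on the right subtree costs nothing more at this vertex. -/
theorem fB_nodeL_left (g : G) {a t i : ℕ} {x z : FTree G →₀ ℤ} (y : FTree G →₀ ℤ)
    (hx : x ∈ Finsupp.supported ℤ ℤ (withArity G a))
    (hz : z ∈ Finsupp.supported ℤ ℤ {T | T.degree deg = t}) (hi : i < a) :
    fB deg i (nodeL g x y) z = nodeL g (fB deg i x z) (wtD deg ((-1) ^ t) y) := by
  apply Finsupp.eq_of_mem_supported z hz; rintro T rfl
  apply Finsupp.eq_of_mem_supported x hx; rintro l rfl
  apply Finsupp.eq_of_single y; intro r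
  rw [nodeL_single, fB_single, fB_single, weight_single, degreeAfter, graft, if_pos hi, if_pos hi]
  simp only [map_smul, LinearMap.smul_apply, smul_smul, nodeL_single]
  rw [← pow_mul, ← pow_add, mul_add, add_comm]

theorem fB_nodeL_right (g : G) {a i : ℕ} {x : FTree G →₀ ℤ} (y z : FTree G →₀ ℤ)
    (hx : x ∈ Finsupp.supported ℤ ℤ (withArity G a)) (hi : a ≤ i) :
    fB deg i (nodeL g x y) z = nodeL g x (fB deg (i - a) y z) := by
  apply Finsupp.eq_of_single z; intro T
  apply Finsupp.eq_of_mem_supported x hx; rintro l rfl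
  apply Finsupp.eq_of_single y; intro r
  rw [nodeL_single, fB_single, fB_single, degreeAfter, graft, if_neg (by omega),
    if_neg (by omega), map_smul, nodeL_single]

theorem fB_nodeG_left (γ : G →₀ ℤ) {a t i : ℕ} {x z : FTree G →₀ ℤ} (y : FTree G →₀ ℤ)
    (hx : x ∈ Finsupp.supported ℤ ℤ (withArity G a))
    (hz : z ∈ Finsupp.supported ℤ ℤ {T | T.degree deg = t}) (hi : i < a) :
    fB deg i (nodeG γ x y) z = nodeG γ (fB deg i x z) (wtD deg ((-1) ^ t) y) := by
  apply Finsupp.eq_of_single γ; intro g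
  rw [nodeG_single, fB_nodeL_left deg g y hx hz hi]

theorem fB_nodeG_right (γ : G →₀ ℤ) {a i : ℕ} {x : FTree G →₀ ℤ} (y z : FTree G →₀ ℤ)
    (hx : x ∈ Finsupp.supported ℤ ℤ (withArity G a)) (hi : a ≤ i) :
    fB deg i (nodeG γ x y) z = nodeG γ x (fB deg (i - a) y z) := by
  apply Finsupp.eq_of_single γ; intro g
  rw [nodeG_single, fB_nodeL_right deg g y z hx hi]

theorem single_mem_withArity (T : FTree G) :
    Finsupp.single T 1 ∈ Finsupp.supported ℤ ℤ (withArity G T.arity) :=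
  Finsupp.single_mem_supported ℤ _ rfl

theorem single_mem_degree (T : FTree G) :
    Finsupp.single T 1 ∈ Finsupp.supported ℤ ℤ {S : FTree G | S.degree deg = T.degree deg} :=
  Finsupp.single_mem_supported ℤ _ rfl

theorem graft_degree (S : FTree G) (i : ℕ) (T : FTree G) :
    (S.graft i T).degree deg = S.degree deg + T.degree deg := by
  induction S generalizing i with
  | leaf => simp only [graft, degree, zero_add]
  | node g l r hl hr =>
    simp only [graft]
    split_ifs <;> simp only [degree, hl, hr] <;> omega

theorem wtD_fB (q : ℤ) (i : ℕ) (x y : FTree G →₀ ℤ) :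
    wtD deg q (fB deg i x y) = fB deg i (wtD deg q x) (wtD deg q y) := by
  apply Finsupp.eq_of_single x; intro S
  apply Finsupp.eq_of_single y; intro T
  rw [fB_single, map_smul, weight_single, weight_single, weight_single, map_smul, map_smul,
    LinearMap.smul_apply, fB_single, graft_degree, pow_add]
  simp only [smul_smul]
  congr 1; ring

theorem dL_mem {a : ℕ} {x : FTree G →₀ ℤ} (hx : x ∈ Finsupp.supported ℤ ℤ (withArity G a)) :
    dL deg dG x ∈ Finsupp.supported ℤ ℤ (withArity G a) :=
  linearCombination_mem_supported (fun T hT => by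
    have := diff_mem deg dG T
    rwa [show T.arity = a from hT] at this) hx

section
variable {deg dG}

theorem wtD_dL (hdeg : ∀ g, dG g ∈ Finsupp.supported ℤ ℤ {g' | deg g' = deg g + 1})
    (q : ℤ) (x : FTree G →₀ ℤ) :
    wtD deg q (dL deg dG x) = q • dL deg dG (wtD deg q x) := by
  apply Finsupp.eq_of_single x; intro T
  induction T with
  | leaf =>
    rw [weight_single, degree, pow_zero, one_smul, dL_leaf, map_zero, smul_zero]
  | node g l r hl hr =>
    simp only [← nodeL_single, dL_nodeL, wtD_nodeL, map_add, map_smul, hl, hr, smul_add,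
      LinearMap.smul_apply, wtD_nodeG deg q (hdeg g), pow_succ, smul_smul]
    rw [weight_weight, weight_weight, mul_comm q (-1)]
    congr 1
    · congr 1
      · rw [mul_comm]
      · congr 1; ring
    · congr 1; ring

theorem dL_nodeG {p : ℕ} {γ : G →₀ ℤ} (hγ : γ ∈ Finsupp.supported ℤ ℤ {g | deg g = p})
    (x y : FTree G →₀ ℤ) :
    dL deg dG (nodeG γ x y) = nodeG (Finsupp.linearCombination ℤ dG γ) x y +
      (-1 : ℤ) ^ p • nodeG γ (dL deg dG x) y +
      (-1 : ℤ) ^ p • nodeG γ (wtD deg (-1) x) (dL deg dG y) := by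
  apply Finsupp.eq_of_mem_supported γ hγ
  rintro g rfl
  rw [nodeG_single, dL_nodeL, Finsupp.linearCombination_single, one_smul]

/-- The mixed terms, where the differential falls on two different factors, cancel in pairs, since
the differential changes the parity of the factor on which it acts. -/
theorem dL_dL (hdeg : ∀ g, dG g ∈ Finsupp.supported ℤ ℤ {g' | deg g' = deg g + 1})
    (hdd : ∀ g, Finsupp.linearCombination ℤ dG (dG g) = 0) (x : FTree G →₀ ℤ) :
    dL deg dG (dL deg dG x) = 0 := by
  apply Finsupp.eq_of_single x; intro T
  induction T with
  | leaf => rw [dL_leaf, map_zero]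
  | node g l r hl hr =>
    have h := wtD_dL hdeg (-1) (Finsupp.single l 1)
    simp only [← nodeL_single, dL_nodeL, map_add, map_smul, hl, hr, dL_nodeG (hdeg g), hdd,
      map_zero, LinearMap.zero_apply, h, neg_smul, one_smul, map_neg, LinearMap.neg_apply,
      smul_add, smul_zero, smul_neg, pow_succ, mul_neg_one]
    abel

theorem dL_fB (hdeg : ∀ g, dG g ∈ Finsupp.supported ℤ ℤ {g' | deg g' = deg g + 1})
    (S : FTree G) {i t : ℕ} (hi : i < S.arity) {z : FTree G →₀ ℤ}
    (hz : z ∈ Finsupp.supported ℤ ℤ {T : FTree G | T.degree deg = t}) :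
    dL deg dG (fB deg i (Finsupp.single S 1) z) = fB deg i (dL deg dG (Finsupp.single S 1)) z +
      (-1 : ℤ) ^ S.degree deg • fB deg i (Finsupp.single S 1) (dL deg dG z) := by
  have hz' : dL deg dG z ∈ Finsupp.supported ℤ ℤ {T : FTree G | T.degree deg = t + 1} := by
    refine mem_supported_of_weight _ ?_
    have := wtD_dL hdeg 2 z
    rw [weight_of_mem _ _ hz, map_smul, smul_smul] at this
    rw [this, pow_succ, mul_comm]
  induction S generalizing i with
  | leaf =>
    rw [fB_leaf, fB_leaf, dL_leaf, map_zero, LinearMap.zero_apply, degree, pow_zero, one_smul,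
      zero_add]
  | node g l r hl hr =>
    have ml := single_mem_withArity l
    have mdl := dL_mem deg dG ml
    have mwl : wtD deg (-1) (Finsupp.single l 1) ∈
        Finsupp.supported ℤ ℤ (withArity G l.arity) := by
      rw [weight_single]; exact Submodule.smul_mem _ _ ml
    rw [← nodeL_single]
    rcases lt_or_ge i l.arity with h | h
    · have hs : ((-1 : ℤ) ^ t * (-1) ^ t) = 1 := by rw [← mul_pow]; norm_num
      have hd : dL deg dG (wtD deg ((-1) ^ t) (Finsupp.single r 1)) =
          (-1 : ℤ) ^ t • wtD deg ((-1) ^ t) (dL deg dG (Finsupp.single r 1)) := by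
        rw [wtD_dL hdeg, smul_smul, hs, one_smul]
      simp only [fB_nodeL_left deg g _ ml hz h, dL_nodeL, map_add, map_smul, LinearMap.add_apply,
        LinearMap.smul_apply, fB_nodeG_left deg _ _ ml hz h, fB_nodeL_left deg g _ mdl hz h,
        fB_nodeL_left deg g _ mwl hz h, fB_nodeL_left deg g _ ml hz' h, hl h, wtD_fB, hd,
        weight_of_mem _ _ hz]
      simp only [weight_single, map_smul, LinearMap.smul_apply, smul_add, smul_smul, degree,
        pow_add, mul_pow, pow_one]
      -- In the term where the differential falls on `z`, the degree is `t + 1`, and the additional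
      -- sign for passing `r` cancels the part of the degree of `S` that comes from `r`.
      have e : (-1 : ℤ) ^ deg g * (-1) ^ l.degree deg * (-1) ^ r.degree deg *
          (((-1) ^ t) ^ r.degree deg * (-1) ^ r.degree deg) =
          (-1) ^ deg g * ((-1) ^ l.degree deg * ((-1) ^ t) ^ r.degree deg) := by
        have : ((-1 : ℤ) ^ r.degree deg * (-1) ^ r.degree deg) = 1 := by
          rw [← mul_pow]; norm_num
        linear_combination (-1 : ℤ) ^ deg g * (-1) ^ l.degree deg *
          ((-1) ^ t) ^ r.degree deg * this
      rw [e, ← mul_assoc ((-1 : ℤ) ^ t) ((-1) ^ t), hs, one_mul]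
      abel
    · simp only [fB_nodeL_right deg g _ _ ml h, dL_nodeL, map_add, map_smul, LinearMap.add_apply,
        LinearMap.smul_apply, fB_nodeG_right deg _ _ _ ml h, fB_nodeL_right deg g _ _ mdl h,
        fB_nodeL_right deg g _ _ mwl h, hr (i := i - l.arity) (by simp only [arity] at hi; omega)]
      simp only [weight_single, map_smul, LinearMap.smul_apply, smul_add, smul_smul, degree,
        pow_add]
      module

theorem dL_fB_of_mem (hdeg : ∀ g, dG g ∈ Finsupp.supported ℤ ℤ {g' | deg g' = deg g + 1})
    {n i : ℕ} (hi : i < n) {x : FTree G →₀ ℤ} (hx : x ∈ Finsupp.supported ℤ ℤ (withArity G n))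
    (y : FTree G →₀ ℤ) :
    dL deg dG (fB deg i x y) =
      fB deg i (dL deg dG x) y + fB deg i (wtD deg (-1) x) (dL deg dG y) := by
  apply Finsupp.eq_of_mem_supported x hx; rintro S rfl
  apply Finsupp.eq_of_single y; intro T
  rw [dL_fB hdeg S hi (single_mem_degree deg T), weight_single, map_smul, LinearMap.smul_apply]

end

theorem graft_leaf (T : FTree G) (i : ℕ) : T.graft i leaf = T := by
  induction T generalizing i with
  | leaf => rfl
  | node g l r hl hr => rw [graft, hl, hr, ite_self]

theorem graft_graft_same {S T U : FTree G} {i j : ℕ} (hi : i < S.arity) (hj : j < T.arity) :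
    (S.graft i T).graft (i + j) U = S.graft i (T.graft j U) ∧
      (S.graft i T).degreeAfter deg (i + j) = T.degreeAfter deg j + S.degreeAfter deg i := by
  induction S generalizing i with
  | leaf =>
    rw [arity, Nat.lt_one_iff] at hi
    subst hi
    simp only [graft, degreeAfter, zero_add, add_zero, and_self]
  | node g l r hl hr =>
    have hT := graft_arity l i T
    rcases lt_or_ge i l.arity with h | h
    · obtain ⟨h₁, h₂⟩ := hl h
      simp only [graft, degreeAfter, if_pos h, if_pos (show i + j < (l.graft i T).arity by omega),
        h₁, h₂, true_and]
      omega
    · obtain ⟨h₁, h₂⟩ := hr (i := i - l.arity) (by simp only [arity] at hi; omega)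
      have e : i + j - l.arity = i - l.arity + j := by omega
      simp only [graft, degreeAfter, if_neg (show ¬ i < l.arity by omega),
        if_neg (show ¬ i + j < l.arity by omega), e, h₁, h₂, and_self]

/-- The last equality is the source of the Koszul sign: once `U` is grafted on the later leaf, `T`
has to pass it, whereas `U` never has to pass `T`. -/
theorem graft_graft_of_lt {S T U : FTree G} {i j l : ℕ} (hij : i < j) (hj : j < S.arity)
    (hl : l + 1 = j + T.arity) :
    (S.graft i T).graft l U = (S.graft j U).graft i T ∧
      (S.graft i T).degreeAfter deg l = S.degreeAfter deg j ∧
      (S.graft j U).degreeAfter deg i = S.degreeAfter deg i + U.degree deg := by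
  induction S generalizing i j l with
  | leaf => simp only [arity] at hj; omega
  | node g a b ha hb =>
    have hT := graft_arity a i T
    have hU := graft_arity a j U
    have pT := arity_pos T
    have pU := arity_pos U
    simp only [arity] at hj
    rcases lt_or_ge j a.arity with h | h
    · obtain ⟨h₁, h₂, h₃⟩ := ha hij h hl
      simp only [graft, degreeAfter, if_pos h, if_pos (hij.trans h),
        if_pos (show l < (a.graft i T).arity by omega),
        if_pos (show i < (a.graft j U).arity by omega), h₁, h₂, h₃, true_and]
      omega
    · have hj' : ¬ j < a.arity := by omega
      rcases lt_or_ge i a.arity with h' | h'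
      · simp only [graft, degreeAfter, if_pos h', if_neg hj',
          if_neg (show ¬ l < (a.graft i T).arity by omega), graft_degree,
          show l - (a.graft i T).arity = j - a.arity by omega, true_and]
        omega
      · obtain ⟨h₁, h₂, h₃⟩ := hb (i := i - a.arity) (j := j - a.arity) (l := l - a.arity)
          (by omega) (by omega) (by omega)
        simp only [graft, degreeAfter, if_neg hj', if_neg (show ¬ i < a.arity by omega),
          if_neg (show ¬ l < a.arity by omega), h₁, h₂, h₃, and_self]

end FTree

open FTree in
theorem freeBinaryOperad_isDGOperad {G : Type} {deg : G → ℕ} {dG : G → G →₀ ℤ}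
    (hdeg : ∀ g, dG g ∈ Finsupp.supported ℤ ℤ {g' | deg g' = deg g + 1})
    (hdd : ∀ g, Finsupp.linearCombination ℤ dG (dG g) = 0) :
    (freeBinaryOperad G deg dG).IsDGOperad where
  isInternal n := isInternal_comap_supported (withArity G n) (degree deg)
  one_mem := Finsupp.single_mem_supported ℤ _ rfl
  comp_mem {n m k p q} i h x y hx hy := by
    refine mem_supported_of_weight (degree deg) ?_
    change wtD deg 2 (fB deg i x.1 y.1) = (2 : ℤ) ^ (p + q) • fB deg i x.1 y.1
    rw [wtD_fB, weight_of_mem _ _ (show x.1 ∈ _ from hx), weight_of_mem _ _ (show y.1 ∈ _ from hy)]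
    simp only [map_smul, LinearMap.smul_apply, smul_smul, pow_add]
    rw [mul_comm]
  d_mem {n p} x hx := by
    refine mem_supported_of_weight (degree deg) ?_
    change wtD deg 2 (dL deg dG x.1) = (2 : ℤ) ^ (p + 1) • dL deg dG x.1
    rw [wtD_dL hdeg, weight_of_mem _ _ (show x.1 ∈ _ from hx), map_smul, smul_smul, pow_succ,
      mul_comm]
  d_d x := Subtype.ext (dL_dL hdeg hdd x.1)
  d_one := Subtype.ext (dL_leaf deg dG)
  d_comp {n m k p} i h x y hx := by
    refine Subtype.ext ?_
    change dL deg dG (fB deg i x.1 y.1) = fB deg i (dL deg dG x.1) y.1 +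
      (-1 : ℤ) ^ p • fB deg i x.1 (dL deg dG y.1)
    have hx' := weight_of_mem _ (-1) (show x.1 ∈ Finsupp.supported ℤ ℤ _ from hx)
    rw [← LinearMap.smul_apply, ← map_smul, ← hx', dL_fB_of_mem hdeg i.2 x.2]
  one_comp h x := Subtype.ext (fB_leaf deg _ x.1)
  comp_one {n} i h x := by
    refine Subtype.ext ?_
    change fB deg i x.1 (Finsupp.single leaf 1) = x.1
    generalize x.1 = x
    apply Finsupp.eq_of_single x; intro S
    rw [fB_single, degree, zero_mul, pow_zero, one_smul, graft_leaf]
  comp_assoc {n m a k r q} h₁ h₂ h₃ h₄ i j l hl x y z := by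
    refine Subtype.ext ?_
    change fB deg l (fB deg i x.1 y.1) z.1 = fB deg i x.1 (fB deg j y.1 z.1)
    obtain ⟨x, hx⟩ := x
    obtain ⟨y, hy⟩ := y
    generalize z.1 = z
    dsimp only
    apply Finsupp.eq_of_mem_supported x hx; rintro S rfl
    apply Finsupp.eq_of_mem_supported y hy; rintro T rfl
    apply Finsupp.eq_of_single z; intro U
    obtain ⟨e₁, e₂⟩ := graft_graft_same deg (U := U) i.2 j.2
    simp only [fB_single, map_smul, LinearMap.smul_apply, smul_smul, hl, e₁, e₂, graft_degree]
    rw [← pow_add, ← pow_add]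
    congr 2; ring
  comp_comm {n m a k r q s t} h₁ h₂ h₃ h₄ i j hij l hl i' hi' x y z hy hz := by
    refine Subtype.ext ?_
    change fB deg l (fB deg i x.1 y.1) z.1 = (-1 : ℤ) ^ (s * t) • fB deg i' (fB deg j x.1 z.1) y.1
    -- Absorbed in a weight operator, the sign no longer refers to the degree of `z`, so both sides
    -- are additive in an arbitrary `z`.
    have hz' : (-1 : ℤ) ^ (s * t) • z.1 = wtD deg ((-1) ^ s) z.1 := by
      rw [weight_of_mem _ _ (show z.1 ∈ Finsupp.supported ℤ ℤ _ from hz), pow_mul]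
    rw [← LinearMap.smul_apply, ← map_smul, ← map_smul, hz']
    have hy' : y.1 ∈ Finsupp.supported ℤ ℤ
        (withArity G m ∩ {T | T.degree deg = s}) := by
      rw [Finsupp.supported_inter]; exact ⟨y.2, hy⟩
    obtain ⟨x, hx⟩ := x
    generalize z.1 = z
    generalize y.1 = y at hy'
    dsimp only
    apply Finsupp.eq_of_mem_supported x hx; rintro S rfl
    apply Finsupp.eq_of_mem_supported y hy'; rintro T ⟨rfl, rfl⟩
    apply Finsupp.eq_of_single z; intro U
    obtain ⟨e₁, e₂, e₃⟩ := graft_graft_of_lt deg (S := S) (T := T) (U := U) hij j.2 hl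
    simp only [fB_single, map_smul, LinearMap.smul_apply, smul_smul, hi', e₁, e₂, e₃,
      weight_single]
    congr 1
    rw [← pow_mul, ← pow_add, ← pow_add, ← pow_add]
    refine neg_one_pow_congr ?_
    simp only [Nat.even_add, Nat.even_mul]
    tauto

/-! ### Morphisms of dg operads -/

namespace DGOperadData

variable {R : Type} [CommRing R]

/-- Morphisms of nonsymmetric dg operads. -/
structure Morphism (P Q : DGOperadData R) where
  map : ∀ n, P.obj n →ₗ[R] Q.obj n
  map_gr : ∀ n p (x : P.obj n), x ∈ P.gr n p → map n x ∈ Q.gr n p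
  map_d : ∀ n (x : P.obj n), map n (P.d n x) = Q.d n (map n x)
  map_one : map 1 P.one = Q.one
  map_comp : ∀ {n m k : ℕ} (i : Fin n) (h : n + m = k + 1) (x : P.obj n) (y : P.obj m),
    map k (P.comp i h x y) = Q.comp i h (map n x) (map m y)

namespace Morphism

variable {P Q : DGOperadData R} (f : Morphism P Q)

/-- The kernel of a morphism. -/
def ker : P.OpIdeal where
  carrier n := LinearMap.ker (f.map n)
  comp_mem_left i h x y hx := by
    rw [LinearMap.mem_ker] at hx ⊢
    rw [f.map_comp, hx, map_zero, LinearMap.zero_apply]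
  comp_mem_right i h x y hy := by
    rw [LinearMap.mem_ker] at hy ⊢
    rw [f.map_comp, hy, map_zero]

/-- The image of a dg operad under a morphism that is surjective in each degree is a dg operad. -/
theorem isDGOperad (hP : P.IsDGOperad) (hQ : ∀ n, DirectSum.IsInternal (Q.gr n))
    (surj : ∀ n, Function.Surjective (f.map n))
    (lift : ∀ n p, ∀ y ∈ Q.gr n p, ∃ x ∈ P.gr n p, f.map n x = y) : Q.IsDGOperad where
  isInternal := hQ
  one_mem := f.map_one ▸ f.map_gr _ _ _ hP.one_mem
  comp_mem i h x y hx hy := by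
    obtain ⟨x, hx', rfl⟩ := lift _ _ x hx
    obtain ⟨y, hy', rfl⟩ := lift _ _ y hy
    rw [← f.map_comp]
    exact f.map_gr _ _ _ (hP.comp_mem i h x y hx' hy')
  d_mem x hx := by
    obtain ⟨x, hx', rfl⟩ := lift _ _ x hx
    rw [← f.map_d]
    exact f.map_gr _ _ _ (hP.d_mem x hx')
  d_d x := by
    obtain ⟨x, rfl⟩ := surj _ x
    rw [← f.map_d, ← f.map_d, hP.d_d, map_zero]
  d_one := by rw [← f.map_one, ← f.map_d, hP.d_one, map_zero]
  d_comp i h x y hx := by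
    obtain ⟨x, hx', rfl⟩ := lift _ _ x hx
    obtain ⟨y, rfl⟩ := surj _ y
    rw [← f.map_comp, ← f.map_d, ← f.map_d, ← f.map_d, ← f.map_comp, ← f.map_comp,
      hP.d_comp i h x y hx', map_add, map_smul]
  one_comp h x := by
    obtain ⟨x, rfl⟩ := surj _ x
    rw [← f.map_one, ← f.map_comp, hP.one_comp]
  comp_one i h x := by
    obtain ⟨x, rfl⟩ := surj _ x
    rw [← f.map_one, ← f.map_comp, hP.comp_one]
  comp_assoc h₁ h₂ h₃ h₄ i j l hl x y z := by
    obtain ⟨x, rfl⟩ := surj _ x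
    obtain ⟨y, rfl⟩ := surj _ y
    obtain ⟨z, rfl⟩ := surj _ z
    rw [← f.map_comp, ← f.map_comp, ← f.map_comp, ← f.map_comp,
      hP.comp_assoc h₁ h₂ h₃ h₄ i j l hl]
  comp_comm h₁ h₂ h₃ h₄ i j hij l hl i' hi' x y z hy hz := by
    obtain ⟨x, rfl⟩ := surj _ x
    obtain ⟨y, hy', rfl⟩ := lift _ _ y hy
    obtain ⟨z, hz', rfl⟩ := lift _ _ z hz
    rw [← f.map_comp, ← f.map_comp, ← f.map_comp, ← f.map_comp,
      hP.comp_comm h₁ h₂ h₃ h₄ i j hij l hl i' hi' x y z hy' hz', map_smul]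

/-- The isomorphism between the quotient by the kernel and the image. -/
noncomputable def quotientIso (I : P.OpIdeal) (hd : I.IsDStable)
    (hI : ∀ n, I.carrier n = LinearMap.ker (f.map n))
    (surj : ∀ n, Function.Surjective (f.map n))
    (lift : ∀ n p, ∀ y ∈ Q.gr n p, ∃ x ∈ P.gr n p, f.map n x = y) :
    (P.quotient I hd).Iso Q where
  equiv n := (Submodule.quotEquivOfEq _ _ (hI n)).trans
    ((f.map n).quotKerEquivOfSurjective (surj n))
  map_gr n p x := by
    obtain ⟨x, rfl⟩ := Submodule.mkQ_surjective _ x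
    change f.map n x ∈ Q.gr n p ↔ _ ∈ (P.gr n p).map (I.carrier n).mkQ
    constructor
    · intro h
      obtain ⟨x', hx', e⟩ := lift n p _ h
      refine ⟨x', hx', (Submodule.Quotient.eq _).2 ?_⟩
      rw [hI, LinearMap.mem_ker, map_sub, e, sub_self]
    · rintro ⟨x', hx', e⟩
      have := (Submodule.Quotient.eq _).1 e
      rw [hI, LinearMap.mem_ker, map_sub, sub_eq_zero] at this
      rw [← this]
      exact f.map_gr _ _ _ hx'
  map_d n x := by
    obtain ⟨x, rfl⟩ := Submodule.mkQ_surjective _ x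
    exact f.map_d n x
  map_one := f.map_one
  map_comp i h x y := by
    obtain ⟨x, rfl⟩ := Submodule.mkQ_surjective _ x
    obtain ⟨y, rfl⟩ := Submodule.mkQ_surjective _ y
    exact f.map_comp i h x y

end Morphism

theorem idealSpan_le (P : DGOperadData R) {a : ℕ} {S : Set (P.obj a)} (J : P.OpIdeal)
    (h : S ⊆ J.carrier a) (n : ℕ) : (P.idealSpan S).carrier n ≤ J.carrier n :=
  iInf₂_le J h

theorem subset_idealSpan (P : DGOperadData R) {a : ℕ} (S : Set (P.obj a)) :
    S ⊆ (P.idealSpan S).carrier a := fun x hx => by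
  change x ∈ ⨅ (J : P.OpIdeal) (_ : S ⊆ J.carrier a), J.carrier a
  simp only [Submodule.mem_iInf]
  exact fun J hJ => hJ hx

end DGOperadData

/-! ### Evaluation of trees -/

/-- Three binary operations, together with a parity operator and a distinguished element. -/
structure TriOps (Q : Type) [AddCommGroup Q] where
  lt : Q →ₗ[ℤ] Q →ₗ[ℤ] Q
  gt : Q →ₗ[ℤ] Q →ₗ[ℤ] Q
  bar : Q →ₗ[ℤ] Q →ₗ[ℤ] Q
  parity : Q →ₗ[ℤ] Q
  one : Q

namespace TriOps

open PTree

variable {Q : Type} [AddCommGroup Q] (A : TriOps Q)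

mutual
/-- The operation `T > -`; for the leaf, this is the identity. -/
noncomputable def actL : PTree → Q →ₗ[ℤ] Q
  | .leaf => LinearMap.id
  | .node c cs => A.gt (evF cs (actL c A.one))
/-- The operation `- < T`; for the leaf, this is the identity. -/
noncomputable def actR : PTree → Q →ₗ[ℤ] Q
  | .leaf => LinearMap.id
  | .node c cs => A.lt.flip (evF cs (actL c A.one))
/-- Adding the siblings `F` on the right of the vertex. -/
noncomputable def evF : PForest → Q →ₗ[ℤ] Q
  | .one c => actR c
  | .cons c cs => (A.bar.flip (evF cs (actL c A.one))).comp A.parity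
end

/-- The value of a tree, each sector being replaced by the distinguished element. -/
noncomputable def ev : PTree → Q
  | .leaf => 0
  | .node c cs => A.evF cs (A.actL c A.one)

/-- Linear extension of `actL`. -/
noncomputable def LL : TreeMod →ₗ[ℤ] Q →ₗ[ℤ] Q := Finsupp.linearCombination ℤ A.actL
/-- Linear extension of `actR`. -/
noncomputable def RR : TreeMod →ₗ[ℤ] Q →ₗ[ℤ] Q := Finsupp.linearCombination ℤ A.actR
/-- Linear extension of `evF`. -/
noncomputable def EF : ForestMod →ₗ[ℤ] Q →ₗ[ℤ] Q := Finsupp.linearCombination ℤ A.evF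
/-- Linear extension of `ev`. -/
noncomputable def ET : TreeMod →ₗ[ℤ] Q := Finsupp.linearCombination ℤ A.ev
/-- The value of a tree in terms of the children of its root. -/
noncomputable def EW : PairMod →ₗ[ℤ] Q :=
  Finsupp.linearCombination ℤ fun p => A.evF p.2 (A.actL p.1 A.one)

theorem LL_tr (x : PTree) : A.LL (tr x) = A.actL x := by simp [LL, tr]
theorem RR_tr (x : PTree) : A.RR (tr x) = A.actR x := by simp [RR, tr]
theorem EF_fo (x : PForest) : A.EF (fo x) = A.evF x := by simp [EF, fo]
theorem ET_tr (x : PTree) : A.ET (tr x) = A.ev x := by simp [ET, tr]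

theorem EW_pr (x : TreeMod) (F : ForestMod) : A.EW (pr x F) = A.EF F (A.LL x A.one) := by
  apply eq_of_tr x; intro x
  apply eq_of_fo F; intro F
  rw [pr_tr_fo, LL_tr, EF_fo]; simp [EW]

theorem ET_nd (w : PairMod) : A.ET (nd w) = A.EW w := by
  apply eq_of_pr w; intro c F
  rw [← tr_node, ET_tr, ev, EW_pr, LL_tr, EF_fo]

theorem LL_lf (X : Q) : A.LL lf X = X := by
  rw [← tr_leaf, LL_tr, actL]; rfl

theorem RR_lf (X : Q) : A.RR lf X = X := by
  rw [← tr_leaf, RR_tr, actR]; rfl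

theorem LL_nd (w : PairMod) (X : Q) : A.LL (nd w) X = A.gt (A.EW w) X := by
  apply eq_of_pr w; intro c F
  rw [← tr_node, LL_tr, actL, EW_pr, LL_tr, EF_fo]

theorem RR_nd (w : PairMod) (X : Q) : A.RR (nd w) X = A.lt X (A.EW w) := by
  apply eq_of_pr w; intro c F
  rw [← tr_node, RR_tr, actR, EW_pr, LL_tr, EF_fo, LinearMap.flip_apply]

theorem EF_on (x : TreeMod) : A.EF (on x) = A.RR x := by
  apply eq_of_tr x; intro x
  rw [← fo_one, EF_fo, evF, RR_tr]

theorem EF_cn (w : PairMod) (X : Q) : A.EF (cn w) X = A.bar (A.parity X) (A.EW w) := by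
  apply eq_of_pr w; intro c F
  rw [← fo_cons, EF_fo, evF, EW_pr, LL_tr, EF_fo]; rfl

/-- Evaluation is compatible with operators that rescale the operations. -/
theorem EW_wtW {q : ℤ} (σ : Q →ₗ[ℤ] Q) (hlt : ∀ x y, σ (A.lt x y) = A.lt (σ x) (σ y))
    (hgt : ∀ x y, σ (A.gt x y) = A.gt (σ x) (σ y))
    (hbar : ∀ x y, σ (A.bar x y) = q • A.bar (σ x) (σ y))
    (hp : ∀ x, σ (A.parity x) = A.parity (σ x)) (hone : σ A.one = A.one) :
    (∀ w, σ (A.EW w) = A.EW (wtW q w)) ∧ ∀ x X, σ (A.LL x X) = A.LL (wt q x) (σ X) := by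
  suffices h : ∀ x : PTree,
      (∀ X, σ (A.LL (tr x) X) = A.LL (wt q (tr x)) (σ X)) ∧
        ∀ X, σ (A.RR (tr x) X) = A.RR (wt q (tr x)) (σ X) by
    have hL : ∀ x X, σ (A.LL x X) = A.LL (wt q x) (σ X) := fun x X => by
      apply eq_of_tr x; intro x; exact (h x).1 X
    refine ⟨fun w => ?_, hL⟩
    apply eq_of_pr w; intro c F
    induction F using PForest.list_induction generalizing c with
    | one d => rw [wtW_pr, EW_pr, EW_pr, fo_one, wtF_on, EF_on, EF_on, (h d).2, hL, hone]
    | cons d D ih =>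
      rw [wtW_pr, EW_pr, EW_pr, fo_cons, wtF_cn, EF_cn, hbar, hp, hL, hone, ih, map_smul,
        LinearMap.smul_apply, EF_cn]
  intro x
  induction x using PTree.rec
    (motive_2 := fun F => ∀ X, σ (A.EF (fo F) X) = A.EF (wtF q (fo F)) (σ X)) with
  | leaf => simp only [tr_leaf, wt_lf, LL_lf, RR_lf, implies_true, and_self]
  | node c F hc hF =>
    have h : σ (A.EW (pr (tr c) (fo F))) = A.EW (wtW q (pr (tr c) (fo F))) := by
      rw [wtW_pr, EW_pr, EW_pr, hF, hc.1, hone]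
    simp only [tr_node, wt_nd, LL_nd, RR_nd, hgt, hlt, h, implies_true, and_self]
  | one c hc =>
    rename_i X
    rw [fo_one, wtF_on, EF_on, EF_on, hc.2]
  | cons c F hc hF =>
    rename_i X
    have h : σ (A.EW (pr (tr c) (fo F))) = A.EW (wtW q (pr (tr c) (fo F))) := by
      rw [wtW_pr, EW_pr, EW_pr, hF, hc.1, hone]
    rw [fo_cons, wtF_cn, map_smul, LinearMap.smul_apply, EF_cn, EF_cn, hbar, hp, h]

/-- Evaluation is compatible with morphisms. -/
theorem map_ev {Q' : Type} [AddCommGroup Q'] (B : TriOps Q') (f : Q →ₗ[ℤ] Q')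
    (hlt : ∀ x y, f (A.lt x y) = B.lt (f x) (f y))
    (hgt : ∀ x y, f (A.gt x y) = B.gt (f x) (f y))
    (hbar : ∀ x y, f (A.bar x y) = B.bar (f x) (f y))
    (hp : ∀ x, f (A.parity x) = B.parity (f x)) (hone : f A.one = B.one) (T : PTree) :
    f (A.ev T) = B.ev T := by
  have h : ∀ x : PTree, (∀ X, f (A.actL x X) = B.actL x (f X)) ∧
      (∀ X, f (A.actR x X) = B.actR x (f X)) ∧ f (A.ev x) = B.ev x := by
    intro x
    induction x using PTree.rec
      (motive_2 := fun F => ∀ X, f (A.evF F X) = B.evF F (f X)) with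
    | leaf => simp [actL, actR, ev]
    | node c F hc hF =>
      simp only [actL, actR, ev, hgt, hlt, hF, hc.1, hone, LinearMap.flip_apply, implies_true,
        and_self]
    | one c hc => simpa only [evF] using hc.2.1 _
    | cons c F hc hF =>
      simp only [evF, LinearMap.comp_apply, LinearMap.flip_apply, hbar, hp, hF, hc.1, hone]
  exact (h T).2.2

/-- The relations satisfied by the three operations on trees. -/
structure Laws : Prop where
  lt_gt : ∀ a b c, A.gt a (A.lt b c) = A.lt (A.gt a b) c
  gt_gt : ∀ a b c, A.gt a (A.gt b c) = A.gt (A.gt a b) c + A.gt (A.lt a b) c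
  lt_lt : ∀ a b c, A.lt (A.lt a b) c = A.lt a (A.lt b c) + A.lt a (A.gt b c)
  gt_bar : ∀ a b c, A.gt (A.parity a) (A.bar b c) = A.bar (A.gt a b) c
  bar_lt : ∀ a b c, A.lt (A.bar a b) c = A.bar a (A.lt b c)
  lt_bar : ∀ a b c, A.bar (A.lt a b) c = A.bar a (A.gt b c)
  bar_bar : ∀ a b c, A.bar (A.bar a b) c = -A.bar (A.parity a) (A.bar b c)
  parity_lt : ∀ a b, A.parity (A.lt a b) = A.lt (A.parity a) (A.parity b)
  parity_gt : ∀ a b, A.parity (A.gt a b) = A.gt (A.parity a) (A.parity b)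
  parity_bar : ∀ a b, A.parity (A.bar a b) = -A.bar (A.parity a) (A.parity b)
  parity_parity : ∀ a, A.parity (A.parity a) = a
  parity_one : A.parity A.one = A.one

namespace Laws

variable {A}

theorem parity_EW (hA : A.Laws) : (∀ w, A.parity (A.EW w) = A.EW (wtW (-1) w)) ∧
    ∀ x X, A.parity (A.LL x X) = A.LL (wt (-1) x) (A.parity X) :=
  A.EW_wtW A.parity hA.parity_lt hA.parity_gt
    (fun x y => by rw [hA.parity_bar, neg_one_smul]) (fun _ => rfl) hA.parity_one

theorem LL_RR (hA : A.Laws) (x y : TreeMod) (X : Q) : A.LL x (A.RR y X) = A.RR y (A.LL x X) := by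
  apply eq_of_lf_nd x
  · simp only [LL_lf]
  intro w
  apply eq_of_lf_nd y
  · simp only [RR_lf]
  intro v
  simp only [LL_nd, RR_nd, hA.lt_gt]

theorem bar_LL (hA : A.Laws) (x : TreeMod) (X Y : Q) :
    A.bar (A.parity (A.LL x X)) Y = A.LL x (A.bar (A.parity X) Y) := by
  apply eq_of_lf_nd x
  · simp only [LL_lf]
  intro w
  simp only [LL_nd, hA.parity_gt, ← hA.gt_bar, hA.parity_parity]

/-- Action on the left and siblings on the right commute: by the first relation when the sibling is
the last one, and by the fourth otherwise. -/
theorem EF_LL (hA : A.Laws) (F : ForestMod) (x : TreeMod) (X : Q) :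
    A.EF F (A.LL x X) = A.LL x (A.EF F X) := by
  apply eq_of_on_cn F
  · intro y; rw [EF_on, hA.LL_RR]
  · intro w; rw [EF_cn, EF_cn, hA.bar_LL]

theorem bar_RR (hA : A.Laws) (x : TreeMod) (X Y : Q) : A.bar (A.RR x X) Y = A.bar X (A.LL x Y) := by
  apply eq_of_lf_nd x
  · simp only [LL_lf, RR_lf]
  intro w
  simp only [LL_nd, RR_nd, hA.lt_bar]

theorem RR_bar (hA : A.Laws) (x : TreeMod) (X Y : Q) : A.RR x (A.bar X Y) = A.bar X (A.RR x Y) := by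
  apply eq_of_lf_nd x
  · simp only [RR_lf]
  intro w
  simp only [RR_nd, hA.bar_lt]

theorem EW_ltW_of {c : TreeMod} {F : ForestMod} {y : TreeMod}
    (h : ∀ X, A.EF (shl F y) X = A.RR y (A.EF F X)) :
    A.EW (ltW (pr c F) y) = A.RR y (A.EW (pr c F)) := by
  rw [ltW_pr, EW_pr, EW_pr, h]

theorem EW_gtW_of (hA : A.Laws) {x d : TreeMod} {F : ForestMod}
    (h : ∀ X, A.LL (sh x d) X = A.LL x (A.LL d X)) :
    A.EW (gtW x (pr d F)) = A.LL x (A.EW (pr d F)) := by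
  rw [gtW_pr, EW_pr, EW_pr, h, hA.EF_LL]

mutual
-- The second and third relations say that > and < are a left and a right action of the product < +
-- >. The shuffle is this sum on trees with a root, so it acts by composition.
theorem LL_sh_tr (hA : A.Laws) : ∀ x y : PTree,
    (∀ X, A.LL (sh (tr x) (tr y)) X = A.LL (tr x) (A.LL (tr y) X)) ∧
      ∀ X, A.RR (sh (tr x) (tr y)) X = A.RR (tr y) (A.RR (tr x) X)
  | .leaf, y => by simp only [tr_leaf, sh_lf_left, LL_lf, RR_lf, implies_true, and_self]
  | .node c C, .leaf => by
      simp only [tr_leaf, sh_lf_right, LL_lf, RR_lf, implies_true, and_self]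
  | .node c C, .node d D => by
      have h₁ := EW_ltW_of (A := A) (c := tr c) (EF_shl_fo hA C (.node d D))
      have h₂ := hA.EW_gtW_of (F := fo D) (LL_sh_tr hA (.node c C) d).1
      simp only [tr_node, sh_nd_nd, map_add, LinearMap.add_apply, LL_nd, RR_nd] at *
      simp only [h₁, h₂, hA.gt_gt, hA.lt_lt]
      exact ⟨fun X => add_comm _ _, fun X => trivial⟩
  termination_by x y => sizeOf x + sizeOf y
theorem EF_shl_fo (hA : A.Laws) : ∀ (F : PForest) (y : PTree) (X : Q),
    A.EF (shl (fo F) (tr y)) X = A.RR (tr y) (A.EF (fo F) X)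
  | .one c, y, X => by rw [fo_one, shl_on, EF_on, EF_on, (LL_sh_tr hA c y).2]
  | .cons c C, y, X => by
      rw [fo_cons, shl_cn, EF_cn, EF_cn, EW_ltW_of (EF_shl_fo hA C y), hA.RR_bar]
  termination_by F y => sizeOf F + sizeOf y
end

theorem EW_ltW (hA : A.Laws) (w : PairMod) (y : TreeMod) : A.EW (ltW w y) = A.RR y (A.EW w) := by
  apply eq_of_pr w; intro c F
  apply eq_of_tr y; intro y
  exact EW_ltW_of (hA.EF_shl_fo F y)

theorem EW_gtW (hA : A.Laws) (x : TreeMod) (w : PairMod) : A.EW (gtW x w) = A.LL x (A.EW w) := by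
  apply eq_of_pr w; intro c F
  apply eq_of_tr x; intro x
  exact hA.EW_gtW_of (hA.LL_sh_tr x c).1

/-- For a single tree, the sixth relation carries it across |. For a longer sequence, the sign of
the seventh relation cancels the one in `bm_cn`. -/
theorem EF_bm (hA : A.Laws) (F : ForestMod) (v : PairMod) (X : Q) :
    A.EF (bm F (nd v)) X = A.bar (A.EF F (A.parity X)) (A.EW v) := by
  apply eq_of_fo F; intro F
  induction F using PForest.list_induction generalizing X with
  | one c => rw [fo_one, bm_on, EF_cn, EF_on, hA.EW_gtW, hA.bar_RR]
  | cons c F ih =>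
    rw [fo_cons, bm_cn, map_neg, LinearMap.neg_apply, EF_cn, bmW_pr, EW_pr, ih, EF_cn,
      hA.parity_EW.2, wt_neg_one_neg_one, hA.parity_one, hA.parity_parity, hA.bar_bar, EW_pr]

theorem EW_bmW (hA : A.Laws) (w v : PairMod) : A.EW (bmW w (nd v)) = A.bar (A.EW w) (A.EW v) := by
  apply eq_of_pr w; intro c F
  rw [bmW_pr, EW_pr, hA.EF_bm, hA.parity_EW.2, wt_neg_one_neg_one, hA.parity_one, EW_pr]

end Laws

end TriOps

open PTree FTree

/-! ### The morphism from the free operad to `K'` -/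

namespace freeK

/-- The generators of `freeK`. -/
abbrev Gen : Type := PTree.cells 2

/-- The degrees of the generators. -/
def deg (g : Gen) : ℕ := g.1.dim

/-- The differential of the generators. -/
noncomputable def dGen (g : Gen) : Gen →₀ ℤ :=
  Finsupp.supportedEquivFinsupp (R := ℤ) (PTree.cells 2) (KPrime.d 2 (KPrime.cell g))

/-- The generator `1 < 2`. -/
def gLt : Gen := ⟨PTree.lt, lt_mem⟩
/-- The generator `1 > 2`. -/
def gGt : Gen := ⟨PTree.gt, gt_mem⟩
/-- The generator `1 | 2`. -/
def gBar : Gen := ⟨PTree.bar, bar_mem⟩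

theorem deg_gLt : deg gLt = 0 := dim_lt
theorem deg_gGt : deg gGt = 0 := dim_gt
theorem deg_gBar : deg gBar = 1 := dim_bar

theorem eq_gen (g : Gen) : g = gLt ∨ g = gGt ∨ g = gBar := by
  rcases eq_of_mem_cells_two g.2 with h | h | h
  · exact Or.inl (Subtype.ext h)
  · exact Or.inr (Or.inl (Subtype.ext h))
  · exact Or.inr (Or.inr (Subtype.ext h))

theorem dGen_eq {g : Gen} {γ : Gen →₀ ℤ}
    (h : cobd g.1 = ((Finsupp.supportedEquivFinsupp (R := ℤ) (PTree.cells 2)).symm γ).1) :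
    dGen g = γ := by
  refine (LinearEquiv.eq_symm_apply _).1 (Subtype.ext (Eq.trans ?_ h))
  exact dT_tr g.1

theorem dGen_gLt : dGen gLt = Finsupp.single gBar 1 :=
  dGen_eq (cobd_lt.trans (by rw [Finsupp.supportedEquivFinsupp_symm_single]; rfl))

theorem dGen_gGt : dGen gGt = -Finsupp.single gBar 1 :=
  dGen_eq (cobd_gt.trans (by
    rw [map_neg, Submodule.coe_neg, Finsupp.supportedEquivFinsupp_symm_single]; rfl))

theorem dGen_gBar : dGen gBar = 0 :=
  dGen_eq (cobd_bar.trans (by rw [map_zero]; rfl))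

theorem dGen_mem (g : Gen) :
    dGen g ∈ Finsupp.supported ℤ ℤ {g' | deg g' = deg g + 1} := by
  have h : Finsupp.single gBar (1 : ℤ) ∈ Finsupp.supported ℤ ℤ {g' : Gen | deg g' = 0 + 1} :=
    Finsupp.single_mem_supported ℤ _ deg_gBar
  rcases eq_gen g with rfl | rfl | rfl
  · rw [dGen_gLt, deg_gLt]; exact h
  · rw [dGen_gGt, deg_gGt]; exact Submodule.neg_mem _ h
  · rw [dGen_gBar]; exact Submodule.zero_mem _

theorem dGen_dGen (g : Gen) : Finsupp.linearCombination ℤ dGen (dGen g) = 0 := by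
  rcases eq_gen g with rfl | rfl | rfl
  · rw [dGen_gLt, Finsupp.linearCombination_single, dGen_gBar, smul_zero]
  · rw [dGen_gGt, map_neg, Finsupp.linearCombination_single, dGen_gBar, smul_zero, neg_zero]
  · rw [dGen_gBar, map_zero]

theorem isDGOperad : freeK.IsDGOperad := freeBinaryOperad_isDGOperad dGen_mem dGen_dGen

/-- The space spanned by all labelled binary trees. -/
abbrev FMod : Type := FTree Gen →₀ ℤ

/-- The value in `K'` of a labelled binary tree. -/
noncomputable def psi : FTree Gen → TreeMod
  | .leaf => tr unit
  | .node g l r => opT g.1 (psi l) (psi r)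

/-- Linear extension of `psi`. -/
noncomputable def psiL : FMod →ₗ[ℤ] TreeMod := Finsupp.linearCombination ℤ psi

theorem psiL_single (T : FTree Gen) : psiL (Finsupp.single T 1) = psi T := by simp [psiL]

theorem psi_mem : ∀ T : FTree Gen, psi T ∈ Finsupp.supported ℤ ℤ (cells T.arity)
  | .leaf => Finsupp.single_mem_supported ℤ _ unit_mem
  | .node g l r => opT_mem_cells g.2 (psi_mem l) (psi_mem r)

theorem psiL_nodeL (g : Gen) (x y : FMod) :
    psiL (nodeL g x y) = opT g.1 (psiL x) (psiL y) := by
  apply Finsupp.eq_of_single x; intro l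
  apply Finsupp.eq_of_single y; intro r
  rw [nodeL_single, psiL_single, psiL_single, psiL_single, psi]

theorem psiL_dGen (g : Gen) (x y : FMod) :
    psiL (nodeG (dGen g) x y) = opL (cobd g.1) (psiL x) (psiL y) := by
  rcases eq_gen g with rfl | rfl | rfl
  · rw [dGen_gLt, nodeG_single, psiL_nodeL, gLt, cobd_lt, opL_tr]; rfl
  · rw [dGen_gGt, map_neg, nodeG_single, gGt, cobd_gt, map_neg, opL_tr]
    simp only [LinearMap.neg_apply, map_neg, psiL_nodeL]; rfl
  · rw [dGen_gBar, gBar, cobd_bar]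
    simp only [map_zero, LinearMap.zero_apply]

theorem wt_psiL (q : ℤ) (x : FMod) : wt q (psiL x) = psiL (wtD deg q x) := by
  apply Finsupp.eq_of_single x; intro T
  induction T with
  | leaf =>
    rw [weight_single, degree, pow_zero, one_smul, psiL_single, psi, wt_tr, dim_unit, pow_zero,
      one_smul]
  | node g l r hl hr =>
    rw [← nodeL_single, psiL_nodeL, wt_opT q g.2, hl, hr, wtD_nodeL, map_smul, psiL_nodeL]; rfl

theorem nd_bodyL {n : ℕ} {x : TreeMod} (hx : x ∈ Finsupp.supported ℤ ℤ (cells n)) :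
    nd (bodyL x) = x := by
  apply eq_of_tr_of_mem x hx
  rintro T ⟨hT, -⟩
  rw [bodyL_tr, nd_body hT]

/-- Both differentials obey the same Leibniz rule at a vertex, agree on the generators and vanish on
the unit. -/
theorem dT_psiL (x : FMod) : dT (psiL x) = psiL (dL deg dGen x) := by
  apply Finsupp.eq_of_single x; intro T
  induction T with
  | leaf =>
    rw [dL_leaf, map_zero, psiL_single, psi, unit, tr_node, dT_nd, tr_leaf, fo_one, dW_pr, dF_on,
      tr_leaf, dT_lf, kL_lf, kW_lf]
    simp only [map_zero, LinearMap.zero_apply, add_zero]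
  | node g l r hl hr =>
    -- Values of `psi` involve only trees with a root, so they can be written in the form `nd _`
    -- required here.
    have h := dT_opT g.2 (bodyL (psi l)) (bodyL (psi r))
    rw [nd_bodyL (psi_mem l), nd_bodyL (psi_mem r), ← psiL_single, ← psiL_single, hl, hr,
      wt_psiL] at h
    simp only [← nodeL_single, psiL_nodeL, h, dL_nodeL, map_add, map_smul, psiL_dGen]
    rfl

theorem psi_mem_nodesOfDim (T : FTree Gen) :
    psi T ∈ Finsupp.supported ℤ ℤ (nodesOfDim (T.degree deg)) := by
  refine mem_nodesOfDim (psi_mem T) ?_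
  rw [← psiL_single, wt_psiL, weight_single, map_smul]

/-- Leaf `i` of `S` corresponds to sector `i` of its value, and both insertions descend through the
root vertex of `S` by the same rule and with the same sign. -/
theorem psi_graft (S T : FTree Gen) {i : ℕ} (hi : i < S.arity) :
    psiL (fB deg i (Finsupp.single S 1) (Finsupp.single T 1)) = cB i (psi S) (psi T) := by
  induction S generalizing i with
  | leaf =>
    rw [arity, Nat.lt_one_iff] at hi
    rw [fB_leaf, hi, psiL_single, psi, cB_unit (psi_mem_nodesOfDim T)]
  | node g l r hl hr =>
    rw [← nodeL_single, psi]
    rcases lt_or_ge i l.arity with h | h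
    · rw [fB_nodeL_left deg g _ (single_mem_withArity l) (single_mem_degree deg T) h, psiL_nodeL,
        hl h, ← wt_psiL, psiL_single,
        cB_opT_left g.2 (psi_mem l) (psi_mem r) (psi_mem_nodesOfDim T) h]
    · rw [fB_nodeL_right deg g _ _ (single_mem_withArity l) h, psiL_nodeL, psiL_single,
        hr (by simp only [arity] at hi; omega),
        cB_opT_right g.2 (psi_mem l) (psi_mem r) (psi_mem_nodesOfDim T) h hi]

/-- The morphism from `freeK` to `K'` that is the identity on the generators. -/
noncomputable def toKPrime : DGOperadData.Morphism freeK KPrime where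
  map n := restrictLin psi (s := withArity Gen n) (t := cells n) (fun T hT => by
    have := psi_mem T
    rwa [show T.arity = n from hT] at this)
  map_gr n p x hx := by
    refine mem_supported_of_weight PTree.dim ?_
    change wt 2 (psiL x.1) = (2 : ℤ) ^ p • psiL x.1
    have h : wtD deg 2 x.1 = (2 : ℤ) ^ p • x.1 := weight_of_mem (degree deg) 2 hx
    rw [wt_psiL, h, map_smul]
  map_d n x := Subtype.ext (dT_psiL x.1).symm
  map_one := Subtype.ext (psiL_single _)
  map_comp {n m k} i h x y := by
    refine Subtype.ext ?_
    change psiL (fB deg i x.1 y.1) = cB i (psiL x.1) (psiL y.1)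
    obtain ⟨x, hx⟩ := x
    generalize y.1 = y
    dsimp only
    apply Finsupp.eq_of_mem_supported x hx; rintro S rfl
    apply Finsupp.eq_of_single y; intro T
    rw [psiL_single, psiL_single, psi_graft S T i.2]

-- A section of the morphism

/-- The operations of the free operad. -/
noncomputable def opsF : TriOps FMod where
  lt := nodeL gLt
  gt := nodeL gGt
  bar := nodeL gBar
  parity := wtD deg (-1)
  one := Finsupp.single .leaf 1

/-- The operations of `K'`. -/
noncomputable def opsM : TriOps TreeMod where
  lt := ltT
  gt := gtT
  bar := barT
  parity := wt (-1)
  one := tr unit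

/-- The two children of the unit tree are leaves, hence neutral for the shuffles with `c` on the
left and with the first tree of `F` on the right: any row of children arises from the unit. -/
theorem attW_gtW_unit (c : TreeMod) (F : ForestMod) :
    attW (gtW c (pr lf (on lf))) F = pr c F := by
  have h : attW (pr lf (on lf)) F = pr lf F := by
    apply eq_of_on_cn F
    · intro x; rw [attW_on, ltW_pr, shl_on, sh_lf_left]
    · intro w; rw [attW_cn, wtW_pr, wtF_on, wt_lf, bmW_pr, wt_lf, bm_on, gtW_lf]
  rw [attW_gtW, h, gtW_pr, sh_lf_right]

/-- On K' itself the abstract actions are the products of trees, and adding siblings is `attW`.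
Evaluation starts from the unit, so it gives back the tree. -/
theorem opsM_act : ∀ x : PTree,
    (∀ w, opsM.LL (tr x) (nd w) = nd (gtW (tr x) w)) ∧
      (∀ w, opsM.RR (tr x) (nd w) = nd (ltW w (tr x))) ∧
        (x ≠ PTree.leaf → opsM.ev x = tr x) := by
  have key : ∀ c F, (∀ w, opsM.LL (tr c) (nd w) = nd (gtW (tr c) w)) →
      (∀ w, opsM.EF (fo F) (nd w) = nd (attW w (fo F))) →
      opsM.EW (pr (tr c) (fo F)) = nd (pr (tr c) (fo F)) := by
    intro c F hc hF
    have hu : opsM.one = nd (pr lf (on lf)) := by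
      change tr unit = _
      rw [unit, tr_node, fo_one, tr_leaf]
    rw [opsM.EW_pr, hu, hc, hF, attW_gtW_unit]
  intro x
  induction x using PTree.rec
    (motive_2 := fun F => ∀ w, opsM.EF (fo F) (nd w) = nd (attW w (fo F))) with
  | leaf =>
    simp only [tr_leaf, opsM.LL_lf, opsM.RR_lf, gtW_lf, ltW_lf, ne_eq, not_true_eq_false,
      implies_true, and_self, false_implies]
  | node c F hc hF =>
    have h := key c F hc.1 hF
    refine ⟨fun w => ?_, fun w => ?_, fun _ => ?_⟩
    · rw [tr_node, opsM.LL_nd, h]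
      exact (gtT_apply _ _).trans (by rw [bodyL_nd])
    · rw [tr_node, opsM.RR_nd, h]
      exact (ltT_apply _ _).trans (by rw [bodyL_nd])
    · rw [← opsM.ET_tr, tr_node, opsM.ET_nd, h]
  | one c hc =>
    rename_i w
    rw [fo_one, opsM.EF_on, hc.2.1, attW_on]
  | cons c F hc hF =>
    rename_i w
    rw [fo_cons, opsM.EF_cn, key c F hc.1 hF, attW_cn, ← bodyL_nd (wtW (-1) w), ← wt_nd]
    rfl

/-- Evaluation is natural, and `psiL` carries the operations of the free operad to those of K',
where evaluation is the identity. -/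
theorem psiL_ev {T : PTree} (hT : T ≠ PTree.leaf) : psiL (opsF.ev T) = tr T := by
  rw [← (opsM_act T).2.2 hT]
  refine opsF.map_ev opsM psiL ?_ ?_ ?_ ?_ ?_ T
  · intro x y; exact (psiL_nodeL _ _ _).trans (by rw [gLt, opT_lt]; rfl)
  · intro x y; exact (psiL_nodeL _ _ _).trans (by rw [gGt, opT_gt]; rfl)
  · intro x y; exact (psiL_nodeL _ _ _).trans (by rw [gBar, opT_bar]; rfl)
  · intro x; exact (wt_psiL _ _).symm
  · exact psiL_single _

theorem nodeL_mem (g : Gen) {a b : ℕ} {x y : FMod}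
    (hx : x ∈ Finsupp.supported ℤ ℤ (withArity Gen a))
    (hy : y ∈ Finsupp.supported ℤ ℤ (withArity Gen b)) :
    nodeL g x y ∈ Finsupp.supported ℤ ℤ (withArity Gen (a + b)) := by
  refine bilinExt_mem_supported ?_ hx hy
  rintro l rfl r rfl
  exact Finsupp.single_mem_supported ℤ _ rfl

theorem wtD_mem (q : ℤ) {a : ℕ} {x : FMod}
    (hx : x ∈ Finsupp.supported ℤ ℤ (withArity Gen a)) :
    wtD deg q x ∈ Finsupp.supported ℤ ℤ (withArity Gen a) :=
  linearCombination_mem_supported (fun _ hT => Finsupp.single_mem_supported ℤ _ hT) hx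

theorem ev_mem {T : PTree} (hT : T ≠ PTree.leaf) :
    opsF.ev T ∈ Finsupp.supported ℤ ℤ (withArity Gen T.sectors) := by
  have h1 : opsF.one ∈ Finsupp.supported ℤ ℤ (withArity Gen 1) :=
    Finsupp.single_mem_supported ℤ _ rfl
  suffices h : ∀ x : PTree,
      (∀ a X, X ∈ Finsupp.supported ℤ ℤ (withArity Gen a) →
        opsF.actL x X ∈ Finsupp.supported ℤ ℤ (withArity Gen (x.sectors + a))) ∧
      (∀ a X, X ∈ Finsupp.supported ℤ ℤ (withArity Gen a) →
        opsF.actR x X ∈ Finsupp.supported ℤ ℤ (withArity Gen (a + x.sectors))) ∧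
      (x ≠ PTree.leaf → opsF.ev x ∈ Finsupp.supported ℤ ℤ (withArity Gen x.sectors)) from
    (h T).2.2 hT
  -- The last of the `a + 1` leaves of `X` is the sector on the left of the first tree of `F`, which
  -- `F.sectors` counts already; hence the result has arity `a + F.sectors`.
  have key : ∀ c F, (∀ a X, X ∈ Finsupp.supported ℤ ℤ (withArity Gen a) →
        opsF.actL c X ∈ Finsupp.supported ℤ ℤ (withArity Gen (c.sectors + a))) →
      (∀ a X, X ∈ Finsupp.supported ℤ ℤ (withArity Gen (a + 1)) →
        opsF.evF F X ∈ Finsupp.supported ℤ ℤ (withArity Gen (a + F.sectors))) →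
      opsF.evF F (opsF.actL c opsF.one) ∈
        Finsupp.supported ℤ ℤ (withArity Gen (c.sectors + F.sectors)) :=
    fun c F hc hF => hF _ _ (hc _ _ h1)
  intro x
  induction x using PTree.rec
    (motive_2 := fun F => ∀ a X, X ∈ Finsupp.supported ℤ ℤ (withArity Gen (a + 1)) →
        opsF.evF F X ∈ Finsupp.supported ℤ ℤ (withArity Gen (a + F.sectors))) with
  | leaf =>
    simp only [TriOps.actL, TriOps.actR, PTree.sectors, zero_add, add_zero, LinearMap.id_apply,
      imp_self, implies_true, ne_eq, not_true_eq_false, false_implies, and_self]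
  | node c F hc hF =>
    have h := key c F hc.1 hF
    refine ⟨fun a X hX => ?_, fun a X hX => ?_, fun _ => ?_⟩
    · rw [TriOps.actL, PTree.sectors]; exact nodeL_mem _ h hX
    · rw [TriOps.actR, PTree.sectors]; exact nodeL_mem _ hX h
    · rw [TriOps.ev, PTree.sectors]; exact h
  | one c hc =>
    rename_i a X hX
    rw [TriOps.evF, PForest.sectors, ← add_assoc]
    exact hc.2.1 _ _ hX
  | cons c F hc hF =>
    rename_i a X hX
    have h := key c F hc.1 hF
    rw [TriOps.evF, PForest.sectors, add_assoc 1, ← add_assoc]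
    change nodeL gBar (wtD deg (-1) X) (opsF.evF F (opsF.actL c opsF.one)) ∈ _
    exact nodeL_mem _ (wtD_mem _ hX) h

theorem wtD_ET (q : ℤ) (x : TreeMod) : wtD deg q (opsF.ET x) = opsF.ET (wt q x) := by
  apply eq_of_lf_nd x
  · rw [wt_lf, ← tr_leaf, opsF.ET_tr, TriOps.ev, map_zero]
  intro w
  rw [wt_nd, opsF.ET_nd, opsF.ET_nd]
  refine (opsF.EW_wtW (wtD deg q) ?_ ?_ ?_ ?_ ?_).1 w
  · intro x y
    exact (wtD_nodeL deg q gLt x y).trans (by rw [deg_gLt, pow_zero, one_smul]; rfl)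
  · intro x y
    exact (wtD_nodeL deg q gGt x y).trans (by rw [deg_gGt, pow_zero, one_smul]; rfl)
  · intro x y
    exact (wtD_nodeL deg q gBar x y).trans (by rw [deg_gBar, pow_one]; rfl)
  · intro x
    exact (weight_weight _ _ _ _).trans (by rw [mul_comm, ← weight_weight]; rfl)
  · exact (weight_single _ _ _).trans (by rw [degree, pow_zero, one_smul]; rfl)

/-- A section of `toKPrime`. -/
noncomputable def treeSection (n : ℕ) : KPrime.obj n →ₗ[ℤ] freeK.obj n :=
  restrictLin opsF.ev (s := cells n) (t := withArity Gen n) (fun T hT => by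
    have := ev_mem hT.1
    rwa [show T.sectors = n from hT.2] at this)

theorem toKPrime_section (n : ℕ) (y : KPrime.obj n) : toKPrime.map n (treeSection n y) = y := by
  refine Subtype.ext ?_
  change psiL (opsF.ET y.1) = y.1
  obtain ⟨y, hy⟩ := y
  dsimp only
  apply eq_of_tr_of_mem y hy
  intro T hT
  rw [opsF.ET_tr, psiL_ev hT.1]

theorem toKPrime_surjective (n : ℕ) : Function.Surjective (toKPrime.map n) :=
  fun y => ⟨_, toKPrime_section n y⟩

/-- The section commutes with the weight operators, hence preserves degrees. Homogeneous lifts are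
needed to transfer the axioms that involve signs. -/
theorem toKPrime_lift (n p : ℕ) (y : KPrime.obj n) (hy : y ∈ KPrime.gr n p) :
    ∃ x ∈ freeK.gr n p, toKPrime.map n x = y := by
  refine ⟨_, ?_, toKPrime_section n y⟩
  refine mem_supported_of_weight (degree deg) ?_
  change wtD deg 2 (opsF.ET y.1) = (2 : ℤ) ^ p • opsF.ET y.1
  have h : wt 2 y.1 = (2 : ℤ) ^ p • y.1 :=
    weight_of_mem PTree.dim 2 hy
  rw [wtD_ET, h, map_smul]

end freeK

/-- Apart from the direct sum decomposition, no axiom is checked on the trees of K', not even d² =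
0: all are inherited from the free operad along the surjection. -/
theorem KPrime_isDGOperad : KPrime.IsDGOperad :=
  freeK.toKPrime.isDGOperad freeK.isDGOperad
    (fun n => isInternal_comap_supported (cells n) PTree.dim)
    freeK.toKPrime_surjective freeK.toKPrime_lift

namespace freeK

/-! ### The ideal of relations -/

/-- The inclusion of the component of arity `n` in the space spanned by all trees. -/
noncomputable def incl (n : ℕ) : freeK.obj n →ₗ[ℤ] FMod :=
  (Finsupp.supported ℤ ℤ (withArity Gen n)).subtype

theorem incl_comp {n m k : ℕ} (i : Fin n) (h : n + m = k + 1) (x : freeK.obj n)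
    (y : freeK.obj m) : incl k (freeK.comp i h x y) = fB deg i (incl n x) (incl m y) := rfl

theorem incl_d {n : ℕ} (x : freeK.obj n) : incl n (freeK.d n x) = dL deg dGen (incl n x) := rfl

theorem incl_mem {n : ℕ} (x : freeK.obj n) :
    incl n x ∈ Finsupp.supported ℤ ℤ (withArity Gen n) := x.2

theorem incl_injective (n : ℕ) : Function.Injective (incl n) := Subtype.val_injective

/-- The basis element of a tree. -/
noncomputable def basis (T : FTree Gen) : freeK.obj T.arity :=
  ⟨Finsupp.single T 1, single_mem_withArity T⟩

theorem incl_basis (T : FTree Gen) : incl T.arity (basis T) = Finsupp.single T 1 := rfl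

theorem incl_gen (g : Gen) : incl 2 (gen g) = Finsupp.single (.node g .leaf .leaf) 1 := rfl

section total
variable (J : freeK.OpIdeal)

/-- The direct sum of the components of an ideal. -/
noncomputable def total : Submodule ℤ FMod := ⨆ n, (J.carrier n).map (incl n)

variable {J}

theorem incl_mem_total {n : ℕ} {x : freeK.obj n} (hx : x ∈ J.carrier n) : incl n x ∈ total J :=
  Submodule.mem_iSup_of_mem n ⟨x, hx, rfl⟩

/-- The sum of the components of an ideal is homogeneous for the arity, so the projection `p` to
arity `n` maps it back into the component of arity `n`. -/
theorem mem_of_incl_mem_total {n : ℕ} {x : freeK.obj n} (hx : incl n x ∈ total J) :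
    x ∈ J.carrier n := by
  classical
  let p : FMod →ₗ[ℤ] freeK.obj n := Finsupp.restrictDom ℤ ℤ (withArity Gen n)
  have hp : ∀ y : freeK.obj n, p (incl n y) = y := fun y => by
    refine Subtype.ext ?_
    change Finsupp.filter _ (incl n y) = incl n y
    rw [Finsupp.filter_eq_self_iff]
    intro T hT
    exact incl_mem y (Finsupp.mem_support_iff.2 hT)
  have h : total J ≤ (J.carrier n).comap p := by
    refine iSup_le fun m => ?_
    rintro _ ⟨y, hy, rfl⟩
    by_cases hm : m = n
    · subst hm
      change p (incl m y) ∈ J.carrier m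
      rw [hp]; exact hy
    · have : p (incl m y) = 0 := by
        refine Subtype.ext ?_
        change Finsupp.filter _ (incl m y) = 0
        rw [Finsupp.filter_eq_zero_iff]
        intro T hT
        by_contra hne
        have := incl_mem y (Finsupp.mem_support_iff.2 hne)
        exact hm ((show T.arity = m from this).symm.trans hT)
      change p (incl m y) ∈ J.carrier n
      rw [this]; exact Submodule.zero_mem _
  have : p (incl n x) ∈ J.carrier n := h hx
  rwa [hp] at this

theorem fB_gen_zero (g : Gen) (x : FMod) :
    fB deg 0 (Finsupp.single (.node g .leaf .leaf) 1) x =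
      nodeL g x (Finsupp.single .leaf 1) := by
  apply Finsupp.eq_of_single x; intro T
  rw [fB_single, nodeL_single]
  simp [degreeAfter, graft, arity, degree]

theorem nodeL_mem_total_left (g : Gen) {x : FMod} (hx : x ∈ total J) (y : FMod) :
    nodeL g x y ∈ total J := by
  suffices h : ∀ r : FTree Gen, nodeL g x (Finsupp.single r 1) ∈ total J by
    rw [← Submodule.Quotient.mk_eq_zero, ← Submodule.mkQ_apply]
    apply Finsupp.eq_of_single y
    intro r
    rw [Submodule.mkQ_apply, Submodule.Quotient.mk_eq_zero]; exact h r
  intro r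
  have h : total J ≤ (total J).comap ((nodeL g).flip (Finsupp.single r 1)) := by
    refine iSup_le fun m => ?_
    rintro _ ⟨x, hx, rfl⟩
    -- A vertex is made of two compositions with the generator: `x` on its first leaf, then `r` on
    -- the remaining leaf, which now has number `m`. No label comes after that leaf, so there is no
    -- sign.
    have h₁ := J.comp_mem_right (0 : Fin 2) (show 2 + m = (m + 1) + 1 by omega) (gen g) x hx
    have h₂ := incl_mem_total (J.comp_mem_left (⟨m, by omega⟩ : Fin (m + 1))
      (show m + 1 + r.arity = (m + r.arity) + 1 by omega) _ (basis r) h₁)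
    rw [incl_comp, incl_comp, incl_gen, incl_basis] at h₂
    change fB deg m (fB deg 0 _ _) _ ∈ _ at h₂
    rw [fB_gen_zero, fB_nodeL_right deg g _ _ (incl_mem x) le_rfl, fB_leaf] at h₂
    exact h₂
  exact h hx

theorem nodeL_mem_total_right (g : Gen) (x : FMod) {y : FMod} (hy : y ∈ total J) :
    nodeL g x y ∈ total J := by
  suffices h : ∀ l : FTree Gen, nodeL g (Finsupp.single l 1) y ∈ total J by
    rw [← Submodule.Quotient.mk_eq_zero, ← Submodule.mkQ_apply]
    apply Finsupp.eq_of_single x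
    intro l
    rw [Submodule.mkQ_apply, Submodule.Quotient.mk_eq_zero]; exact h l
  intro l
  have h : total J ≤ (total J).comap (nodeL g (Finsupp.single l 1)) := by
    refine iSup_le fun m => ?_
    rintro _ ⟨y, hy, rfl⟩
    have h₂ := incl_mem_total (J.comp_mem_right (⟨l.arity, by omega⟩ : Fin (l.arity + 1))
      (show l.arity + 1 + m = (l.arity + m) + 1 by omega)
      (freeK.comp (0 : Fin 2) (show 2 + l.arity = (l.arity + 1) + 1 by omega) (gen g) (basis l))
      y hy)
    rw [incl_comp, incl_comp, incl_gen, incl_basis] at h₂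
    change fB deg l.arity (fB deg 0 _ _) _ ∈ _ at h₂
    rw [fB_gen_zero, fB_nodeL_right deg g _ _ (single_mem_withArity l) le_rfl, Nat.sub_self,
      fB_leaf] at h₂
    exact h₂
  exact h hy

/-- An element of arity three of an ideal may be composed with three trees. -/
theorem fB_fB_fB_mem_total {r : freeK.obj 3} (hr : r ∈ J.carrier 3) (a b c : FTree Gen) :
    fB deg (a.arity + b.arity) (fB deg a.arity (fB deg 0 (incl 3 r) (Finsupp.single a 1))
      (Finsupp.single b 1)) (Finsupp.single c 1) ∈ total J := by
  have ha := a.arity_pos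
  have hb := b.arity_pos
  have hc := c.arity_pos
  have h₁ := J.comp_mem_left (0 : Fin 3) (show 3 + a.arity = (a.arity + 2) + 1 by omega) r
    (basis a) hr
  have h₂ := J.comp_mem_left (⟨a.arity, by omega⟩ : Fin (a.arity + 2))
    (show a.arity + 2 + b.arity = (a.arity + b.arity + 1) + 1 by omega) _ (basis b) h₁
  exact incl_mem_total (J.comp_mem_left
    (⟨a.arity + b.arity, by omega⟩ : Fin (a.arity + b.arity + 1))
    (show a.arity + b.arity + 1 + c.arity = (a.arity + b.arity + c.arity) + 1 by omega) _
    (basis c) h₂)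

end total

/-! ### Composites of two generators -/

theorem incl_o₁ (g h : Gen) : incl 3 (o₁ (gen g) (gen h)) =
    Finsupp.single (.node g (.node h .leaf .leaf) .leaf) 1 := by
  refine (fB_single deg 0 _ _).trans ?_
  simp [degreeAfter, graft, arity, degree]

theorem incl_o₂ (g h : Gen) : incl 3 (o₂ (gen g) (gen h)) =
    Finsupp.single (.node g .leaf (.node h .leaf .leaf)) 1 := by
  refine (fB_single deg 1 _ _).trans ?_
  simp [degreeAfter, graft, arity]

theorem wtD_one (q : ℤ) :
    wtD deg q (Finsupp.single (.leaf : FTree Gen) 1) = Finsupp.single .leaf 1 := by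
  rw [weight_single, degree, pow_zero, one_smul]

theorem fB_o₁ (g h : Gen) (a b c : FTree Gen) :
    fB deg (a.arity + b.arity) (fB deg a.arity (fB deg 0 (incl 3 (o₁ (gen g) (gen h)))
      (Finsupp.single a 1)) (Finsupp.single b 1)) (Finsupp.single c 1) =
      nodeL g (nodeL h (Finsupp.single a 1) (Finsupp.single b 1)) (Finsupp.single c 1) := by
  have ha := a.arity_pos
  have h1 := single_mem_withArity (.leaf : FTree Gen)
  have hA := single_mem_withArity a
  have hB := single_mem_withArity b
  rw [incl_o₁, ← nodeL_single, ← nodeL_single,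
    fB_nodeL_left deg g _ (nodeL_mem h h1 h1) (single_mem_degree deg a) (by simp [arity]),
    fB_nodeL_left deg h _ h1 (single_mem_degree deg a) (by simp [arity]), fB_leaf, wtD_one,
    fB_nodeL_left deg g _ (nodeL_mem h hA h1) (single_mem_degree deg b) (by simp [arity]),
    fB_nodeL_right deg h _ _ hA le_rfl, fB_leaf, wtD_one,
    fB_nodeL_right deg g _ _ (nodeL_mem h hA hB) le_rfl, fB_leaf]

/-- The tree `a` is grafted on the first leaf and has to pass the label `h`, which lies in the right
subtree; this is the weight on `a`. -/
theorem fB_o₂ (g h : Gen) (a b c : FTree Gen) :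
    fB deg (a.arity + b.arity) (fB deg a.arity (fB deg 0 (incl 3 (o₂ (gen g) (gen h)))
      (Finsupp.single a 1)) (Finsupp.single b 1)) (Finsupp.single c 1) =
      nodeL g (wtD deg ((-1) ^ deg h) (Finsupp.single a 1))
        (nodeL h (Finsupp.single b 1) (Finsupp.single c 1)) := by
  have hb := b.arity_pos
  have h1 := single_mem_withArity (.leaf : FTree Gen)
  have hA := single_mem_withArity a
  have hB := single_mem_withArity b
  rw [incl_o₂, ← nodeL_single, ← nodeL_single,
    fB_nodeL_left deg g _ h1 (single_mem_degree deg a) (by simp [arity]), fB_leaf, wtD_nodeL,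
    wtD_one, map_smul, map_smul, LinearMap.smul_apply, map_smul, LinearMap.smul_apply,
    fB_nodeL_right deg g _ _ hA le_rfl, Nat.sub_self,
    fB_nodeL_left deg h _ h1 (single_mem_degree deg b) (by simp [arity]), fB_leaf, wtD_one,
    fB_nodeL_right deg g _ _ hA (by omega), Nat.add_sub_cancel_left,
    fB_nodeL_right deg h _ _ hB le_rfl, fB_leaf, weight_single, map_smul, LinearMap.smul_apply,
    ← pow_mul, ← pow_mul, mul_comm]

end freeK

/-! ### Stability of the ideal of relations under the differential -/

namespace DGOperadData

/-- The linear endomorphisms of the component of arity `n`. -/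
abbrev Endo {R : Type} [CommRing R] (P : DGOperadData R) (n : ℕ) : Type :=
  P.obj n →ₗ[R] P.obj n

/-- An ideal is stable under the differential and a parity operator as soon as its generators are sent
into it. -/
theorem idealSpan_stable {R : Type} [CommRing R] (P : DGOperadData R) {a : ℕ}
    (S : Set (P.obj a)) (σ : ∀ n, P.Endo n)
    (hσ : ∀ {n m k : ℕ} (i : Fin n) (h : n + m = k + 1) (x : P.obj n) (y : P.obj m),
      σ k (P.comp i h x y) = P.comp i h (σ n x) (σ m y))
    (hd : ∀ {n m k : ℕ} (i : Fin n) (h : n + m = k + 1) (x : P.obj n) (y : P.obj m),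
      P.d k (P.comp i h x y) = P.comp i h (P.d n x) y + P.comp i h (σ n x) (P.d m y))
    (hS : ∀ r ∈ S, σ a r ∈ (P.idealSpan S).carrier a ∧ P.d a r ∈ (P.idealSpan S).carrier a) :
    (∀ n x, x ∈ (P.idealSpan S).carrier n → σ n x ∈ (P.idealSpan S).carrier n) ∧
      (P.idealSpan S).IsDStable := by
  let I := P.idealSpan S
  -- The elements of `I` that `σ` and the differential send into `I` form an ideal. The operator `σ`
  -- must be carried along because `σ x` appears in the Leibniz rule.
  let J : P.OpIdeal :=
    { carrier := fun n =>
        I.carrier n ⊓ (I.carrier n).comap (σ n) ⊓ (I.carrier n).comap (P.d n)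
      comp_mem_left := fun {n m k} i h x y hx => by
        obtain ⟨⟨h₀, h₁⟩, h₂⟩ := hx
        refine ⟨⟨I.comp_mem_left i h x y h₀, ?_⟩, ?_⟩
        · change σ k (P.comp i h x y) ∈ I.carrier k
          rw [hσ]
          exact I.comp_mem_left i h _ _ h₁
        · change P.d k (P.comp i h x y) ∈ I.carrier k
          rw [hd]
          exact add_mem (I.comp_mem_left i h _ _ h₂) (I.comp_mem_left i h _ _ h₁)
      comp_mem_right := fun {n m k} i h x y hy => by
        obtain ⟨⟨h₀, h₁⟩, h₂⟩ := hy
        refine ⟨⟨I.comp_mem_right i h x y h₀, ?_⟩, ?_⟩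
        · change σ k (P.comp i h x y) ∈ I.carrier k
          rw [hσ]
          exact I.comp_mem_right i h _ _ h₁
        · change P.d k (P.comp i h x y) ∈ I.carrier k
          rw [hd]
          exact add_mem (I.comp_mem_right i h _ _ h₀) (I.comp_mem_right i h _ _ h₂) }
  have hJ : ∀ n, I.carrier n ≤ J.carrier n := P.idealSpan_le J fun r hr =>
    ⟨⟨P.subset_idealSpan S hr, (hS r hr).1⟩, (hS r hr).2⟩
  exact ⟨fun n x hx => (hJ n hx).1.2, fun n x hx => (hJ n hx).2⟩

end DGOperadData

namespace freeK

/-- The parity operator of `freeK`. -/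
noncomputable def parity (n : ℕ) : freeK.Endo n :=
  restrictLin (s := withArity Gen n) (t := withArity Gen n)
    (fun T => Finsupp.single T ((-1 : ℤ) ^ T.degree deg))
    (fun _ hT => Finsupp.single_mem_supported ℤ _ hT)

theorem incl_parity {n : ℕ} (x : freeK.obj n) : incl n (parity n x) = wtD deg (-1) (incl n x) := rfl

theorem parity_gen (g : Gen) : parity 2 (gen g) = (-1 : ℤ) ^ deg g • gen g := by
  apply incl_injective
  rw [incl_parity, incl_gen, weight_single, degree, degree, add_zero, add_zero, map_smul, incl_gen]

theorem parity_comp {n m k : ℕ} (i : Fin n) (h : n + m = k + 1) (x : freeK.obj n)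
    (y : freeK.obj m) :
    parity k (freeK.comp i h x y) = freeK.comp i h (parity n x) (parity m y) := by
  apply incl_injective
  rw [incl_parity, incl_comp, incl_comp, wtD_fB, incl_parity, incl_parity]

theorem d_comp_parity {n m k : ℕ} (i : Fin n) (h : n + m = k + 1) (x : freeK.obj n)
    (y : freeK.obj m) : freeK.d k (freeK.comp i h x y) =
      freeK.comp i h (freeK.d n x) y + freeK.comp i h (parity n x) (freeK.d m y) := by
  apply incl_injective
  rw [map_add, incl_d, incl_comp, incl_comp, incl_comp, dL_fB_of_mem dGen_mem i.2 (incl_mem x),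
    incl_parity, incl_d, incl_d]

theorem incl_d_gen (g : Gen) : incl 2 (freeK.d 2 (gen g)) =
    nodeG (dGen g) (Finsupp.single .leaf 1) (Finsupp.single .leaf 1) := by
  rw [incl_d, incl_gen, ← nodeL_single, dL_nodeL, dL_leaf]
  simp only [map_zero, LinearMap.zero_apply, smul_zero, add_zero]

theorem d_lt : freeK.d 2 lt = bar := by
  apply incl_injective
  refine (incl_d_gen gLt).trans ?_
  rw [dGen_gLt, nodeG_single, nodeL_single]; rfl

theorem d_gt : freeK.d 2 gt = -bar := by
  apply incl_injective
  refine (incl_d_gen gGt).trans ?_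
  rw [dGen_gGt, map_neg, nodeG_single, LinearMap.neg_apply, LinearMap.neg_apply, nodeL_single,
    map_neg]; rfl

theorem d_bar : freeK.d 2 bar = 0 := by
  apply incl_injective
  refine (incl_d_gen gBar).trans ?_
  rw [dGen_gBar, map_zero, LinearMap.zero_apply, LinearMap.zero_apply, map_zero]

theorem parity_lt : parity 2 lt = lt :=
  (parity_gen gLt).trans (by rw [deg_gLt, pow_zero, one_smul]; rfl)

theorem parity_gt : parity 2 gt = gt :=
  (parity_gen gGt).trans (by rw [deg_gGt, pow_zero, one_smul]; rfl)

theorem parity_bar : parity 2 bar = -bar :=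
  (parity_gen gBar).trans (by rw [deg_gBar, pow_one, neg_one_smul]; rfl)

theorem parity_o₁ (x y : freeK.obj 2) : parity 3 (o₁ x y) = o₁ (parity 2 x) (parity 2 y) :=
  parity_comp _ _ _ _

theorem parity_o₂ (x y : freeK.obj 2) : parity 3 (o₂ x y) = o₂ (parity 2 x) (parity 2 y) :=
  parity_comp _ _ _ _

theorem d_o₁ (x y : freeK.obj 2) : freeK.d 3 (o₁ x y) =
    o₁ (freeK.d 2 x) y + o₁ (parity 2 x) (freeK.d 2 y) := d_comp_parity _ _ _ _

theorem d_o₂ (x y : freeK.obj 2) : freeK.d 3 (o₂ x y) =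
    o₂ (freeK.d 2 x) y + o₂ (parity 2 x) (freeK.d 2 y) := d_comp_parity _ _ _ _

theorem o₁_neg_left (x y : freeK.obj 2) : o₁ (-x) y = -o₁ x y := by
  rw [o₁, map_neg, LinearMap.neg_apply, o₁]
theorem o₁_neg_right (x y : freeK.obj 2) : o₁ x (-y) = -o₁ x y := by rw [o₁, map_neg, o₁]
theorem o₁_zero_left (y : freeK.obj 2) : o₁ 0 y = 0 := by
  rw [o₁, map_zero, LinearMap.zero_apply]
theorem o₁_zero_right (x : freeK.obj 2) : o₁ x 0 = 0 := by rw [o₁, map_zero]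
theorem o₂_neg_left (x y : freeK.obj 2) : o₂ (-x) y = -o₂ x y := by
  rw [o₂, map_neg, LinearMap.neg_apply, o₂]
theorem o₂_neg_right (x y : freeK.obj 2) : o₂ x (-y) = -o₂ x y := by rw [o₂, map_neg, o₂]
theorem o₂_zero_left (y : freeK.obj 2) : o₂ 0 y = 0 := by
  rw [o₂, map_zero, LinearMap.zero_apply]
theorem o₂_zero_right (x : freeK.obj 2) : o₂ x 0 = 0 := by rw [o₂, map_zero]

theorem forall_relations {p : freeK.obj 3 → Prop} (h₁ : p (o₂ gt lt - o₁ lt gt))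
    (h₂ : p (o₂ gt gt - (o₁ gt gt + o₁ gt lt))) (h₃ : p (o₁ lt lt - (o₂ lt lt + o₂ lt gt)))
    (h₄ : p (o₂ gt bar - o₁ bar gt)) (h₅ : p (o₁ lt bar - o₂ bar lt))
    (h₆ : p (o₁ bar lt - o₂ bar gt)) (h₇ : p (o₁ bar bar - (-o₂ bar bar))) :
    ∀ r ∈ relations, p r := by
  rintro r (rfl | rfl | rfl | rfl | rfl | rfl | rfl) <;> assumption

/-- The ideal of relations. -/
noncomputable abbrev relIdeal : freeK.OpIdeal := freeK.idealSpan relations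

theorem rel_mem {r : freeK.obj 3} (hr : r ∈ relations) : r ∈ relIdeal.carrier 3 :=
  freeK.subset_idealSpan relations hr

/-- With the relations numbered in the order of the list, the differential sends r₁ to r₄ + r₅, r₂
to r₆ - r₄, r₃ to r₅ + r₆, r₄ and r₆ to -r₇, r₅ to r₇ and r₇ to 0. Each relation is homogeneous, so
parity changes it at most by a sign. -/
theorem relIdeal_stable :
    (∀ n x, x ∈ relIdeal.carrier n → parity n x ∈ relIdeal.carrier n) ∧ relIdeal.IsDStable := by
  refine freeK.idealSpan_stable relations parity parity_comp d_comp_parity ?_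
  have r₁ : o₂ gt lt - o₁ lt gt ∈ relIdeal.carrier 3 := rel_mem (by simp [relations])
  have r₂ : o₂ gt gt - (o₁ gt gt + o₁ gt lt) ∈ relIdeal.carrier 3 :=
    rel_mem (by simp [relations])
  have r₃ : o₁ lt lt - (o₂ lt lt + o₂ lt gt) ∈ relIdeal.carrier 3 :=
    rel_mem (by simp [relations])
  have r₄ : o₂ gt bar - o₁ bar gt ∈ relIdeal.carrier 3 := rel_mem (by simp [relations])
  have r₅ : o₁ lt bar - o₂ bar lt ∈ relIdeal.carrier 3 := rel_mem (by simp [relations])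
  have r₆ : o₁ bar lt - o₂ bar gt ∈ relIdeal.carrier 3 := rel_mem (by simp [relations])
  have r₇ : o₁ bar bar - (-o₂ bar bar) ∈ relIdeal.carrier 3 := rel_mem (by simp [relations])
  apply forall_relations <;>
    simp only [map_sub, map_add, map_neg, parity_o₁, parity_o₂, d_o₁, d_o₂, parity_lt, parity_gt,
      parity_bar, d_lt, d_gt, d_bar, o₁_neg_left, o₁_neg_right, o₁_zero_left, o₁_zero_right,
      o₂_neg_left, o₂_neg_right, o₂_zero_left, o₂_zero_right]
  · refine ⟨r₁, ?_⟩
    convert add_mem r₄ r₅ using 1; abel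
  · refine ⟨r₂, ?_⟩
    convert sub_mem r₆ r₄ using 1; abel
  · refine ⟨r₃, ?_⟩
    convert add_mem r₅ r₆ using 1; abel
  · constructor
    · convert neg_mem r₄ using 1; abel
    · convert neg_mem r₇ using 1; abel
  · constructor
    · convert neg_mem r₅ using 1; abel
    · convert r₇ using 1; abel
  · constructor
    · convert neg_mem r₆ using 1; abel
    · convert neg_mem r₇ using 1; abel
  · constructor
    · convert r₇ using 1; abel
    · convert zero_mem (relIdeal.carrier 3) using 1; abel

end freeK

/-! ### The isomorphism between the quotient and `K'` -/

/-- The bilinear map induced on a quotient. -/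
def quotientBilin {M : Type} [AddCommGroup M] (N : Submodule ℤ M) (f : M →ₗ[ℤ] M →ₗ[ℤ] M)
    (hl : ∀ x ∈ N, ∀ y, f x y ∈ N) (hr : ∀ x, ∀ y ∈ N, f x y ∈ N) :
    (M ⧸ N) →ₗ[ℤ] (M ⧸ N) →ₗ[ℤ] (M ⧸ N) :=
  N.liftQ
    { toFun := fun x => N.mapQ N (f x) (fun y hy => hr x y hy)
      map_add' := fun x x' => LinearMap.ext fun y => by
        obtain ⟨y, rfl⟩ := Submodule.mkQ_surjective _ y; simp
      map_smul' := fun c x => LinearMap.ext fun y => by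
        obtain ⟨y, rfl⟩ := Submodule.mkQ_surjective _ y; simp }
    (fun x hx => by
      rw [LinearMap.mem_ker]
      refine LinearMap.ext fun y => ?_
      obtain ⟨y, rfl⟩ := Submodule.mkQ_surjective _ y
      simpa using hl x hx y)

namespace freeK

theorem wtD_mem_total {x : FMod} (hx : x ∈ total relIdeal) :
    wtD deg (-1) x ∈ total relIdeal := by
  have h : total relIdeal ≤ (total relIdeal).comap (wtD deg (-1)) := by
    refine iSup_le fun n => ?_
    rintro _ ⟨x, hx, rfl⟩
    exact incl_mem_total (relIdeal_stable.1 n x hx)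
  exact h hx

/-- The space of trees modulo the relations. -/
abbrev QMod : Type := FMod ⧸ total relIdeal

/-- The operations of the quotient. -/
noncomputable def opsQ : TriOps QMod where
  lt := quotientBilin _ (nodeL gLt) (fun _ hx y => nodeL_mem_total_left _ hx y)
    (fun x _ hy => nodeL_mem_total_right _ x hy)
  gt := quotientBilin _ (nodeL gGt) (fun _ hx y => nodeL_mem_total_left _ hx y)
    (fun x _ hy => nodeL_mem_total_right _ x hy)
  bar := quotientBilin _ (nodeL gBar) (fun _ hx y => nodeL_mem_total_left _ hx y)
    (fun x _ hy => nodeL_mem_total_right _ x hy)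
  parity := (total relIdeal).mapQ (total relIdeal) (wtD deg (-1)) (fun _ hx => wtD_mem_total hx)
  one := (total relIdeal).mkQ (Finsupp.single .leaf 1)

/-- The projection to the quotient. -/
noncomputable def proj : FMod →ₗ[ℤ] QMod := (total relIdeal).mkQ

theorem proj_surjective : Function.Surjective proj := Submodule.mkQ_surjective _

theorem proj_eq_zero {x : FMod} : proj x = 0 ↔ x ∈ total relIdeal :=
  Submodule.Quotient.mk_eq_zero _

theorem opsQ_lt (x y : FMod) : opsQ.lt (proj x) (proj y) = proj (nodeL gLt x y) := rfl
theorem opsQ_gt (x y : FMod) : opsQ.gt (proj x) (proj y) = proj (nodeL gGt x y) := rfl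
theorem opsQ_bar (x y : FMod) : opsQ.bar (proj x) (proj y) = proj (nodeL gBar x y) := rfl
theorem opsQ_parity (x : FMod) : opsQ.parity (proj x) = proj (wtD deg (-1) x) := rfl

/-- The relations hold in the quotient. -/
theorem proj_relations {r : freeK.obj 3} (hr : r ∈ relations) (a b c : FTree Gen) :
    proj (fB deg (a.arity + b.arity) (fB deg a.arity (fB deg 0 (incl 3 r) (Finsupp.single a 1))
      (Finsupp.single b 1)) (Finsupp.single c 1)) = 0 :=
  proj_eq_zero.2 (fB_fB_fB_mem_total (rel_mem hr) a b c)

/-- Each of the first seven laws is a relation composed with three trees. The parities in the laws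
come from the weight in `fB_o₂`, which is trivial unless the upper generator is |. -/
theorem opsQ_laws : opsQ.Laws := by
  -- Additivity in each variable reduces a law to the images of basis trees.
  have key : ∀ {f g : QMod → QMod → QMod → QMod}
      (_ : ∀ a b c : FTree Gen, f (proj (Finsupp.single a 1)) (proj (Finsupp.single b 1))
        (proj (Finsupp.single c 1)) = g (proj (Finsupp.single a 1)) (proj (Finsupp.single b 1))
          (proj (Finsupp.single c 1)))
      (_ : ∀ x x' y z, f (x + x') y z = f x y z + f x' y z)
      (_ : ∀ x y y' z, f x (y + y') z = f x y z + f x y' z)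
      (_ : ∀ x y z z', f x y (z + z') = f x y z + f x y z')
      (_ : ∀ x x' y z, g (x + x') y z = g x y z + g x' y z)
      (_ : ∀ x y y' z, g x (y + y') z = g x y z + g x y' z)
      (_ : ∀ x y z z', g x y (z + z') = g x y z + g x y z') (x y z : QMod),
      f x y z = g x y z := by
    intro f g h f₁ f₂ f₃ g₁ g₂ g₃ x y z
    obtain ⟨x, rfl⟩ := proj_surjective x
    obtain ⟨y, rfl⟩ := proj_surjective y
    obtain ⟨z, rfl⟩ := proj_surjective z
    refine Finsupp.eq_of_additive (f := fun x => f (proj x) (proj y) (proj z))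
      (g := fun x => g (proj x) (proj y) (proj z)) x (fun _ _ => by simp only [map_add, f₁])
      (fun _ _ => by simp only [map_add, g₁]) fun a => ?_
    refine Finsupp.eq_of_additive (f := fun y => f _ (proj y) (proj z))
      (g := fun y => g _ (proj y) (proj z)) y (fun _ _ => by simp only [map_add, f₂])
      (fun _ _ => by simp only [map_add, g₂]) fun b => ?_
    exact Finsupp.eq_of_additive (f := fun z => f _ _ (proj z)) (g := fun z => g _ _ (proj z)) z
      (fun _ _ => by simp only [map_add, f₃]) (fun _ _ => by simp only [map_add, g₃]) fun c => h a b c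
  have hrel : ∀ r ∈ relations, ∀ a b c : FTree Gen, proj (fB deg (a.arity + b.arity)
      (fB deg a.arity (fB deg 0 (incl 3 r) (Finsupp.single a 1)) (Finsupp.single b 1))
        (Finsupp.single c 1)) = 0 := fun r hr => proj_relations hr
  have e₁ := hrel (o₂ gt lt - o₁ lt gt) (by simp [relations])
  have e₂ := hrel (o₂ gt gt - (o₁ gt gt + o₁ gt lt)) (by simp [relations])
  have e₃ := hrel (o₁ lt lt - (o₂ lt lt + o₂ lt gt)) (by simp [relations])
  have e₄ := hrel (o₂ gt bar - o₁ bar gt) (by simp [relations])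
  have e₅ := hrel (o₁ lt bar - o₂ bar lt) (by simp [relations])
  have e₆ := hrel (o₁ bar lt - o₂ bar gt) (by simp [relations])
  have e₇ := hrel (o₁ bar bar - (-o₂ bar bar)) (by simp [relations])
  have hlt : lt = gen gLt := rfl
  have hgt : gt = gen gGt := rfl
  have hbar : bar = gen gBar := rfl
  simp only [map_sub, map_add, map_neg, LinearMap.sub_apply, LinearMap.add_apply,
    LinearMap.neg_apply, hlt, hgt, hbar, fB_o₁, fB_o₂, deg_gLt, deg_gGt, deg_gBar, pow_zero,
    pow_one, weight_one] at e₁ e₂ e₃ e₄ e₅ e₆ e₇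
  constructor
  · refine key (fun a b c => ?_) ?_ ?_ ?_ ?_ ?_ ?_
    · exact sub_eq_zero.1 (e₁ a b c)
    all_goals intros; simp only [map_add, LinearMap.add_apply]
  · refine key (fun a b c => ?_) ?_ ?_ ?_ ?_ ?_ ?_
    · exact sub_eq_zero.1 (e₂ a b c)
    all_goals intros; simp only [map_add, LinearMap.add_apply] <;> abel
  · refine key (fun a b c => ?_) ?_ ?_ ?_ ?_ ?_ ?_
    · exact sub_eq_zero.1 (e₃ a b c)
    all_goals intros; simp only [map_add, LinearMap.add_apply] <;> abel
  · refine key (fun a b c => ?_) ?_ ?_ ?_ ?_ ?_ ?_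
    · exact sub_eq_zero.1 (e₄ a b c)
    all_goals intros; simp only [map_add, LinearMap.add_apply]
  · refine key (fun a b c => ?_) ?_ ?_ ?_ ?_ ?_ ?_
    · exact sub_eq_zero.1 (e₅ a b c)
    all_goals intros; simp only [map_add, LinearMap.add_apply]
  · refine key (fun a b c => ?_) ?_ ?_ ?_ ?_ ?_ ?_
    · exact sub_eq_zero.1 (e₆ a b c)
    all_goals intros; simp only [map_add, LinearMap.add_apply]
  · refine key (fun a b c => ?_) ?_ ?_ ?_ ?_ ?_ ?_
    · exact sub_eq_zero.1 (e₇ a b c)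
    all_goals intros; simp only [map_add, LinearMap.add_apply, neg_add]
  · intro x y
    obtain ⟨x, rfl⟩ := proj_surjective x
    obtain ⟨y, rfl⟩ := proj_surjective y
    simp only [opsQ_lt, opsQ_parity, wtD_nodeL, deg_gLt, pow_zero, one_smul]
  · intro x y
    obtain ⟨x, rfl⟩ := proj_surjective x
    obtain ⟨y, rfl⟩ := proj_surjective y
    simp only [opsQ_gt, opsQ_parity, wtD_nodeL, deg_gGt, pow_zero, one_smul]
  · intro x y
    obtain ⟨x, rfl⟩ := proj_surjective x
    obtain ⟨y, rfl⟩ := proj_surjective y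
    simp only [opsQ_bar, opsQ_parity, wtD_nodeL, deg_gBar, pow_one, neg_one_smul, map_neg]
  · intro x
    obtain ⟨x, rfl⟩ := proj_surjective x
    rw [opsQ_parity, opsQ_parity, weight_weight, neg_mul_neg, one_mul, weight_one]
  · change opsQ.parity (proj _) = proj _
    rw [opsQ_parity, wtD_one]

/-- Evaluation in the quotient turns the products of trees into the operations of the quotient and
the unit into the unit, so it undoes `psi` vertex by vertex. An element killed by `psiL` is thus
zero modulo the relations. -/
theorem ET_psiL (x : FMod) : opsQ.ET (psiL x) = proj x := by
  apply Finsupp.eq_of_single x; intro T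
  rw [psiL_single]
  induction T with
  | leaf => exact opsQ.ET_tr unit
  | node g l r hl hr =>
    have h := opsQ_laws
    rw [← nodeL_single, psi]
    rw [← nd_bodyL (psi_mem l), opsQ.ET_nd] at hl
    rw [← nd_bodyL (psi_mem r), opsQ.ET_nd] at hr
    rcases eq_gen g with rfl | rfl | rfl
    · rw [gLt, opT_lt, ltT_apply, opsQ.ET_nd, h.EW_ltW, ← nd_bodyL (psi_mem r), opsQ.RR_nd, hl,
        hr, opsQ_lt]; rfl
    · rw [gGt, opT_gt, gtT_apply, opsQ.ET_nd, h.EW_gtW, ← nd_bodyL (psi_mem l), opsQ.LL_nd, hl,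
        hr, opsQ_gt]; rfl
    · rw [gBar, opT_bar, barT_apply, opsQ.ET_nd, ← nd_bodyL (psi_mem r), h.EW_bmW, hl,
        hr, opsQ_bar]; rfl

theorem ker_le_relIdeal (n : ℕ) (x : freeK.obj n) (hx : toKPrime.map n x = 0) :
    x ∈ relIdeal.carrier n := by
  refine mem_of_incl_mem_total (proj_eq_zero.1 ?_)
  rw [← ET_psiL, show psiL (incl n x) = 0 from congrArg Subtype.val hx, map_zero]

theorem psiL_o₁ (g h : Gen) :
    psiL (incl 3 (o₁ (gen g) (gen h))) = opT g.1 (opT h.1 (tr unit) (tr unit)) (tr unit) := by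
  rw [incl_o₁, psiL_single]; rfl

theorem psiL_o₂ (g h : Gen) :
    psiL (incl 3 (o₂ (gen g) (gen h))) = opT g.1 (tr unit) (opT h.1 (tr unit) (tr unit)) := by
  rw [incl_o₂, psiL_single]; rfl

theorem psiL_relations : ∀ r ∈ relations, psiL (incl 3 r) = 0 := by
  have hlt : lt = gen gLt := rfl
  have hgt : gt = gen gGt := rfl
  have hbar : bar = gen gBar := rfl
  have hu : tr unit = nd (pr lf (on lf)) := by rw [unit, tr_node, fo_one, tr_leaf]
  have hw : wtW (-1) (pr lf (on lf)) = pr lf (on lf) := by rw [wtW_pr, wt_lf, wtF_on, wt_lf]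
  have h₁ : ∀ x y, opT gLt.1 x y = nd (ltW (bodyL x) y) := fun x y => by
    rw [gLt, opT_lt, ltT_apply]
  have h₂ : ∀ x y, opT gGt.1 x y = nd (gtW x (bodyL y)) := fun x y => by
    rw [gGt, opT_gt, gtT_apply]
  have h₃ : ∀ x y, opT gBar.1 x y = nd (bmW (bodyL x) y) := fun x y => by
    rw [gBar, opT_bar, barT_apply]
  -- All that matters about the unit is that it has a root and even degree; the relations are then
  -- instances of the general identities between products.
  generalize pr lf (on lf) = w at hu hw
  have hw' : wt (-1) (nd w) = nd w := by rw [wt_nd, hw]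
  apply forall_relations <;>
    simp only [map_sub, map_add, map_neg, hlt, hgt, hbar, psiL_o₁, psiL_o₂, h₁, h₂, h₃, hu,
      bodyL_nd]
  · rw [ltW_gtW, sub_self]
  · rw [gtW_gtW, sh_nd_nd]
    simp only [map_add, LinearMap.add_apply]; abel
  · rw [ltW_ltW, sh_nd_nd]
    simp only [map_add]; abel
  · rw [bmW_gtW, hw', sub_self]
  · rw [bmW_nd_ltW, sub_self]
  · rw [bmW_nd_gtW, sub_self]
  · have := bmW_nd_bmW w w (nd w)
    rw [hw] at this
    rw [this, map_neg, neg_neg, sub_self]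

theorem relIdeal_eq_ker (n : ℕ) : relIdeal.carrier n = LinearMap.ker (toKPrime.map n) :=
  le_antisymm
    (freeK.idealSpan_le toKPrime.ker (fun r hr => Subtype.ext (psiL_relations r hr)) n)
    (ker_le_relIdeal n)

/-- The isomorphism between the quotient of `freeK` by the relations and `K'`. -/
noncomputable def quotientIsoKPrime :
    (freeK.quotient relIdeal relIdeal_stable.2).Iso KPrime :=
  toKPrime.quotientIso relIdeal relIdeal_stable.2 relIdeal_eq_ker toKPrime_surjective toKPrime_lift

theorem psi_gen (g : Gen) : psi (.node g .leaf .leaf) = tr g.1 := by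
  rw [psi, psi, unit, tr_node, fo_one, tr_leaf]
  rcases eq_gen g with rfl | rfl | rfl
  · rw [gLt, opT_lt, ltT_apply, bodyL_nd, ltW_pr, shl_on, sh_lf_left]
    change _ = tr (.node .leaf (.one (.node .leaf (.one .leaf))))
    rw [tr_node, fo_one, tr_node, fo_one, tr_leaf]
  · rw [gGt, opT_gt, gtT_apply, bodyL_nd, gtW_pr, sh_lf_right]
    change _ = tr (.node (.node .leaf (.one .leaf)) (.one .leaf))
    rw [tr_node, fo_one, tr_node, fo_one, tr_leaf]
  · rw [gBar, opT_bar, barT_apply, bodyL_nd, bmW_pr, wt_lf, bm_on, gtW_lf]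
    change _ = tr (.node .leaf (.cons .leaf (.one .leaf)))
    rw [tr_node, fo_cons, fo_one, tr_leaf]

theorem toKPrime_gen (g : Gen) : toKPrime.map 2 (gen g) = KPrime.cell g :=
  Subtype.ext ((psiL_single _).trans (psi_gen g))

end freeK

theorem mainTheorem6 :
    KPrime.IsDGOperad ∧ freeK.IsDGOperad ∧
      (∃ (hd : (freeK.idealSpan freeK.relations).IsDStable)
        (e : (freeK.quotient (freeK.idealSpan freeK.relations) hd).Iso KPrime),
        ∀ T : PTree.cells 2,
          e.equiv 2 (((freeK.idealSpan freeK.relations).carrier 2).mkQ (freeK.gen T)) =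
            KPrime.cell T) ∧
      KPrime.IsBinaryQuadratic :=
  ⟨KPrime_isDGOperad, freeK.isDGOperad,
    ⟨freeK.relIdeal_stable.2, freeK.quotientIsoKPrime, freeK.toKPrime_gen⟩,
    ⟨_, _, _, freeK.relations, freeK.relIdeal_stable.2, freeK.isDGOperad,
      ⟨freeK.quotientIsoKPrime⟩⟩⟩
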